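/- **Setting.** Let $k$ be a field, $Q$ a finite quiver and $I$ an admissible ideal of $kQ$ generated by paths of length two, such that $(Q,I)$ is gentle: at most two arrows start and at most two arrows end at each vertex, and for each arrow $a$ there is at most one arrow $b$ with $s(b)=e(a)$ and $ba\notin I$, at most one arrow $b$ with $s(b)=e(a)$ and $ba\in I$, and dually for the products $ac$ with $s(a)=e(c)$ (paths are read from right to left; $s$ and $e$ denote start and end). Let $\Lambda$ be a $k$-algebra Morita equivalent to $kQ/I$. We use left modules, and maps are composed from left to right; $P(x)$ is the projective module corresponding to $(kQ/I)e_x$. A nonzero path $p$ of $(Q,I)$ induces by right multiplication a map $P(e(p))\to P(s(p))$, again denoted $p$. **Homotopy strings.** A homotopy string $\sigma=\sigma_n\cdots\sigma_1$, possibly infinite to the left and/or to the right, is a reduced walk of arrows and inverse arrows of $Q$, cut into its homotopy letters: each letter is a path of positive length in $(Q,I)$, i.e. not in $I$ (direct letter), or the inverse $\bar p$ of such a path (inverse letter), and at the boundary of two consecutive letters either the direction changes or the two adjacent arrows form a relation in $I$. A trivial homotopy string is a single vertex. If $\sigma$ is left infinite, then far enough to the left all letters are single direct arrows; if it is right infinite,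 then far enough to the right all letters are single inverse arrows. The string complex $P^\bullet_\sigma$ is the direct sum of the modules $P(x)$ over the vertices $x$ between consecutive letters and at the ends of $\sigma$, with differential given by the letters: a direct letter maps its left vertex to its right vertex, an inverse letter $\bar p$ gives the map $p$ from its right vertex to its left vertex. Every vertex carries a cohomological degree, and the letters raise the degree by one. We put $P^\bullet_\emptyset=0$, where the empty string $\emptyset$ has no vertex. **Graph maps.** Suppose that $\sigma=\beta\,\sigma_L\,\rho\,\sigma_R\,\alpha$ and $\tau=\delta\,\tau_L\,\rho\,\tau_R\,\gamma$, where $\rho$ is a common homotopy substring (finite, possibly trivial, or infinite), sitting in the same cohomological degrees in $\sigma$ and $\tau$, where $\sigma_L,\sigma_R,\tau_L,\tau_R$ are homotopy letters or empty, and $\alpha,\beta,\gamma,\delta$ are homotopy substrings; if a letter is empty, so is the adjacent substring. If $\rho$ has a right end, one of the following holds: * (RG1) $\sigma_R$, $\tau_R$ are direct and $\tau_R=\sigma_Rf_R$ for a nontrivial path $f_R$; * (RG2) $\sigma_R$, $\tau_R$ are inverse and $\bar\sigma_R=f_R\bar\tau_R$ for a nontrivial path $f_R$; * (RG3) $\sigma_R$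 is direct or empty, $\tau_R$ is inverse or empty, and there is no $f_R$. If $\rho$ has a left end, one of the following holds: * (LG1) $\sigma_L$, $\tau_L$ are direct and $\sigma_L=f_L\tau_L$ for a nontrivial path $f_L$; * (LG2) $\sigma_L$, $\tau_L$ are inverse and $\bar\tau_L=\bar\sigma_Lf_L$ for a nontrivial path $f_L$; * (LG3) $\sigma_L$ is inverse or empty, $\tau_L$ is direct or empty, and there is no $f_L$. (So $\rho$ is a maximal common substring.) The graph map $f^\bullet\colon P^\bullet_\sigma\to P^\bullet_\tau$ is the chain map whose components are the identities on the vertices of $\rho$, together with $f_L$ and $f_R$, where these exist, at the vertices next to $\rho$. **Compatible orientation.** If $\rho$ is trivial and (RG3) and (LG3) hold, then $\sigma,\tau$ are called compatibly oriented if (a) $\bar\tau_R\sigma_R\notin I$ if $\sigma_R,\tau_R\ne\emptyset$, and $\sigma_L\bar\tau_L$ is not the inverse of a path in $I$ if $\sigma_L,\tau_L\neq\emptyset$; and (b) if $\sigma_L=\tau_R=\emptyset$ and $\tau_L,\sigma_R\ne\emptyset$ then $\tau_L\sigma_R\in I$; if $\sigma_R=\tau_L=\emptyset$ and $\sigma_L,\tau_R\neq\emptyset$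 then $\sigma_L\tau_R$ is the inverse of a path in $I$. In all other cases $\sigma$ and $\tau$ are compatibly oriented without further condition. **Theorem.** Let $\sigma$ and $\tau$ be (possibly infinite) homotopy strings and $f^\bullet\colon P^\bullet_\sigma\to P^\bullet_\tau$ a graph map as above, such that $\sigma$ and $\tau$ are compatibly oriented. Let $M^\bullet_{f^\bullet}$ be its mapping cone, $M^n=P_\sigma^{n+1}\oplus P_\tau^n$. Put $$ c_1=\begin{cases}\bar\gamma\,\bar\tau_R\sigma_R\,\alpha&\text{if }\sigma_R\ne\emptyset\text{ and }\tau_R\neq\emptyset,\\ \bar\gamma&\text{if }\sigma_R=\emptyset,\\ \alpha&\text{if }\tau_R=\emptyset,\\ \emptyset&\text{if }\sigma_R=\tau_R=\emptyset,\end{cases} \qquad c_2=\begin{cases}\beta\,\sigma_L\bar\tau_L\,\bar\delta&\text{if }\sigma_L\ne\emptyset\text{ and }\tau_L\neq\emptyset,\\ \bar\delta&\text{if }\sigma_L=\emptyset,\\ \beta&\text{if }\tau_L=\emptyset,\\ \emptyset&\text{if }\sigma_L=\tau_L=\emptyset,\end{cases} $$ where $c_1$ is defined if $\rho$ has a right end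 and $c_2$ if $\rho$ has a left end, the products $\bar\tau_R\sigma_R$ and $\sigma_L\bar\tau_L$ are freely reduced and form a single homotopy letter, and the vertices of $\gamma$, $\delta$ keep their degrees in $P^\bullet_\tau$, while those of $\alpha$, $\beta$ have their degrees in $P^\bullet_\sigma$ lowered by one. Then the strings that occur below are homotopy strings (or empty), and: 1. If $\rho$ is finite, then $M^\bullet_{f^\bullet}\cong P^\bullet_{c_1}\oplus P^\bullet_{c_2}$ in $\mathsf K^{b,-}(\operatorname{proj}\Lambda)$. 2. If $\rho$ is infinite to the left only, so that $\sigma=\rho\sigma_R\alpha$ and $\tau=\rho\tau_R\gamma$, then $M^\bullet_{f^\bullet}\cong P^\bullet_{c_1}$. Dually, if $\rho$ is infinite to the right only, so that $\sigma=\beta\sigma_L\rho$ and $\tau=\delta\tau_L\rho$, then $M^\bullet_{f^\bullet}\cong P^\bullet_{c_2}$. If $\rho$ is infinite in both directions, then $M^\bullet_{f^\bullet}\cong P^\bullet_\emptyset=0$. -/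

import Mathlib

open CategoryTheory

universe u

noncomputable section

/-! ### Gentle algebras -/

/-- A finite quiver `Q` with vertices `V` and arrows `A`, where the arrow `a` starts at `s a` and
ends at `t a`, together with a set of paths of length two: `rel b a` says that the path `ba`
(first `a`, then `b`; paths are read from right to left) is one of the chosen relations.
`I` denotes the ideal of the path algebra generated by these relations. -/
structure BoundQuiver where
  V : Type u
  A : Type u
  [fintypeV : Fintype V]
  [fintypeA : Fintype A]
  s : A → V
  t : A → V
  rel : A → A → Prop
  rel_comp : ∀ {b a : A}, rel b a → s b = t a

attribute [instance] BoundQuiver.fintypeV BoundQuiver.fintypeA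

namespace BoundQuiver

variable (Q : BoundQuiver.{u})

/-- `Q.IsPath p x y`: the nonempty list of arrows `p = [aₙ, …, a₁]` is a path `aₙ ⋯ a₁` in `(Q, I)`
which starts at `y` and ends at `x`, that is, a path of the quiver which does not lie in `I`
(as `I` is generated by paths of length two, this means that no two consecutive arrows
form a relation). -/
structure IsPath (p : List Q.A) (x y : Q.V) : Prop where
  target : p.head?.map Q.t = some x
  source : p.getLast?.map Q.s = some y
  chain : p.IsChain (fun b a => Q.s b = Q.t a ∧ ¬ Q.rel b a)

/-- `(Q, I)` is gentle. That `I` is generated by monomial relations of length two is built into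
`BoundQuiver`; `admissible` says that `I` is an admissible ideal. -/
structure IsGentle : Prop where
  admissible : ∃ N : ℕ, ∀ p x y, Q.IsPath p x y → p.length ≤ N
  card_start : ∀ x, {a | Q.s a = x}.ncard ≤ 2
  card_end : ∀ x, {a | Q.t a = x}.ncard ≤ 2
  nonrel_left : ∀ a b b', Q.s b = Q.t a → ¬ Q.rel b a → Q.s b' = Q.t a → ¬ Q.rel b' a → b = b'
  nonrel_right : ∀ a c c', Q.s a = Q.t c → ¬ Q.rel a c → Q.s a = Q.t c' → ¬ Q.rel a c' → c = c'
  rel_left : ∀ a b b', Q.rel b a → Q.rel b' a → b = b'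
  rel_right : ∀ a c c', Q.rel a c → Q.rel a c' → c = c'

section Algebra

variable (k : Type u) [Field k]

/-- The defining relations of `kQ/I` on the generators `V ⊔ A`: the vertices are orthogonal
idempotents with sum `1`, each arrow `a` satisfies `e_{t a} a e_{s a} = a`, and the
relations `ba` are zero. -/
inductive AlgRel : FreeAlgebra k (Q.V ⊕ Q.A) → FreeAlgebra k (Q.V ⊕ Q.A) → Prop
  | idem (x : Q.V) : AlgRel (FreeAlgebra.ι k (.inl x) * FreeAlgebra.ι k (.inl x))
      (FreeAlgebra.ι k (.inl x))
  | orth (x y : Q.V) : x ≠ y → AlgRel (FreeAlgebra.ι k (.inl x) * FreeAlgebra.ι k (.inl y)) 0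
  | one : AlgRel (∑ x : Q.V, FreeAlgebra.ι k (.inl x)) 1
  | left (a : Q.A) : AlgRel (FreeAlgebra.ι k (.inl (Q.t a)) * FreeAlgebra.ι k (.inr a))
      (FreeAlgebra.ι k (.inr a))
  | right (a : Q.A) : AlgRel (FreeAlgebra.ι k (.inr a) * FreeAlgebra.ι k (.inl (Q.s a)))
      (FreeAlgebra.ι k (.inr a))
  | rel (b a : Q.A) : Q.rel b a →
      AlgRel (FreeAlgebra.ι k (.inr b) * FreeAlgebra.ι k (.inr a)) 0

/-- The algebra `kQ/I`, by generators and relations. -/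
def Alg : Type u := RingQuot (Q.AlgRel k)

instance : Ring (Q.Alg k) := inferInstanceAs (Ring (RingQuot (Q.AlgRel k)))
instance : Algebra k (Q.Alg k) := inferInstanceAs (Algebra k (RingQuot (Q.AlgRel k)))

/-- The idempotent of `kQ/I` at the vertex `x`. -/
def e (x : Q.V) : Q.Alg k := RingQuot.mkAlgHom k (Q.AlgRel k) (FreeAlgebra.ι k (.inl x))

/-- The element of `kQ/I` given by the arrow `a`. -/
def arr (a : Q.A) : Q.Alg k := RingQuot.mkAlgHom k (Q.AlgRel k) (FreeAlgebra.ι k (.inr a))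

/-- The indecomposable projective left module `P(x) = Λ e_x` over `Λ = kQ/I`. -/
def P (x : Q.V) : Submodule (Q.Alg k) (Q.Alg k) := Ideal.span {Q.e k x}

lemma e_mul_e (x : Q.V) : Q.e k x * Q.e k x = Q.e k x := by
  have := RingQuot.mkAlgHom_rel k (AlgRel.idem (Q := Q) (k := k) x)
  rwa [map_mul] at this

lemma e_mul_e_of_ne {x y : Q.V} (h : x ≠ y) : Q.e k x * Q.e k y = 0 := by
  have := RingQuot.mkAlgHom_rel k (AlgRel.orth (Q := Q) (k := k) x y h)
  rwa [map_mul, map_zero] at this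

lemma e_mul_arr (a : Q.A) : Q.e k (Q.t a) * Q.arr k a = Q.arr k a := by
  have := RingQuot.mkAlgHom_rel k (AlgRel.left (Q := Q) (k := k) a)
  rwa [map_mul] at this

lemma arr_mul_e (a : Q.A) : Q.arr k a * Q.e k (Q.s a) = Q.arr k a := by
  have := RingQuot.mkAlgHom_rel k (AlgRel.right (Q := Q) (k := k) a)
  rwa [map_mul] at this

lemma arr_mul_arr_of_rel {b a : Q.A} (h : Q.rel b a) : Q.arr k b * Q.arr k a = 0 := by
  have := RingQuot.mkAlgHom_rel k (AlgRel.rel (Q := Q) (k := k) b a h)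
  rwa [map_mul, map_zero] at this

lemma arr_mul_arr_of_ne {b a : Q.A} (h : Q.s b ≠ Q.t a) : Q.arr k b * Q.arr k a = 0 := by
  rw [← Q.arr_mul_e k b, ← Q.e_mul_arr k a, mul_assoc, ← mul_assoc (Q.e k _) (Q.e k _),
    Q.e_mul_e_of_ne k h, zero_mul, mul_zero]

lemma mem_P {x : Q.V} {y : Q.Alg k} : y ∈ Q.P k x ↔ y * Q.e k x = y := by
  unfold P
  rw [Ideal.mem_span_singleton']
  constructor
  · rintro ⟨z, rfl⟩
    rw [mul_assoc, e_mul_e]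
  · intro h
    exact ⟨y, h⟩

end Algebra

/-! ### Homotopy strings -/

/-- Words in the arrows and the inverse arrows: `(a, true)` is the arrow `a` and `(a, false)` is its
formal inverse. The empty word stands for the empty homotopy letter `∅`. The inverse of the
word `w` is `FreeGroup.invRev w`. -/
abbrev Word := List (Q.A × Bool)

variable {Q}

/-- The word of a path. -/
def direct (p : List Q.A) : Q.Word := p.map (fun a => (a, true))

/-- The word of the inverse of a path. -/
def inverse (p : List Q.A) : Q.Word := FreeGroup.invRev (direct p)

/-- The word `w` is a path in `(Q, I)` or the inverse of a path in `(Q, I)`. -/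
def NonzeroWord (w : Q.Word) : Prop :=
  ∃ p x y, Q.IsPath p x y ∧ (w = direct p ∨ w = inverse p)

/-- Condition for `u v` to occur in a walk with a boundary between homotopy letters
between `u` and `v`: either `u` and `v` are both arrows, or both inverse arrows, and their product
is a relation (respectively the inverse of a relation), or one of them is an arrow and the other one
is an inverse arrow, and they do not cancel. -/
def Boundary : Q.A × Bool → Q.A × Bool → Prop
  | (b, true), (a, true) => Q.rel b a
  | (b, false), (a, false) => Q.rel a b
  | (b, true), (a, false) => b ≠ a
  | (b, false), (a, true) => b ≠ a

/-- The word `w'` can be followed (on its right) by `w` as the next homotopy letter. -/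
def Junction (w' w : Q.Word) : Prop :=
  ∀ u ∈ w'.getLast?, ∀ v ∈ w.head?, Boundary u v

variable (Q)

/-- The data of a (possibly infinite) walk `⋯ σ₂ σ₁ σ₀ σ₋₁ ⋯` in its decomposition into homotopy
letters, with cohomological degrees. Positions decrease from left to right, as in the notation
`σₙ ⋯ σ₁`. If there is a vertex at position `i`, then `vtx i = some (x, n)`, where `x` is this
vertex and `n` the cohomological degree in which `P(x)` sits. The homotopy letter between the
positions `i` and `i - 1` is `letter i`; it is `∅` if there is none. -/
structure GradedWalk where
  vtx : ℤ → Option (Q.V × ℤ)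
  letter : ℤ → Q.Word

variable {Q}

namespace GradedWalk

/-- The set of positions of the vertices of a walk. -/
def pos (w : Q.GradedWalk) : Set ℤ := {i | w.vtx i ≠ none}

/-- `w` is a (finite, left infinite, right infinite or two-sided infinite) homotopy string
with its decomposition into homotopy letters and a choice of cohomological degrees
that is compatible with the letters: a direct letter `p` at `i` gives a map
`P(e(p)) → P(s(p))` from position `i` to position `i - 1`, an inverse letter one in the other
direction, and these maps raise the degree by one. A string with a single position is a
trivial homotopy string. The string `∅` without positions is also allowed. -/
structure IsHomotopyString (w : Q.GradedWalk) : Prop where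
  ordConnected : w.pos.OrdConnected
  letter_spec : ∀ i x m y n, w.vtx i = some (x, m) → w.vtx (i - 1) = some (y, n) →
    (∃ p, Q.IsPath p x y ∧ w.letter i = direct p ∧ n = m + 1) ∨
    (∃ p, Q.IsPath p y x ∧ w.letter i = inverse p ∧ m = n + 1)
  letter_empty : ∀ i, w.vtx i = none ∨ w.vtx (i - 1) = none → w.letter i = []
  junction : ∀ i, Junction (w.letter (i + 1)) (w.letter i)
  left_infinite : ¬ BddAbove w.pos → ∃ N, ∀ i, N ≤ i → ∃ a, w.letter i = [(a, true)]
  right_infinite : ¬ BddBelow w.pos → ∃ N, ∀ i, i ≤ N → ∃ a, w.letter i = [(a, false)]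

/-- The empty string `∅`. -/
def empty : Q.GradedWalk := ⟨fun _ => none, fun _ => []⟩

/-- The part of a walk strictly to the right of position `a`. -/
def below (w : Q.GradedWalk) (a : ℤ) : Q.GradedWalk where
  vtx i := if i < a then w.vtx i else none
  letter i := if i < a then w.letter i else []

/-- The part of a walk strictly to the left of position `b`. -/
def above (w : Q.GradedWalk) (b : ℤ) : Q.GradedWalk where
  vtx i := if b < i then w.vtx i else none
  letter i := if b + 1 < i then w.letter i else []

/-- The inverse of a walk, where the vertex at position `i` is moved to position `N - i`. -/
def bar (w : Q.GradedWalk) (N : ℤ) : Q.GradedWalk where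
  vtx i := w.vtx (N - i)
  letter i := FreeGroup.invRev (w.letter (N + 1 - i))

/-- The same walk with all degrees lowered by one, as for `Σ P`, where `(Σ P)ⁿ = Pⁿ⁺¹`. -/
def susp (w : Q.GradedWalk) : Q.GradedWalk where
  vtx i := (w.vtx i).map (fun v => (v.1, v.2 - 1))
  letter := w.letter

/-- The concatenation `l v r`, where `v` is a single homotopy letter, at position `a`; it is meant
for `l` with positions `≥ a` and `r` with positions `< a`. -/
def concat (a : ℤ) (l : Q.GradedWalk) (v : Q.Word) (r : Q.GradedWalk) : Q.GradedWalk where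
  vtx i := if i < a then r.vtx i else l.vtx i
  letter i := if i < a then r.letter i else if i = a then v else l.letter i

end GradedWalk

/-! ### String complexes -/

section Complex

variable (k : Type u) [Field k]

open Classical in
/-- The element of `kQ/I` given by a direct homotopy letter; `0` for all other words. Right
multiplication with the element of a path `p` is the map `P(e(p)) → P(s(p))` given by `p`. -/
def letterElt (w : Q.Word) : Q.Alg k :=
  if w ≠ [] ∧ ∀ u ∈ w, u.2 = true then (w.map (fun u => Q.arr k u.1)).prod else 0

lemma letterElt_nil : letterElt k ([] : Q.Word) = 0 := by simp [letterElt]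

lemma letterElt_direct_nil : letterElt k (direct ([] : List Q.A)) = 0 := letterElt_nil k

lemma letterElt_direct {p : List Q.A} (hp : p ≠ []) :
    letterElt k (direct p) = (p.map (Q.arr k)).prod := by
  simp [letterElt, direct, hp, Function.comp_def]

lemma letterElt_inverse (p : List Q.A) : letterElt k (inverse p) = 0 := by
  rcases p with _ | ⟨a, p⟩
  · simp [letterElt, direct, inverse]
  · refine if_neg fun h => ?_
    simpa using h.2 (a, false) (by simp [direct, inverse, FreeGroup.invRev])

lemma invRev_inverse (p : List Q.A) : FreeGroup.invRev (inverse p) = direct p :=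
  FreeGroup.invRev_invRev

lemma invRev_direct (p : List Q.A) : FreeGroup.invRev (direct p) = inverse p := rfl

lemma direct_append (p q : List Q.A) : direct (p ++ q) = direct p ++ direct q := by simp [direct]

lemma inverse_append (p q : List Q.A) : inverse (p ++ q) = inverse q ++ inverse p := by
  simp [inverse, direct_append]

lemma exists_of_letterElt_ne_zero {w : Q.Word} (h : letterElt k w ≠ 0) :
    ∃ p, p ≠ [] ∧ w = direct p := by
  unfold letterElt at h
  split_ifs at h with h'
  · refine ⟨w.map Prod.fst, by simpa using h'.1, ?_⟩
    rw [direct, List.map_map]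
    conv_lhs => rw [← List.map_id w]
    refine List.map_congr_left fun u hu => ?_
    exact Prod.ext rfl (h'.2 u hu)
  · exact absurd rfl h

lemma letterElt_mul_invRev (w : Q.Word) :
    letterElt k w * letterElt k (FreeGroup.invRev w) = 0 := by
  by_cases h : letterElt k w = 0
  · rw [h, zero_mul]
  · obtain ⟨p, -, rfl⟩ := exists_of_letterElt_ne_zero k h
    rw [invRev_direct, letterElt_inverse, mul_zero]

lemma mul_letterElt {p : List Q.A} {x y : Q.V} (h : Q.IsPath p x y) :
    letterElt k (direct p) * Q.e k y = letterElt k (direct p) := by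
  rcases List.eq_nil_or_concat p with rfl | ⟨p, a, rfl⟩
  · simp [direct, letterElt]
  · have h2 := h.source
    simp only [List.concat_eq_append, List.getLast?_append, List.getLast?_singleton,
      Option.some_or, Option.map_some, Option.some.injEq] at h2
    subst h2
    rw [letterElt_direct k (by simp)]
    simp [mul_assoc, arr_mul_e]

lemma isPath_ne_nil {p : List Q.A} {x y : Q.V} (h : Q.IsPath p x y) : p ≠ [] := by
  rintro rfl
  simpa using h.target

lemma e_mul_letterElt {p : List Q.A} {x y : Q.V} (h : Q.IsPath p x y) :
    Q.e k x * letterElt k (direct p) = letterElt k (direct p) := by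
  rcases p with _ | ⟨a, p⟩
  · simp [direct, letterElt]
  · have h2 := h.target
    simp only [List.head?_cons, Option.map_some, Option.some.injEq] at h2
    subst h2
    rw [letterElt_direct k (by simp)]
    simp [← mul_assoc, e_mul_arr]

lemma Boundary.symm {u v : Q.A × Bool} (h : Boundary u v) :
    Boundary (v.1, !v.2) (u.1, !u.2) := by
  rcases u with ⟨u, _ | _⟩ <;> rcases v with ⟨v, _ | _⟩ <;> simpa [Boundary, eq_comm] using h

lemma Junction.symm {w' w : Q.Word} (h : Junction w' w) :
    Junction (FreeGroup.invRev w) (FreeGroup.invRev w') := by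
  intro u hu v hv
  simp only [FreeGroup.invRev, List.getLast?_reverse, List.head?_reverse, List.head?_map,
    List.getLast?_map, Option.mem_def, Option.map_eq_some_iff] at hu hv
  obtain ⟨u, hu, rfl⟩ := hu
  obtain ⟨v, hv, rfl⟩ := hv
  exact (h v hv u hu).symm

lemma mul_eq_zero_of_arr {p q : List Q.A} {b a : Q.A} (hb : b ∈ p.getLast?) (ha : a ∈ q.head?)
    (h : Q.arr k b * Q.arr k a = 0) : letterElt k (direct p) * letterElt k (direct q) = 0 := by
  rcases List.eq_nil_or_concat p with rfl | ⟨p, b', rfl⟩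
  · simp at hb
  rcases q with _ | ⟨a', q⟩
  · simp at ha
  simp only [List.concat_eq_append, List.getLast?_append, List.getLast?_singleton, Option.some_or,
    Option.mem_def, Option.some.injEq, List.head?_cons] at hb ha
  subst hb ha
  rw [letterElt_direct k (by simp), letterElt_direct k (by simp)]
  simp only [List.concat_eq_append, List.map_append, List.map_cons, List.map_nil,
    List.prod_append, List.prod_cons, List.prod_nil, mul_one]
  rw [mul_assoc, ← mul_assoc (Q.arr k b'), h, zero_mul, mul_zero]

lemma Junction.mul_eq_zero {w' w : Q.Word} (h : Junction w' w) :
    letterElt k w' * letterElt k w = 0 := by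
  by_cases h1 : letterElt k w' = 0
  · rw [h1, zero_mul]
  by_cases h2 : letterElt k w = 0
  · rw [h2, mul_zero]
  obtain ⟨p, hp, rfl⟩ := exists_of_letterElt_ne_zero k h1
  obtain ⟨q, hq, rfl⟩ := exists_of_letterElt_ne_zero k h2
  obtain ⟨b, hb⟩ := Option.ne_none_iff_exists'.1 (mt List.getLast?_eq_none_iff.1 hp)
  obtain ⟨a, ha⟩ := Option.ne_none_iff_exists'.1 (mt List.head?_eq_none_iff.1 hq)
  exact mul_eq_zero_of_arr k hb ha (Q.arr_mul_arr_of_rel k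
    (h (b, true) (by simp [direct, hb]) (a, true) (by simp [direct, ha])))

lemma mul_letterElt_right {f : List Q.A} {y : Q.V} (h : f.getLast?.map Q.s = some y) :
    letterElt k (direct f) * Q.e k y = letterElt k (direct f) := by
  rcases List.eq_nil_or_concat f with rfl | ⟨p, a, rfl⟩
  · simp [direct, letterElt]
  · simp only [List.concat_eq_append, List.getLast?_append, List.getLast?_singleton,
      Option.some_or, Option.map_some, Option.some.injEq] at h
    subst h
    rw [letterElt_direct k (by simp)]
    simp [mul_assoc, arr_mul_e]

lemma isPath_source_append {p f : List Q.A} {x y : Q.V} (h : Q.IsPath (p ++ f) x y)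
    (hf : f ≠ []) : f.getLast?.map Q.s = some y := by
  rw [← h.source, List.getLast?_append_of_ne_nil _ hf]

lemma isPath_junction {p q : List Q.A} {x y : Q.V} (h : Q.IsPath (p ++ q) x y) :
    ∀ b ∈ p.getLast?, ∀ a ∈ q.head?, Q.s b = Q.t a ∧ ¬ Q.rel b a :=
  (List.isChain_append.1 h.chain).2.2

lemma isPath_source_left {f q : List Q.A} {x y z : Q.V} (h : Q.IsPath (f ++ q) x y)
    (hq : q.head?.map Q.t = some z) (hf : f ≠ []) : f.getLast?.map Q.s = some z := by
  obtain ⟨b, hb⟩ := Option.ne_none_iff_exists'.1 (mt List.getLast?_eq_none_iff.1 hf)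
  obtain ⟨a, ha, rfl⟩ := Option.map_eq_some_iff.1 hq
  rw [hb, Option.map_some, (isPath_junction h b hb a ha).1]

lemma Junction.of_append_left {p f : List Q.A} {w : Q.Word} (h : Junction (direct (p ++ f)) w)
    (hf : f ≠ []) : Junction (direct f) w := by
  rw [direct_append] at h
  intro u hu
  refine h u ?_
  rwa [List.getLast?_append_of_ne_nil _ (by simpa [direct] using hf)]

lemma Junction.of_append_right {f q : List Q.A} {w : Q.Word} (h : Junction w (direct (f ++ q)))
    (hf : f ≠ []) : Junction w (direct f) := by
  rw [direct_append] at h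
  intro u hu v hv
  refine h u hu v ?_
  rwa [List.head?_append_of_ne_nil _ (by simpa [direct] using hf)]

lemma mul_eq_zero_of_inverse_left (hQ : Q.IsGentle) {f q : List Q.A} {x y : Q.V} {w : Q.Word}
    (h : Q.IsPath (f ++ q) x y) (hf : f ≠ []) (hq : q ≠ []) (hJ : Junction (inverse q) w) :
    letterElt k (direct f) * letterElt k w = 0 := by
  by_cases h2 : letterElt k w = 0
  · rw [h2, mul_zero]
  obtain ⟨r, hr, rfl⟩ := exists_of_letterElt_ne_zero k h2
  obtain ⟨l, hl⟩ := Option.ne_none_iff_exists'.1 (mt List.getLast?_eq_none_iff.1 hf)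
  obtain ⟨a, ha⟩ := Option.ne_none_iff_exists'.1 (mt List.head?_eq_none_iff.1 hq)
  obtain ⟨c, hc⟩ := Option.ne_none_iff_exists'.1 (mt List.head?_eq_none_iff.1 hr)
  refine mul_eq_zero_of_arr k hl hc ?_
  have hne : a ≠ c := hJ (a, false) (by simp [inverse, direct, FreeGroup.invRev, ha])
    (c, true) (by simp [direct, hc])
  by_cases h3 : Q.s l = Q.t c
  · by_cases h4 : Q.rel l c
    · exact Q.arr_mul_arr_of_rel k h4
    · have := isPath_junction h l hl a ha
      exact absurd (hQ.nonrel_right l a c this.1 this.2 h3 h4) hne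
  · exact Q.arr_mul_arr_of_ne k h3

lemma mul_eq_zero_of_inverse_right (hQ : Q.IsGentle) {q f : List Q.A} {x y : Q.V} {w : Q.Word}
    (h : Q.IsPath (q ++ f) x y) (hq : q ≠ []) (hf : f ≠ []) (hJ : Junction w (inverse q)) :
    letterElt k w * letterElt k (direct f) = 0 := by
  by_cases h2 : letterElt k w = 0
  · rw [h2, zero_mul]
  obtain ⟨r, hr, rfl⟩ := exists_of_letterElt_ne_zero k h2
  obtain ⟨l, hl⟩ := Option.ne_none_iff_exists'.1 (mt List.getLast?_eq_none_iff.1 hq)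
  obtain ⟨a, ha⟩ := Option.ne_none_iff_exists'.1 (mt List.head?_eq_none_iff.1 hf)
  obtain ⟨c, hc⟩ := Option.ne_none_iff_exists'.1 (mt List.getLast?_eq_none_iff.1 hr)
  refine mul_eq_zero_of_arr k hc ha ?_
  have hne : c ≠ l := hJ (c, true) (by simp [direct, hc]) (l, false)
    (by simp [inverse, direct, FreeGroup.invRev, hl])
  by_cases h3 : Q.s c = Q.t a
  · by_cases h4 : Q.rel c a
    · exact Q.arr_mul_arr_of_rel k h4
    · have := isPath_junction h l hl a ha
      exact absurd (hQ.nonrel_left a c l h3 h4 this.1 this.2) hne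
  · exact Q.arr_mul_arr_of_ne k h3

namespace GradedWalk

variable {w w' : Q.GradedWalk}

variable (w) in
/-- The summand at position `i` of the string complex in degree `n`: it is `P(x)` if
there is a vertex `x` of degree `n` at position `i`, and zero otherwise. -/
def summand (i n : ℤ) : Submodule (Q.Alg k) (Q.Alg k) :=
  match w.vtx i with
  | some (x, m) => if m = n then Q.P k x else ⊥
  | none => ⊥

variable (w) in
/-- The direct sum of all `P(x)` for the vertices `x` of degree `n` of the walk, as a module of row
vectors with finite support and entries in `Λ`. -/
def term (n : ℤ) : Submodule (Q.Alg k) (ℤ →₀ Q.Alg k) :=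
  ⨅ i, (w.summand k i n).comap (Finsupp.lapply i)

/-- The map of row vectors given by right multiplication with the matrix with rows `M i`. -/
abbrev mulMatrix (M : ℤ → (ℤ →₀ Q.Alg k)) : (ℤ →₀ Q.Alg k) →ₗ[Q.Alg k] (ℤ →₀ Q.Alg k) :=
  Finsupp.linearCombination (Q.Alg k) M

variable (w) in
/-- The rows of the matrix of the differential: a direct letter at `i` maps position `i` to
position `i - 1`, an inverse letter at `i + 1` maps position `i` to position `i + 1`. -/
def dRow (i : ℤ) : ℤ →₀ Q.Alg k :=
  Finsupp.single (i - 1) (letterElt k (w.letter i)) +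
    Finsupp.single (i + 1) (letterElt k (FreeGroup.invRev (w.letter (i + 1))))

lemma mem_term {n : ℤ} {v : ℤ →₀ Q.Alg k} : v ∈ w.term k n ↔ ∀ i, v i ∈ w.summand k i n := by
  simp [term]

lemma single_mem_term {n i : ℤ} {y : Q.Alg k} (h : y ∈ w.summand k i n) :
    Finsupp.single i y ∈ w.term k n := by
  rw [mem_term]
  intro j
  by_cases hj : i = j
  · subst hj; simpa using h
  · rw [Finsupp.single_eq_of_ne (by tauto)]; exact Submodule.zero_mem _

lemma mulMatrix_mem {M : ℤ → (ℤ →₀ Q.Alg k)} {n n' : ℤ}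
    (h : ∀ i, ∀ y ∈ w.summand k i n, y • M i ∈ w'.term k n') :
    ∀ v ∈ w.term k n, mulMatrix k M v ∈ w'.term k n' := by
  intro v hv
  rw [mulMatrix, Finsupp.linearCombination_apply]
  exact Submodule.sum_mem _ fun i _ => h i _ ((mem_term k).1 hv i)

lemma mem_summand {i n m : ℤ} {x : Q.V} {y : Q.Alg k} (hx : w.vtx i = some (x, m))
    (hm : m = n) : y ∈ w.summand k i n ↔ y * Q.e k x = y := by
  rw [summand, hx]
  simp [hm, mem_P]

lemma exists_of_mem_summand {i n : ℤ} {y : Q.Alg k} (h : y ∈ w.summand k i n) (hy : y ≠ 0) :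
    ∃ x, w.vtx i = some (x, n) ∧ y * Q.e k x = y := by
  unfold summand at h
  split at h
  · rename_i x m hx
    split_ifs at h with hm
    · subst hm
      exact ⟨x, hx, (Q.mem_P k).1 h⟩
    · exact absurd ((Submodule.mem_bot _).1 h) hy
  · exact absurd ((Submodule.mem_bot _).1 h) hy

lemma direct_inj {p q : List Q.A} (h : direct p = direct q) : p = q :=
  (List.map_injective_iff.2 fun a b hab => by simpa using hab) h

lemma direct_ne_inverse {p q : List Q.A} (hp : p ≠ []) : direct p ≠ inverse q := by
  rcases p with _ | ⟨a, p⟩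
  · simp at hp
  · intro h
    have : (a, true) ∈ inverse q := by rw [← h]; simp [direct]
    simp [inverse, direct, FreeGroup.invRev] at this

lemma IsHomotopyString.of_direct (hw : w.IsHomotopyString) {i : ℤ} {p : List Q.A} (hp : p ≠ [])
    (h : w.letter i = direct p) : ∃ x y m, w.vtx i = some (x, m) ∧
      w.vtx (i - 1) = some (y, m + 1) ∧ Q.IsPath p x y := by
  have hne : w.letter i ≠ [] := by rw [h]; simpa [direct] using hp
  have h1 := mt (hw.letter_empty i) hne
  push Not at h1
  obtain ⟨⟨x, m⟩, hx⟩ := Option.ne_none_iff_exists'.1 h1.1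
  obtain ⟨⟨y, n⟩, hy⟩ := Option.ne_none_iff_exists'.1 h1.2
  rcases hw.letter_spec i x m y n hx hy with ⟨q, hq, hq', rfl⟩ | ⟨q, hq, hq', rfl⟩
  · rw [h] at hq'
    obtain rfl := direct_inj hq'
    exact ⟨x, y, m, hx, hy, hq⟩
  · rw [h] at hq'
    exact absurd hq' (direct_ne_inverse hp)

lemma IsHomotopyString.of_inverse (hw : w.IsHomotopyString) {i : ℤ} {p : List Q.A} (hp : p ≠ [])
    (h : w.letter i = inverse p) : ∃ x y m, w.vtx i = some (x, m + 1) ∧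
      w.vtx (i - 1) = some (y, m) ∧ Q.IsPath p y x := by
  have hne : w.letter i ≠ [] := by rw [h]; simpa [direct, inverse, FreeGroup.invRev] using hp
  have h1 := mt (hw.letter_empty i) hne
  push Not at h1
  obtain ⟨⟨x, m⟩, hx⟩ := Option.ne_none_iff_exists'.1 h1.1
  obtain ⟨⟨y, n⟩, hy⟩ := Option.ne_none_iff_exists'.1 h1.2
  rcases hw.letter_spec i x m y n hx hy with ⟨q, hq, hq', rfl⟩ | ⟨q, hq, hq', rfl⟩
  · rw [h] at hq'
    exact absurd hq'.symm (direct_ne_inverse (isPath_ne_nil hq))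
  · rw [h] at hq'
    obtain rfl := direct_inj (FreeGroup.invRev_injective hq')
    exact ⟨x, y, n, hx, hy, hq⟩

lemma IsHomotopyString.dRow_mem (hw : w.IsHomotopyString) {n n' : ℤ} (hn : n + 1 = n') (i : ℤ)
    (y : Q.Alg k) (hy : y ∈ w.summand k i n) : y • w.dRow k i ∈ w.term k n' := by
  subst hn
  by_cases hy0 : y = 0
  · simp [hy0]
  obtain ⟨x, hx, hyx⟩ := exists_of_mem_summand k hy hy0
  rw [dRow, smul_add, Finsupp.smul_single, Finsupp.smul_single, smul_eq_mul, smul_eq_mul]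
  refine Submodule.add_mem _ (single_mem_term k ?_) (single_mem_term k ?_)
  · by_cases h0 : letterElt k (w.letter i) = 0
    · simp [h0]
    obtain ⟨p, hp, hw'⟩ := exists_of_letterElt_ne_zero k h0
    obtain ⟨x', z, m, hx', hz, hpath⟩ := hw.of_direct hp hw'
    rw [hx] at hx'
    simp only [Option.some.injEq, Prod.mk.injEq] at hx'
    rw [mem_summand k hz (by omega), hw', mul_assoc, mul_letterElt k hpath]
  · by_cases h0 : letterElt k (FreeGroup.invRev (w.letter (i + 1))) = 0
    · simp [h0]
    obtain ⟨p, hp, hw'⟩ := exists_of_letterElt_ne_zero k h0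
    have hw2 : w.letter (i + 1) = inverse p := by
      rw [inverse, ← hw', FreeGroup.invRev_invRev]
    obtain ⟨z, x', m, hz, hx', hpath⟩ := hw.of_inverse hp hw2
    rw [add_sub_cancel_right, hx] at hx'
    simp only [Option.some.injEq, Prod.mk.injEq] at hx'
    rw [mem_summand k hz (by omega), hw', mul_assoc, mul_letterElt k hpath]

lemma IsHomotopyString.mulMatrix_dRow (hw : w.IsHomotopyString) (v : ℤ →₀ Q.Alg k) :
    mulMatrix k (w.dRow k) (mulMatrix k (w.dRow k) v) = 0 := by
  have : mulMatrix k (w.dRow k) ∘ₗ mulMatrix k (w.dRow k) = 0 := by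
    ext i : 1
    refine LinearMap.ext_ring ?_
    have h1 := (hw.junction (i - 1)).mul_eq_zero k
    have h2 := letterElt_mul_invRev k (w.letter i)
    have h3 := letterElt_mul_invRev k (FreeGroup.invRev (w.letter (i + 1)))
    have h4 := (hw.junction (i + 1)).symm.mul_eq_zero k
    rw [sub_add_cancel] at h1
    rw [FreeGroup.invRev_invRev] at h3
    simp [dRow, h1, h2, h3, h4]
  exact LinearMap.congr_fun this v

/-- The string complex `P_w` of a homotopy string `w` with given cohomological degrees. -/
def stringComplex (hw : w.IsHomotopyString) : CochainComplex (ModuleCat.{u} (Q.Alg k)) ℤ where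
  X n := ModuleCat.of _ (w.term k n)
  d n n' := open Classical in
    if h : n + 1 = n' then
      ModuleCat.ofHom ((mulMatrix k (w.dRow k)).restrict (mulMatrix_mem k (hw.dRow_mem k h)))
    else 0
  shape n n' h := dif_neg h
  d_comp_d' i j l hij hjl := by
    have hij' : i + 1 = j := hij
    have hjl' : j + 1 = l := hjl
    rw [dif_pos hij', dif_pos hjl', ← ModuleCat.ofHom_comp]
    ext v : 2
    exact Subtype.ext (hw.mulMatrix_dRow k v.1)

end GradedWalk

end Complex

/-! ### Graph maps -/

/-- The right endpoint conditions (RG1), (RG2) and (RG3) for the letters `u = σ_R` and `v = τ_R`.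
The path `f` is the component `f_R`, where `[]` means that there is none. -/
inductive RightEndpoint : Q.Word → Q.Word → List Q.A → Prop
  | rg1 (p f : List Q.A) : p ≠ [] → f ≠ [] → RightEndpoint (direct p) (direct (p ++ f)) f
  | rg2 (q f : List Q.A) : q ≠ [] → f ≠ [] → RightEndpoint (inverse (f ++ q)) (inverse q) f
  | rg3 (p q : List Q.A) : RightEndpoint (direct p) (inverse q) []

/-- The left endpoint conditions, dual to the right ones, for `u = σ_L`, `v = τ_L` and the
component `f = f_L`. -/
inductive LeftEndpoint : Q.Word → Q.Word → List Q.A → Prop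
  | lg1 (q f : List Q.A) : q ≠ [] → f ≠ [] → LeftEndpoint (direct (f ++ q)) (direct q) f
  | lg2 (p f : List Q.A) : p ≠ [] → f ≠ [] → LeftEndpoint (inverse p) (inverse (p ++ f)) f
  | lg3 (p q : List Q.A) : LeftEndpoint (inverse p) (direct q) []

/-- The data of a graph map `P_σ → P_τ`. The positions of the overlap `ρ` in `σ` form the interval
`R`, and position `i` of `R` corresponds to position `i + m` of `τ`; vertices, degrees
and letters of `ρ` agree. If `ρ` has a right end `a`, so that `σ_R` is the letter of `σ` at `a` and
`τ_R` that of `τ` at `a + m`, then a right endpoint condition holds; if `ρ` has a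
left end `b`, so that `σ_L` is the letter of `σ` at `b + 1` and `τ_L` that of `τ` at
`b + m + 1`, then a left endpoint condition holds. The endpoint conditions imply that
`ρ` is maximal. -/
structure GraphMapData (σ τ : Q.GradedWalk) where
  R : Set ℤ
  m : ℤ
  fL : List Q.A
  fR : List Q.A
  nonempty : R.Nonempty
  ordConnected : R.OrdConnected
  subset_pos : R ⊆ σ.pos
  vtx_eq : ∀ i ∈ R, τ.vtx (i + m) = σ.vtx i
  letter_eq : ∀ i ∈ R, i - 1 ∈ R → τ.letter (i + m) = σ.letter i
  right_endpoint : ∀ a, IsLeast R a → RightEndpoint (σ.letter a) (τ.letter (a + m)) fR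
  left_endpoint : ∀ b, IsGreatest R b →
    LeftEndpoint (σ.letter (b + 1)) (τ.letter (b + m + 1)) fL

namespace GraphMapData

variable {σ τ : Q.GradedWalk}

section Map

variable (k : Type u) [Field k] (g : GraphMapData σ τ)

open Classical in
/-- The component of the graph map at position `i` of `σ` (with values in position `i + m` of `τ`):
the identity of `P(x)` on the overlap, `f_R` and `f_L` at the positions next to the
overlap, and zero at all other positions. -/
def component (i : ℤ) : Q.Alg k :=
  if i ∈ g.R then (match σ.vtx i with
    | some (x, _) => Q.e k x
    | none => 0)
  else if i + 1 ∈ g.R then letterElt k (direct g.fR)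
  else if i - 1 ∈ g.R then letterElt k (direct g.fL)
  else 0

/-- The rows of the matrix of the graph map. -/
def mapRow (i : ℤ) : ℤ →₀ Q.Alg k := Finsupp.single (i + g.m) (g.component k i)

variable {k g}

lemma component_of_mem {i : ℤ} (h : i ∈ g.R) {x : Q.V} {n : ℤ} (hx : σ.vtx i = some (x, n)) :
    g.component k i = Q.e k x := by
  simp [component, h, hx]

lemma component_right {i : ℤ} (h : i ∉ g.R) (h1 : i + 1 ∈ g.R) :
    g.component k i = letterElt k (direct g.fR) := by
  simp [component, h, h1]

lemma component_left {i : ℤ} (h : i ∉ g.R) (h1 : i - 1 ∈ g.R) :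
    g.component k i = letterElt k (direct g.fL) := by
  have h2 : i + 1 ∉ g.R := fun h2 => h (g.ordConnected.out h1 h2 ⟨by omega, by omega⟩)
  simp [component, h, h1, h2]

lemma component_zero {i : ℤ} (h : i ∉ g.R) (h1 : i + 1 ∉ g.R) (h2 : i - 1 ∉ g.R) :
    g.component k i = 0 := by
  simp [component, h, h1, h2]

lemma isLeast_of {a : ℤ} (h : a ∈ g.R) (h1 : a - 1 ∉ g.R) : IsLeast g.R a := by
  refine ⟨h, fun i hi => ?_⟩
  by_contra hlt
  exact h1 (g.ordConnected.out hi h ⟨by omega, by omega⟩)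

lemma isGreatest_of {b : ℤ} (h : b ∈ g.R) (h1 : b + 1 ∉ g.R) : IsGreatest g.R b := by
  refine ⟨h, fun i hi => ?_⟩
  by_contra hlt
  exact h1 (g.ordConnected.out h hi ⟨by omega, by omega⟩)

lemma exists_vtx {i : ℤ} (h : i ∈ g.R) :
    ∃ x n, σ.vtx i = some (x, n) ∧ τ.vtx (i + g.m) = some (x, n) := by
  obtain ⟨⟨x, n⟩, hx⟩ := Option.ne_none_iff_exists'.1 (g.subset_pos h)
  exact ⟨x, n, hx, (g.vtx_eq i h).trans hx⟩

lemma component_mem (hσ : σ.IsHomotopyString) (hτ : τ.IsHomotopyString) (n i : ℤ)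
    (y : Q.Alg k) (hy : y ∈ σ.summand k i n) : y • g.mapRow k i ∈ τ.term k n := by
  rw [mapRow, Finsupp.smul_single, smul_eq_mul]
  apply GradedWalk.single_mem_term
  by_cases hy0 : y = 0
  · simp [hy0]
  obtain ⟨x, hx, hyx⟩ := GradedWalk.exists_of_mem_summand k hy hy0
  by_cases hi : i ∈ g.R
  · rw [component_of_mem hi hx, hyx,
      GradedWalk.mem_summand k ((g.vtx_eq i hi).trans hx) rfl, hyx]
  by_cases hi1 : i + 1 ∈ g.R
  · rw [component_right hi hi1]
    have hR := g.right_endpoint (i + 1) (isLeast_of hi1 (by simpa using hi))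
    obtain ⟨z, l, hz, hz'⟩ := exists_vtx hi1
    generalize hu : σ.letter (i + 1) = u at hR
    generalize hv : τ.letter (i + 1 + g.m) = v at hR
    generalize g.fR = f at hR ⊢
    rcases hR with ⟨p, _, hp, hf⟩ | ⟨q, _, hq, hf⟩ | ⟨p, q⟩
    · obtain ⟨z1, x1, l1, h1, h2, h3⟩ := hσ.of_direct hp hu
      obtain ⟨z2, x2, l2, h4, h5, h6⟩ := hτ.of_direct (by simp [hp]) hv
      rw [hz] at h1
      rw [hz'] at h4
      rw [add_sub_cancel_right, hx] at h2
      rw [show i + 1 + g.m - 1 = i + g.m by ring] at h5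
      simp only [Option.some.injEq, Prod.mk.injEq] at h1 h2 h4
      rw [GradedWalk.mem_summand k h5 (by omega), mul_assoc,
        mul_letterElt_right k (isPath_source_append h6 hf)]
    · obtain ⟨z1, x1, l1, h1, h2, h3⟩ := hσ.of_inverse (by simp [hq]) hu
      obtain ⟨z2, x2, l2, h4, h5, h6⟩ := hτ.of_inverse hq hv
      rw [hz] at h1
      rw [hz'] at h4
      rw [add_sub_cancel_right, hx] at h2
      rw [show i + 1 + g.m - 1 = i + g.m by ring] at h5
      simp only [Option.some.injEq, Prod.mk.injEq] at h1 h2 h4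
      rw [GradedWalk.mem_summand k h5 (by omega), mul_assoc,
        mul_letterElt_right k (isPath_source_left h3 h6.target hf)]
    · simp [letterElt_direct_nil]
  by_cases hi2 : i - 1 ∈ g.R
  · rw [component_left hi hi2]
    have hL := g.left_endpoint (i - 1) (isGreatest_of hi2 (by simpa using hi))
    obtain ⟨z, l, hz, hz'⟩ := exists_vtx hi2
    rw [sub_add_cancel, show i - 1 + g.m + 1 = i + g.m by ring] at hL
    generalize hu : σ.letter i = u at hL
    generalize hv : τ.letter (i + g.m) = v at hL
    generalize g.fL = f at hL ⊢
    rcases hL with ⟨q, _, hq, hf⟩ | ⟨p, _, hp, hf⟩ | ⟨p, q⟩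
    · obtain ⟨z1, x1, l1, h1, h2, h3⟩ := hσ.of_direct (by simp [hq]) hu
      obtain ⟨z2, x2, l2, h4, h5, h6⟩ := hτ.of_direct hq hv
      rw [show i + g.m - 1 = i - 1 + g.m by ring, hz'] at h5
      rw [hz] at h2
      rw [hx] at h1
      simp only [Option.some.injEq, Prod.mk.injEq] at h1 h2 h5
      rw [GradedWalk.mem_summand k h4 (by omega), mul_assoc,
        mul_letterElt_right k (isPath_source_left h3 h6.target hf)]
    · obtain ⟨z1, x1, l1, h1, h2, h3⟩ := hσ.of_inverse hp hu
      obtain ⟨z2, x2, l2, h4, h5, h6⟩ := hτ.of_inverse (by simp [hp]) hv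
      rw [show i + g.m - 1 = i - 1 + g.m by ring, hz'] at h5
      rw [hz] at h2
      rw [hx] at h1
      simp only [Option.some.injEq, Prod.mk.injEq] at h1 h2 h5
      rw [GradedWalk.mem_summand k h4 (by omega), mul_assoc,
        mul_letterElt_right k (isPath_source_append h6 hf)]
    · simp [letterElt_direct_nil]
  · simp [component_zero hi hi1 hi2]

lemma right_comm (hQ : Q.IsGentle) (hσ : σ.IsHomotopyString) (hτ : τ.IsHomotopyString) (i : ℤ) :
    letterElt k (σ.letter i) * g.component k (i - 1) =
      g.component k i * letterElt k (τ.letter (i + g.m)) := by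
  by_cases hi : i ∈ g.R
  · obtain ⟨x, n, hx, hx'⟩ := exists_vtx hi
    rw [component_of_mem hi hx]
    by_cases hi1 : i - 1 ∈ g.R
    · obtain ⟨y, l, hy, hy'⟩ := exists_vtx hi1
      rw [component_of_mem hi1 hy, g.letter_eq i hi hi1]
      rcases hσ.letter_spec i x n y l hx hy with ⟨p, hp, hp', -⟩ | ⟨p, hp, hp', -⟩
      · rw [hp', mul_letterElt k hp, e_mul_letterElt k hp]
      · simp [hp', letterElt_inverse]
    · rw [component_right hi1 (by simpa using hi)]
      have hR := g.right_endpoint i (isLeast_of hi hi1)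
      generalize hu : σ.letter i = u at hR
      generalize hv : τ.letter (i + g.m) = v at hR
      generalize g.fR = f at hR ⊢
      rcases hR with ⟨p, _, hp, hf⟩ | ⟨q, _, hq, hf⟩ | ⟨p, q⟩
      · obtain ⟨z2, x2, l2, h4, -, h6⟩ := hτ.of_direct (by simp [hp]) hv
        rw [hx'] at h4
        simp only [Option.some.injEq, Prod.mk.injEq] at h4
        rw [h4.1, e_mul_letterElt k h6, letterElt_direct k hp, letterElt_direct k hf,
          letterElt_direct k (by simp [hp])]
        simp
      · simp [letterElt_inverse]
      · simp [letterElt_inverse, letterElt_direct_nil]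
  by_cases hi1 : i - 1 ∈ g.R
  · rw [component_left hi hi1]
    obtain ⟨x, n, hx, hx'⟩ := exists_vtx hi1
    rw [component_of_mem hi1 hx]
    have hL := g.left_endpoint (i - 1) (isGreatest_of hi1 (by simpa using hi))
    rw [sub_add_cancel, show i - 1 + g.m + 1 = i + g.m by ring] at hL
    generalize hu : σ.letter i = u at hL
    generalize hv : τ.letter (i + g.m) = v at hL
    generalize g.fL = f at hL ⊢
    rcases hL with ⟨q, _, hq, hf⟩ | ⟨p, _, hp, hf⟩ | ⟨p, q⟩
    · obtain ⟨z1, x1, l1, -, h2, h3⟩ := hσ.of_direct (by simp [hq]) hu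
      rw [hx] at h2
      simp only [Option.some.injEq, Prod.mk.injEq] at h2
      rw [h2.1, mul_letterElt k h3, letterElt_direct k hq, letterElt_direct k hf,
        letterElt_direct k (by simp [hq])]
      simp
    · simp [letterElt_inverse]
    · simp [letterElt_inverse, letterElt_direct_nil]
  by_cases hi2 : i + 1 ∈ g.R
  · rw [component_right hi hi2, component_zero hi1 (by simpa using hi)
      (fun h => hi (g.ordConnected.out h hi2 ⟨by omega, by omega⟩)), mul_zero]
    have hR := g.right_endpoint (i + 1) (isLeast_of hi2 (by simpa using hi))
    have hJ := hτ.junction (i + g.m)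
    rw [show i + g.m + 1 = i + 1 + g.m by ring] at hJ
    generalize hu : σ.letter (i + 1) = u at hR
    generalize hv : τ.letter (i + 1 + g.m) = v at hR hJ
    generalize g.fR = f at hR ⊢
    symm
    rcases hR with ⟨p, _, hp, hf⟩ | ⟨q, _, hq, hf⟩ | ⟨p, q⟩
    · exact (hJ.of_append_left hf).mul_eq_zero k
    · obtain ⟨_, _, _, -, -, h3⟩ := hσ.of_inverse (by simp [hq]) hu
      exact mul_eq_zero_of_inverse_left k hQ h3 hf hq hJ
    · simp [letterElt_direct_nil]
  rw [component_zero hi hi2 hi1, zero_mul]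
  by_cases hi3 : i - 1 - 1 ∈ g.R
  · rw [component_left hi1 hi3]
    have hL := g.left_endpoint (i - 1 - 1) (isGreatest_of hi3 (by simpa using hi1))
    rw [sub_add_cancel] at hL
    have hJ := hσ.junction (i - 1)
    rw [sub_add_cancel] at hJ
    generalize hu : σ.letter (i - 1) = u at hL hJ
    generalize hv : τ.letter (i - 1 - 1 + g.m + 1) = v at hL
    generalize g.fL = f at hL ⊢
    rcases hL with ⟨q, _, hq, hf⟩ | ⟨p, _, hp, hf⟩ | ⟨p, q⟩
    · exact (hJ.of_append_right hf).mul_eq_zero k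
    · obtain ⟨_, _, _, -, -, h3⟩ := hτ.of_inverse (by simp [hp]) hv
      exact mul_eq_zero_of_inverse_right k hQ h3 hp hf hJ
    · simp [letterElt_direct_nil]
  · rw [component_zero hi1 (by simpa using hi) hi3, mul_zero]

lemma left_comm (hQ : Q.IsGentle) (hσ : σ.IsHomotopyString) (hτ : τ.IsHomotopyString) (i : ℤ) :
    letterElt k (FreeGroup.invRev (σ.letter (i + 1))) * g.component k (i + 1) =
      g.component k i * letterElt k (FreeGroup.invRev (τ.letter (i + g.m + 1))) := by
  by_cases hi : i ∈ g.R
  · obtain ⟨x, n, hx, hx'⟩ := exists_vtx hi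
    rw [component_of_mem hi hx]
    by_cases hi1 : i + 1 ∈ g.R
    · obtain ⟨y, l, hy, hy'⟩ := exists_vtx hi1
      rw [component_of_mem hi1 hy, show i + g.m + 1 = i + 1 + g.m by ring,
        g.letter_eq (i + 1) hi1 (by simpa using hi)]
      rcases hσ.letter_spec (i + 1) y l x n hy (by simpa using hx) with
        ⟨p, hp, hp', -⟩ | ⟨p, hp, hp', -⟩
      · simp [hp', invRev_direct, letterElt_inverse]
      · rw [hp', invRev_inverse, mul_letterElt k hp, e_mul_letterElt k hp]
    · rw [component_left hi1 (by simpa using hi)]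
      have hL := g.left_endpoint i (isGreatest_of hi hi1)
      generalize hu : σ.letter (i + 1) = u at hL
      generalize hv : τ.letter (i + g.m + 1) = v at hL
      generalize g.fL = f at hL ⊢
      rcases hL with ⟨q, _, hq, hf⟩ | ⟨p, _, hp, hf⟩ | ⟨p, q⟩
      · simp [letterElt_inverse, invRev_direct]
      · obtain ⟨z2, x2, l2, -, h5, h6⟩ := hτ.of_inverse (by simp [hp]) hv
        rw [add_sub_cancel_right, hx'] at h5
        simp only [Option.some.injEq, Prod.mk.injEq] at h5
        rw [invRev_inverse, invRev_inverse, h5.1, e_mul_letterElt k h6, letterElt_direct k hp,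
          letterElt_direct k hf, letterElt_direct k (by simp [hp])]
        simp
      · simp [letterElt_inverse, invRev_direct, letterElt_direct_nil]
  by_cases hi1 : i + 1 ∈ g.R
  · rw [component_right hi hi1]
    obtain ⟨x, n, hx, hx'⟩ := exists_vtx hi1
    rw [component_of_mem hi1 hx, show i + g.m + 1 = i + 1 + g.m by ring]
    have hR := g.right_endpoint (i + 1) (isLeast_of hi1 (by simpa using hi))
    generalize hu : σ.letter (i + 1) = u at hR
    generalize hv : τ.letter (i + 1 + g.m) = v at hR
    generalize g.fR = f at hR ⊢
    rcases hR with ⟨p, _, hp, hf⟩ | ⟨q, _, hq, hf⟩ | ⟨p, q⟩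
    · simp [letterElt_inverse, invRev_direct]
    · obtain ⟨z1, x1, l1, h1, -, h3⟩ := hσ.of_inverse (by simp [hq]) hu
      rw [hx] at h1
      simp only [Option.some.injEq, Prod.mk.injEq] at h1
      rw [invRev_inverse, invRev_inverse, h1.1, mul_letterElt k h3, letterElt_direct k hq,
        letterElt_direct k hf, letterElt_direct k (by simp [hq])]
      simp
    · simp [letterElt_inverse, invRev_direct, letterElt_direct_nil]
  by_cases hi2 : i - 1 ∈ g.R
  · rw [component_left hi hi2, component_zero hi1
      (fun h => hi (g.ordConnected.out hi2 h ⟨by omega, by omega⟩)) (by simpa using hi), mul_zero]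
    have hL := g.left_endpoint (i - 1) (isGreatest_of hi2 (by simpa using hi))
    rw [sub_add_cancel, show i - 1 + g.m + 1 = i + g.m by ring] at hL
    have hJ := (hτ.junction (i + g.m)).symm
    generalize hu : σ.letter i = u at hL
    generalize hv : τ.letter (i + g.m) = v at hL hJ
    generalize g.fL = f at hL ⊢
    symm
    rcases hL with ⟨q, _, hq, hf⟩ | ⟨p, _, hp, hf⟩ | ⟨p, q⟩
    · obtain ⟨_, _, _, -, -, h3⟩ := hσ.of_direct (by simp [hq]) hu
      exact mul_eq_zero_of_inverse_left k hQ h3 hf hq hJ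
    · rw [invRev_inverse] at hJ
      exact (hJ.of_append_left hf).mul_eq_zero k
    · simp [letterElt_direct_nil]
  rw [component_zero hi hi1 hi2, zero_mul]
  by_cases hi3 : i + 1 + 1 ∈ g.R
  · rw [component_right hi1 hi3]
    have hR := g.right_endpoint (i + 1 + 1) (isLeast_of hi3 (by simpa using hi1))
    have hJ := (hσ.junction (i + 1)).symm
    generalize hu : σ.letter (i + 1 + 1) = u at hR hJ
    generalize hv : τ.letter (i + 1 + 1 + g.m) = v at hR
    generalize g.fR = f at hR ⊢
    rcases hR with ⟨p, _, hp, hf⟩ | ⟨q, _, hq, hf⟩ | ⟨p, q⟩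
    · obtain ⟨_, _, _, -, -, h3⟩ := hτ.of_direct (by simp [hp]) hv
      exact mul_eq_zero_of_inverse_right k hQ h3 hp hf hJ
    · rw [invRev_inverse] at hJ
      exact (hJ.of_append_right hf).mul_eq_zero k
    · simp [letterElt_direct_nil]
  · rw [component_zero hi1 hi3 (by simpa using hi), mul_zero]

lemma mapRow_comm (hQ : Q.IsGentle) (hσ : σ.IsHomotopyString) (hτ : τ.IsHomotopyString)
    (v : ℤ →₀ Q.Alg k) :
    GradedWalk.mulMatrix k (τ.dRow k) (GradedWalk.mulMatrix k (g.mapRow k) v) =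
      GradedWalk.mulMatrix k (g.mapRow k) (GradedWalk.mulMatrix k (σ.dRow k) v) := by
  have : GradedWalk.mulMatrix k (τ.dRow k) ∘ₗ GradedWalk.mulMatrix k (g.mapRow k) =
      GradedWalk.mulMatrix k (g.mapRow k) ∘ₗ GradedWalk.mulMatrix k (σ.dRow k) := by
    ext i : 1
    refine LinearMap.ext_ring ?_
    have h1 := right_comm (k := k) (g := g) hQ hσ hτ i
    have h2 := left_comm (k := k) (g := g) hQ hσ hτ i
    simp [GradedWalk.dRow, mapRow, h1, h2, sub_add_eq_add_sub, add_right_comm]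
  exact LinearMap.congr_fun this v

end Map

/-- The graph map `P_σ → P_τ` given by the data `g`. -/
def graphMap (k : Type u) [Field k] (hQ : Q.IsGentle) (hσ : σ.IsHomotopyString)
    (hτ : τ.IsHomotopyString) (g : GraphMapData σ τ) :
    σ.stringComplex k hσ ⟶ τ.stringComplex k hτ where
  f n := ModuleCat.ofHom ((GradedWalk.mulMatrix k (g.mapRow k)).restrict
    (GradedWalk.mulMatrix_mem k (component_mem hσ hτ n)))
  comm' i j hij := by
    have hij' : i + 1 = j := hij
    simp only [GradedWalk.stringComplex]
    rw [dif_pos hij', dif_pos hij', ← ModuleCat.ofHom_comp, ← ModuleCat.ofHom_comp]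
    congr 1
    ext v : 1
    exact Subtype.ext (mapRow_comm hQ hσ hτ v.1)

variable (g : GraphMapData σ τ)

/-- `σ` and `τ` are compatibly oriented. This is a condition only if the graph map is concentrated
in one degree: `ρ` is trivial, at position `a`, and there are no components `f_L` and `f_R`, so
that (RG3) and (LG3) hold. Then `τ̄_R σ_R` and `σ_L τ̄_L` have to be nonzero, where the letters
involved are nonempty. If moreover `σ_L` and `τ_R`, or `σ_R` and `τ_L`, are empty, then this says
nothing on the product of the two other letters, and it is required to be zero
(if one of these pairs consists of nonempty letters and so does one of the pairs above,
this follows from gentleness). -/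
def CompatiblyOriented : Prop :=
  ∀ a, g.R = {a} → g.fL = [] → g.fR = [] →
    (σ.letter a ≠ [] → τ.letter (a + g.m) ≠ [] →
      NonzeroWord (FreeGroup.invRev (τ.letter (a + g.m)) ++ σ.letter a)) ∧
    (σ.letter (a + 1) ≠ [] → τ.letter (a + g.m + 1) ≠ [] →
      NonzeroWord (σ.letter (a + 1) ++ FreeGroup.invRev (τ.letter (a + g.m + 1)))) ∧
    (σ.letter (a + 1) = [] → τ.letter (a + g.m) = [] →
      σ.letter a ≠ [] → τ.letter (a + g.m + 1) ≠ [] →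
      ¬ NonzeroWord (τ.letter (a + g.m + 1) ++ σ.letter a)) ∧
    (σ.letter a = [] → τ.letter (a + g.m + 1) = [] →
      σ.letter (a + 1) ≠ [] → τ.letter (a + g.m) ≠ [] →
      ¬ NonzeroWord (σ.letter (a + 1) ++ τ.letter (a + g.m)))

open Classical in
/-- The string read off at the right end `a` of the overlap, where `σ = ⋯ ρ σ_R α` and
`τ = ⋯ ρ τ_R γ`: it is `γ̄ τ̄_R σ_R α`, with `τ̄_R σ_R` freely reduced, or `γ̄` if `σ_R = ∅`, or `α`
if `τ_R = ∅`, or `∅` if both are empty. The part `α` is taken in the degrees of `Σ P_σ`. -/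
def rightString (a : ℤ) : Q.GradedWalk :=
  let σR := σ.letter a
  let τR := τ.letter (a + g.m)
  let α := (σ.below a).susp
  let γbar := (τ.below (a + g.m)).bar (a + (a + g.m) - 1)
  if σR = [] ∧ τR = [] then .empty
  else if σR = [] then γbar
  else if τR = [] then α
  else .concat a γbar (FreeGroup.reduce (FreeGroup.invRev τR ++ σR)) α

open Classical in
/-- The string read off at the left end `b` of the overlap, where `σ = β σ_L ρ ⋯` and
`τ = δ τ_L ρ ⋯`: it is `β σ_L τ̄_L δ̄`, with `σ_L τ̄_L` freely reduced, or `δ̄` if `σ_L = ∅`, or `β`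
if `τ_L = ∅`, or `∅` if both are empty. The part `β` is taken in the degrees of `Σ P_σ`. -/
def leftString (b : ℤ) : Q.GradedWalk :=
  let σL := σ.letter (b + 1)
  let τL := τ.letter (b + g.m + 1)
  let β := (σ.above b).susp
  let δbar := (τ.above (b + g.m)).bar (b + (b + g.m) + 1)
  if σL = [] ∧ τL = [] then .empty
  else if σL = [] then δbar
  else if τL = [] then β
  else .concat (b + 1) β (FreeGroup.reduce (σL ++ FreeGroup.invRev τL)) δbar

end GraphMapData

/-! ### String complexes over an algebra Morita equivalent to `kQ/I` -/

section Morita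

variable {k : Type u} [Field k] {Λ : Type u} [Ring Λ] [Algebra k Λ]
  (E : MoritaEquivalence k (Q.Alg k) Λ)

/-- The string complex `P_w` over an algebra `Λ` that is Morita equivalent to `kQ/I`. -/
def stringComplexOver {w : Q.GradedWalk} (hw : w.IsHomotopyString) :
    CochainComplex (ModuleCat.{u} Λ) ℤ :=
  (E.eqv.functor.mapHomologicalComplex (ComplexShape.up ℤ)).obj (w.stringComplex k hw)

/-- The graph map `P_σ → P_τ` over an algebra `Λ` that is Morita equivalent to `kQ/I`. -/
def graphMapOver {σ τ : Q.GradedWalk} (hQ : Q.IsGentle) (hσ : σ.IsHomotopyString)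
    (hτ : τ.IsHomotopyString) (g : GraphMapData σ τ) :
    stringComplexOver E hσ ⟶ stringComplexOver E hτ :=
  (E.eqv.functor.mapHomologicalComplex (ComplexShape.up ℤ)).map (g.graphMap k hQ hσ hτ)

/-- The complexes `C` and `D` are isomorphic in the homotopy category of complexes of `Λ`-modules.
As `K^{b,-}(proj Λ)` is a full subcategory, for complexes in this subcategory this means that they
are isomorphic in it. -/
def IsoInK (C D : CochainComplex (ModuleCat.{u} Λ) ℤ) : Prop :=
  Nonempty ((HomotopyCategory.quotient (ModuleCat.{u} Λ) (ComplexShape.up ℤ)).obj C ≅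
    (HomotopyCategory.quotient (ModuleCat.{u} Λ) (ComplexShape.up ℤ)).obj D)

end Morita

end BoundQuiver

end

open BoundQuiver

/-!
The mapping cone of a graph map `f` is the direct sum of a summand for each position of `σ` (in its
degree lowered by one) and a summand for each position of `τ`. On the overlap, `f` is the identity,
so that the summands of `σ` and `τ` at positions of the overlap can be eliminated in pairs
(Gaussian elimination). What remains are the positions of `σ` and `τ` outside of the overlap. The
new differential is the old one plus the zigzags from a position of `τ` outside of the
overlap to its neighbour in the overlap, back along the identity to `σ`, and on to a
position of `σ` outside of the overlap. Such zigzags connect only the positions next to the overlap: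

* on one side of the overlap, the zigzag yields the letter `τ̄_R σ_R` or `σ_L τ̄_L` in case of
  (RG3) or (LG3), while in the other cases the reduced letter is the inverse of the component `f_R`
  or `f_L` (`CrossLetter`, `crossLetter_spec`). Hence the part of the complement on the right
  (left) of the overlap is, up to signs, the string complex of the right (left) string.
* if the overlap is trivial, there might be zigzags from one side to the other. They vanish because
  `(Q, I)` is gentle and `σ` and `τ` are compatibly oriented (`letterElt_mul_eq_zero`).

The elimination is written down with explicit matrices. `SideRetract` collects the identities that
are needed on each of the two sides of the overlap, and `nonempty_homotopyEquiv_of_sideRetract`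
deduces that the cone is homotopy equivalent to the sum of the two string complexes. A side on which
the overlap is unbounded contributes zero. The identities are verified in `SideString.sideRetract`
for both sides at once. The two strings themselves are studied at the right end only; reversal of
all strings (`GraphMapData.bar`, `leftString_eq_bar`) interchanges the two ends.

The statement over an algebra that is Morita equivalent to `kQ/I` follows, as an additive functor
preserves mapping cones, sums and homotopy equivalences (`isoInK_biprod`).
-/

noncomputable section

/-! ### Homotopy equivalences of cochain complexes -/

section Retracts

open Limits CochainComplex HomComplex

universe v w

variable {C : Type w} [Category.{v} C] [Preadditive C] [HasBinaryBiproducts C]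

/-- Let `X` and `Y` be complexes with chain maps `p` and `q` to `M` that are degreewise split by
orthogonal retractions `r` and `s`, and assume that the projection to the image of `X ⊞ Y` is
homotopic to the identity. Then `M` is homotopy equivalent to `X ⊞ Y`. The retractions are not
assumed to be chain maps: this follows from the other conditions. -/
theorem nonempty_homotopyEquiv_biprod_of_retracts {M X Y : CochainComplex C ℤ}
    (p : X ⟶ M) (q : Y ⟶ M) (r : ∀ n, M.X n ⟶ X.X n) (s : ∀ n, M.X n ⟶ Y.X n)
    (h : ∀ n, M.X (n + 1) ⟶ M.X n)
    (hpr : ∀ n, p.f n ≫ r n = 𝟙 _) (hqs : ∀ n, q.f n ≫ s n = 𝟙 _)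
    (hps : ∀ n, p.f n ≫ s n = 0) (hqr : ∀ n, q.f n ≫ r n = 0)
    (hh : ∀ n, r (n + 1) ≫ p.f (n + 1) + s (n + 1) ≫ q.f (n + 1) =
      𝟙 _ - (M.d (n + 1) (n + 1 + 1) ≫ h (n + 1) + h n ≫ M.d n (n + 1))) :
    Nonempty (HomotopyEquiv M (X ⊞ Y)) := by
  have hcomm : ∀ n, M.d n (n + 1) ≫ (r (n + 1) ≫ p.f (n + 1) + s (n + 1) ≫ q.f (n + 1)) =
      (r n ≫ p.f n + s n ≫ q.f n) ≫ M.d n (n + 1) := by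
    intro n
    obtain ⟨n, rfl⟩ : ∃ l, n = l + 1 := ⟨n - 1, by ring⟩
    rw [hh, hh]
    simp
  have hr : ∀ n, r n ≫ X.d n (n + 1) = M.d n (n + 1) ≫ r (n + 1) := by
    intro n
    have := hcomm n =≫ r (n + 1)
    simp only [Preadditive.comp_add, Preadditive.add_comp, Category.assoc, p.comm,
      q.comm, hpr, hqr] at this
    simpa using this.symm
  have hs : ∀ n, s n ≫ Y.d n (n + 1) = M.d n (n + 1) ≫ s (n + 1) := by
    intro n
    have := hcomm n =≫ s (n + 1)
    simp only [Preadditive.comp_add, Preadditive.add_comp, Category.assoc, p.comm,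
      q.comm, hps, hqs] at this
    simpa using this.symm
  -- so the retractions are chain maps
  let ρ : M ⟶ X := { f := r, comm' := by rintro i j rfl; exact hr i }
  let θ : M ⟶ Y := { f := s, comm' := by rintro i j rfl; exact hs i }
  have e : biprod.lift ρ θ ≫ biprod.desc p q = ρ ≫ p + θ ≫ q := biprod.lift_desc
  have e1 : p ≫ ρ = 𝟙 _ := by ext n; exact hpr n
  have e2 : p ≫ θ = 0 := by ext n; exact hps n
  have e3 : q ≫ ρ = 0 := by ext n; exact hqr n
  have e4 : q ≫ θ = 𝟙 _ := by ext n; exact hqs n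
  have e' : biprod.desc p q ≫ biprod.lift ρ θ = 𝟙 _ := by
    apply biprod.hom_ext <;> apply biprod.hom_ext' <;> simp [e1, e2, e3, e4]
  refine ⟨⟨biprod.lift ρ θ, biprod.desc p q, ?_, Homotopy.ofEq e'⟩⟩
  refine (Homotopy.ofEq e).trans (Homotopy.symm ?_)
  refine
    { hom := fun i j => if hij : j + 1 = i then (by subst hij; exact h j) else 0
      zero := fun i j hij => dif_neg hij
      comm := fun n => ?_ }
  obtain ⟨n, rfl⟩ : ∃ l, n = l + 1 := ⟨n - 1, by ring⟩
  rw [dNext_eq _ (show (ComplexShape.up ℤ).Rel (n + 1) (n + 1 + 1) from rfl),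
    prevD_eq _ (show (ComplexShape.up ℤ).Rel n (n + 1) from rfl)]
  have := hh n
  simp only [HomologicalComplex.id_f, HomologicalComplex.add_f_apply, HomologicalComplex.comp_f,
    dif_pos]
  change _ = _ + (r (n + 1) ≫ p.f (n + 1) + s (n + 1) ≫ q.f (n + 1))
  rw [this]
  abel

/-- A chain map to the mapping cone of `f`, given by its two components. -/
def mappingConeLift {K L X : CochainComplex C ℤ} (f : K ⟶ L)
    (ps : ∀ n, X.X n ⟶ K.X (n + 1)) (pt : ∀ n, X.X n ⟶ L.X n)
    (h1 : ∀ n, ps n ≫ K.d (n + 1) (n + 1 + 1) = - X.d n (n + 1) ≫ ps (n + 1))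
    (h2 : ∀ n, ps n ≫ f.f (n + 1) + pt n ≫ L.d n (n + 1) = X.d n (n + 1) ≫ pt (n + 1)) :
    X ⟶ mappingCone f where
  f n := ps n ≫ (mappingCone.inl f).v (n + 1) n (by omega) + pt n ≫ (mappingCone.inr f).f n
  comm' := by
    rintro n _ rfl
    have h1 := h1 n
    have h2 := h2 n
    simp only [Preadditive.add_comp, Category.assoc, Preadditive.comp_add,
      mappingCone.inl_v_d f (n + 1) n (n + 1 + 1) (by omega) (by omega), Preadditive.comp_sub,
      mappingCone.inr_f_d, reassoc_of% h1, ← reassoc_of% h2, Preadditive.neg_comp]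
    abel

/-- Elimination of summands from a mapping cone: `X` and `Y` are the complements of the summands of
`K` and `L` between which `f` is invertible, with partial inverse `h`. -/
theorem nonempty_homotopyEquiv_mappingCone_biprod {K L X Y : CochainComplex C ℤ} (f : K ⟶ L)
    (ps : ∀ n, X.X n ⟶ K.X (n + 1)) (pt : ∀ n, X.X n ⟶ L.X n)
    (qs : ∀ n, Y.X n ⟶ K.X (n + 1)) (qt : ∀ n, Y.X n ⟶ L.X n)
    (rs : ∀ n, K.X (n + 1) ⟶ X.X n) (rt : ∀ n, L.X n ⟶ X.X n)
    (ss : ∀ n, K.X (n + 1) ⟶ Y.X n) (st : ∀ n, L.X n ⟶ Y.X n)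
    (h : ∀ n, L.X n ⟶ K.X n)
    (p1 : ∀ n, ps n ≫ K.d (n + 1) (n + 1 + 1) = - X.d n (n + 1) ≫ ps (n + 1))
    (p2 : ∀ n, ps n ≫ f.f (n + 1) + pt n ≫ L.d n (n + 1) = X.d n (n + 1) ≫ pt (n + 1))
    (q1 : ∀ n, qs n ≫ K.d (n + 1) (n + 1 + 1) = - Y.d n (n + 1) ≫ qs (n + 1))
    (q2 : ∀ n, qs n ≫ f.f (n + 1) + qt n ≫ L.d n (n + 1) = Y.d n (n + 1) ≫ qt (n + 1))
    (hpr : ∀ n, ps n ≫ rs n + pt n ≫ rt n = 𝟙 _)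
    (hqs : ∀ n, qs n ≫ ss n + qt n ≫ st n = 𝟙 _)
    (hps : ∀ n, ps n ≫ ss n + pt n ≫ st n = 0)
    (hqr : ∀ n, qs n ≫ rs n + qt n ≫ rt n = 0)
    (h1 : ∀ n, rs n ≫ ps n + ss n ≫ qs n = 𝟙 _ - f.f (n + 1) ≫ h (n + 1))
    (h2 : ∀ n, rs n ≫ pt n + ss n ≫ qt n = 0)
    (h3 : ∀ n, rt n ≫ ps n + st n ≫ qs n = h n ≫ K.d n (n + 1) - L.d n (n + 1) ≫ h (n + 1))
    (h4 : ∀ n, rt n ≫ pt n + st n ≫ qt n = 𝟙 _ - h n ≫ f.f n) :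
    Nonempty (HomotopyEquiv (mappingCone f) (X ⊞ Y)) := by
  refine nonempty_homotopyEquiv_biprod_of_retracts (mappingConeLift f ps pt p1 p2)
    (mappingConeLift f qs qt q1 q2)
    (fun n => (mappingCone.fst f).1.v n (n + 1) rfl ≫ rs n +
      (mappingCone.snd f).v n n (add_zero n) ≫ rt n)
    (fun n => (mappingCone.fst f).1.v n (n + 1) rfl ≫ ss n +
      (mappingCone.snd f).v n n (add_zero n) ≫ st n)
    (fun n => (mappingCone.snd f).v (n + 1) (n + 1) (add_zero _) ≫ h (n + 1) ≫
      (mappingCone.inl f).v (n + 1) n (by omega)) ?_ ?_ ?_ ?_ ?_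
  · intro n; simpa [mappingConeLift] using hpr n
  · intro n; simpa [mappingConeLift] using hqs n
  · intro n; simpa [mappingConeLift] using hps n
  · intro n; simpa [mappingConeLift] using hqr n
  · -- the identity for the projection is checked on the four components of the mapping cone
    intro n
    have h1 := h1 (n + 1)
    have h2 := h2 (n + 1)
    have h3 := h3 (n + 1)
    have h4 := h4 (n + 1)
    rw [mappingCone.ext_from_iff _ (n + 1 + 1) (n + 1) rfl,
      mappingCone.ext_to_iff _ _ (n + 1 + 1) rfl, mappingCone.ext_to_iff _ _ (n + 1 + 1) rfl]
    simp only [mappingConeLift]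
    refine ⟨⟨?_, ?_⟩, ?_, ?_⟩
    · simp [mappingCone.inl_v_d_assoc f (n + 1 + 1) (n + 1) (n + 1 + 1 + 1) (by omega) (by omega),
        h1]
    · simp [mappingCone.inl_v_d_assoc f (n + 1 + 1) (n + 1) (n + 1 + 1 + 1) (by omega) (by omega),
        mappingCone.inl_v_d f (n + 1) n (n + 1 + 1) (by omega) (by omega), h2]
    · simp [mappingCone.inl_v_d_assoc f (n + 1) n (n + 1 + 1) (by omega) (by omega), h3,
        sub_eq_add_neg]
    · simp [mappingCone.inl_v_d_assoc f (n + 1) n (n + 1 + 1) (by omega) (by omega), h4]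

end Retracts

/-! ### Transfer to a Morita equivalent algebra -/

namespace BoundQuiver

variable {Q : BoundQuiver.{u}} {k : Type u} [Field k] {Λ : Type u} [Ring Λ] [Algebra k Λ]
  (E : MoritaEquivalence k (Q.Alg k) Λ)

open Limits

/-- A homotopy equivalence over `kQ/I` from the mapping cone of a graph map to a sum of two string
complexes yields the corresponding isomorphism in the homotopy category over `Λ`. -/
theorem isoInK_biprod {σ τ c₁ c₂ : Q.GradedWalk} (hQ : Q.IsGentle)
    (hσ : σ.IsHomotopyString) (hτ : τ.IsHomotopyString) (g : GraphMapData σ τ)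
    (h₁ : c₁.IsHomotopyString) (h₂ : c₂.IsHomotopyString)
    (h : Nonempty (HomotopyEquiv (CochainComplex.mappingCone (g.graphMap k hQ hσ hτ))
      (c₁.stringComplex k h₁ ⊞ c₂.stringComplex k h₂))) :
    IsoInK (CochainComplex.mappingCone (graphMapOver E hQ hσ hτ g))
      (stringComplexOver E h₁ ⊞ stringComplexOver E h₂) := by
  obtain ⟨e⟩ := h
  let F := E.eqv.functor
  let e1 := CochainComplex.mappingCone.mapHomologicalComplexIso (g.graphMap k hQ hσ hτ) F
  let e2 := (F.mapHomotopyEquiv e)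
  have : PreservesBinaryBiproducts (F.mapHomologicalComplex (ComplexShape.up ℤ)) :=
    preservesBinaryBiproducts_of_preservesBiproducts _
  let e3 := (F.mapHomologicalComplex (ComplexShape.up ℤ)).mapBiprod
    (c₁.stringComplex k h₁) (c₂.stringComplex k h₂)
  exact ⟨(HomotopyCategory.quotient _ _).mapIso e1.symm ≪≫
    HomotopyCategory.isoOfHomotopyEquiv e2 ≪≫ (HomotopyCategory.quotient _ _).mapIso e3⟩

lemma IsoInK.trans_iso {A B D : CochainComplex (ModuleCat.{u} Λ) ℤ} (h : IsoInK A B) (e : B ≅ D) :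
    IsoInK A D :=
  h.map fun i => i ≪≫ (HomotopyCategory.quotient _ _).mapIso e

namespace GradedWalk

lemma isHomotopyString_empty : (empty : Q.GradedWalk).IsHomotopyString where
  ordConnected := by simp [pos, empty, Set.ordConnected_empty]
  letter_spec := by simp [empty]
  letter_empty := by simp [empty]
  junction := by simp [empty, Junction]
  left_infinite := by simp [pos, empty]
  right_infinite := by simp [pos, empty]

lemma isZero_stringComplex_empty (h : (empty : Q.GradedWalk).IsHomotopyString) :
    IsZero (stringComplex k h) := by
  rw [IsZero.iff_id_eq_zero]
  ext n : 1
  apply IsZero.eq_of_src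
  refine ModuleCat.isZero_of_iff_subsingleton.2 ⟨fun v w => Subtype.ext ?_⟩
  have : ∀ v : term k (empty : Q.GradedWalk) n, v.1 = 0 := fun v => Finsupp.ext fun i => by
    simpa [summand, empty] using (mem_term k).1 v.2 i
  rw [this v, this w]

end GradedWalk

lemma isZero_stringComplexOver_empty (h : (GradedWalk.empty : Q.GradedWalk).IsHomotopyString) :
    IsZero (stringComplexOver E h) :=
  Functor.map_isZero (E.eqv.functor.mapHomologicalComplex (ComplexShape.up ℤ))
    (GradedWalk.isZero_stringComplex_empty h)

end BoundQuiver

namespace BoundQuiver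

variable {Q : BoundQuiver.{u}}

/-! ### Matrices of maps between string complexes -/

namespace GradedWalk

variable (k : Type u) [Field k] {w w' : Q.GradedWalk}

variable (w) in
/-- The entry of the differential of the string complex from position `i` to position `i + δ`.
It is meaningful for `δ = 1` and `δ = -1`. -/
def edge (i δ : ℤ) : Q.Alg k := w.dRow k i (i + δ)

lemma edge_neg_one (i : ℤ) : w.edge k i (-1) = letterElt k (w.letter i) := by
  simp [edge, dRow, sub_eq_add_neg]

lemma edge_one (i : ℤ) :
    w.edge k i 1 = letterElt k (FreeGroup.invRev (w.letter (i + 1))) := by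
  simp [edge, dRow, sub_eq_add_neg]

lemma dRow_eq {η : ℤ} (hη : η = 1 ∨ η = -1) (i : ℤ) :
    w.dRow k i = Finsupp.single (i - η) (w.edge k i (-η)) +
      Finsupp.single (i + η) (w.edge k i η) := by
  rcases hη with rfl | rfl
  · rw [edge_neg_one, edge_one, dRow]
  · rw [neg_neg, edge_neg_one, edge_one, dRow, add_comm, sub_neg_eq_add]
    rfl

lemma mulMatrix_single (M : ℤ → (ℤ →₀ Q.Alg k)) (i : ℤ) (y : Q.Alg k) :
    mulMatrix k M (Finsupp.single i y) = y • M i := by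
  simp [mulMatrix]

lemma IsHomotopyString.e_smul_dRow (hw : w.IsHomotopyString) {i : ℤ} {x : Q.V} {n : ℤ}
    (hx : w.vtx i = some (x, n)) : Q.e k x • w.dRow k i = w.dRow k i := by
  have key : ∀ {u : Q.Word}, (∀ p, p ≠ [] → u = direct p → ∃ y, Q.IsPath p x y) →
      Q.e k x * letterElt k u = letterElt k u := by
    intro u h
    by_cases h0 : letterElt k u = 0
    · rw [h0, mul_zero]
    obtain ⟨p, hp, rfl⟩ := exists_of_letterElt_ne_zero k h0
    obtain ⟨y, hy⟩ := h p hp rfl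
    exact e_mul_letterElt k hy
  rw [dRow, smul_add, Finsupp.smul_single, Finsupp.smul_single, smul_eq_mul, smul_eq_mul, key, key]
  · intro p hp h
    obtain ⟨y, x', m, hy, hx', hpath⟩ :=
      hw.of_inverse hp (by rw [inverse, ← h, FreeGroup.invRev_invRev])
    rw [add_sub_cancel_right, hx] at hx'
    simp only [Option.some.injEq, Prod.mk.injEq] at hx'
    exact ⟨y, hx'.1 ▸ hpath⟩
  · intro p hp h
    obtain ⟨x', y, m, hx', hy, hpath⟩ := hw.of_direct hp h
    rw [hx] at hx'
    simp only [Option.some.injEq, Prod.mk.injEq] at hx'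
    exact ⟨y, hx'.1 ▸ hpath⟩

lemma IsHomotopyString.e_mul_edge (hw : w.IsHomotopyString) {i : ℤ} {x : Q.V} {n : ℤ}
    (hx : w.vtx i = some (x, n)) (δ : ℤ) : Q.e k x * w.edge k i δ = w.edge k i δ := by
  conv_rhs => rw [edge, ← hw.e_smul_dRow k hx]
  rfl

lemma IsHomotopyString.edge_mem (hw : w.IsHomotopyString) {i : ℤ} {x : Q.V} {n : ℤ}
    (hx : w.vtx i = some (x, n)) (δ : ℤ) : w.edge k i δ ∈ w.summand k (i + δ) (n + 1) := by
  have h := hw.dRow_mem k (n := n) rfl i (Q.e k x)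
    ((mem_summand k hx rfl).2 (Q.e_mul_e k x))
  rw [hw.e_smul_dRow k hx] at h
  exact (mem_term k).1 h _

lemma IsHomotopyString.edge_mul_e (hw : w.IsHomotopyString) {i : ℤ} {x y : Q.V} {n m : ℤ}
    (hx : w.vtx i = some (x, n)) (δ : ℤ) (hy : w.vtx (i + δ) = some (y, m)) :
    w.edge k i δ * Q.e k y = w.edge k i δ := by
  by_cases h0 : w.edge k i δ = 0
  · rw [h0, zero_mul]
  obtain ⟨z, hz, h⟩ := exists_of_mem_summand k (hw.edge_mem k hx δ) h0
  rw [hy] at hz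
  simp only [Option.some.injEq, Prod.mk.injEq] at hz
  rwa [hz.1]

lemma IsHomotopyString.edge_mul_edge (hw : w.IsHomotopyString) {δ : ℤ} (hδ : δ = 1 ∨ δ = -1)
    (i : ℤ) : w.edge k i δ * w.edge k (i + δ) δ = 0 := by
  rcases hδ with rfl | rfl
  · rw [edge_one, edge_one]
    exact (hw.junction (i + 1)).symm.mul_eq_zero k
  · rw [edge_neg_one, edge_neg_one]
    have := (hw.junction (i - 1)).mul_eq_zero k
    rwa [sub_add_cancel] at this

lemma single_one_mem {i n : ℤ} {x : Q.V} (h : w.vtx i = some (x, n)) :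
    Q.e k x • Finsupp.single i (1 : Q.Alg k) ∈ w.term k n := by
  rw [Finsupp.smul_single, smul_eq_mul, mul_one]
  exact single_mem_term k ((mem_summand k h rfl).2 (Q.e_mul_e k x))

lemma stringComplex_d (hw : w.IsHomotopyString) (n : ℤ) :
    (w.stringComplex k hw).d n (n + 1) = ModuleCat.ofHom ((mulMatrix k (w.dRow k)).restrict
      (mulMatrix_mem k (hw.dRow_mem k (n := n) rfl))) :=
  dif_pos rfl

/-- The homomorphism from the degree `n` part of `P_w` to the degree `n'` part of `P_w'` given by
right multiplication with the matrix with rows `M i`. -/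
def rowHom (hw : w.IsHomotopyString) (hw' : w'.IsHomotopyString) (n n' : ℤ)
    (M : ℤ → (ℤ →₀ Q.Alg k))
    (h : ∀ i x, w.vtx i = some (x, n) → Q.e k x • M i ∈ w'.term k n') :
    (w.stringComplex k hw).X n ⟶ (w'.stringComplex k hw').X n' :=
  ModuleCat.ofHom ((mulMatrix k M).restrict (mulMatrix_mem k fun i y hy => by
    by_cases hy0 : y = 0
    · simp [hy0]
    obtain ⟨x, hx, hyx⟩ := exists_of_mem_summand k hy hy0
    rw [← hyx, mul_smul]
    exact Submodule.smul_mem _ _ (h i x hx)))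

lemma stringComplex_d_eq_rowHom (hw : w.IsHomotopyString) (n : ℤ) :
    (w.stringComplex k hw).d n (n + 1) = rowHom k hw hw n (n + 1) (w.dRow k)
      (fun i _ hx => hw.dRow_mem k rfl i _ ((mem_summand k hx rfl).2 (Q.e_mul_e k _))) :=
  stringComplex_d k hw n

/-- Homomorphisms on the degree `n` part of `P_w` agree if they agree on the generators `e_x`. -/
lemma stringComplex_hom_ext (hw : w.IsHomotopyString) (hw' : w'.IsHomotopyString) {n n' : ℤ}
    {f g : (w.stringComplex k hw).X n ⟶ (w'.stringComplex k hw').X n'}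
    (h : ∀ i x (hx : w.vtx i = some (x, n)),
      (w'.term k n').subtype (f.hom (⟨Finsupp.single i (Q.e k x),
        single_mem_term k ((mem_summand k hx rfl).2 (Q.e_mul_e k x))⟩ : w.term k n)) =
      (w'.term k n').subtype (g.hom (⟨Finsupp.single i (Q.e k x),
        single_mem_term k ((mem_summand k hx rfl).2 (Q.e_mul_e k x))⟩ : w.term k n))) : f = g := by
  refine ModuleCat.hom_ext (LinearMap.ext ?_)
  change ∀ v : w.term k n, _
  rintro ⟨v, hv⟩
  have hsum : (⟨v, hv⟩ : w.term k n) = ∑ i ∈ v.support,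
      ⟨Finsupp.single i (v i), single_mem_term k ((mem_term k).1 hv i)⟩ := by
    apply Subtype.ext
    rw [AddSubmonoidClass.coe_finsetSum]
    exact (Finsupp.sum_single v).symm
  have hsingle : ∀ i ∈ v.support, ∃ (y : Q.Alg k) (z : w.term k n),
      (⟨Finsupp.single i (v i), single_mem_term k ((mem_term k).1 hv i)⟩ : w.term k n) = y • z ∧
      f.hom z = g.hom z := by
    intro i hi
    obtain ⟨x, hx, hyx⟩ :=
      exists_of_mem_summand k ((mem_term k).1 hv i) (Finsupp.mem_support_iff.1 hi)
    exact ⟨v i, _, Subtype.ext (by simp [hyx]), Subtype.ext (h i x hx)⟩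
  rw [hsum]
  refine (map_sum f.hom _ _).trans (Eq.trans ?_ (map_sum g.hom _ _).symm)
  refine Finset.sum_congr rfl fun i hi => ?_
  obtain ⟨y, z, hz, hz'⟩ := hsingle i hi
  rw [hz]
  exact (map_smul f.hom y z).trans ((congrArg (y • ·) hz').trans (map_smul g.hom y z).symm)

end GradedWalk

open GradedWalk

namespace GraphMapData

variable {σ τ : Q.GradedWalk} (k : Type u) [Field k] (g : GraphMapData σ τ)

/-! ### Elimination of the overlap from the mapping cone -/

/-- Position `i` of `σ` lies outside the overlap: to its right if `η = 1`, to its left if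
`η = -1`. -/
def Beyond (η i : ℤ) : Prop := ∀ r ∈ g.R, 0 < η * (r - i)

open Classical in
/-- A retract `C` of the mapping cone of the graph map, which consists of the summands on one side
of the overlap (the right one if `η = 1`, the left one if `η = -1`). The inclusion is given by the
matrices `ps` and `pt` with values in `P_σ` and `P_τ`, the retraction by `rs` and `rt`.
The last four conditions determine the projection to the retract. -/
structure SideRetract (η : ℤ) (C : Q.GradedWalk) where
  ps : ℤ → (ℤ →₀ Q.Alg k)
  pt : ℤ → (ℤ →₀ Q.Alg k)
  rs : ℤ → (ℤ →₀ Q.Alg k)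
  rt : ℤ → (ℤ →₀ Q.Alg k)
  ps_mem : ∀ n i x, C.vtx i = some (x, n) → Q.e k x • ps i ∈ σ.term k (n + 1)
  pt_mem : ∀ n i x, C.vtx i = some (x, n) → Q.e k x • pt i ∈ τ.term k n
  rs_mem : ∀ n i x, σ.vtx i = some (x, n + 1) → Q.e k x • rs i ∈ C.term k n
  rt_mem : ∀ n i x, τ.vtx i = some (x, n) → Q.e k x • rt i ∈ C.term k n
  comm_s : ∀ i, mulMatrix k (σ.dRow k) (ps i) = - mulMatrix k ps (C.dRow k i)
  comm_t : ∀ i, mulMatrix k (g.mapRow k) (ps i) + mulMatrix k (τ.dRow k) (pt i) =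
    mulMatrix k pt (C.dRow k i)
  split : ∀ i x n, C.vtx i = some (x, n) →
    mulMatrix k rs (ps i) + mulMatrix k rt (pt i) = Finsupp.single i 1
  ps_apply : ∀ i j, ¬ g.Beyond η j → j ∉ g.R → ps i j = 0
  pt_apply : ∀ i j, ¬ g.Beyond η j → pt i (j + g.m) = 0
  rs_eq_zero : ∀ i, ¬ g.Beyond η i → rs i = 0
  rt_eq_zero : ∀ i, ¬ g.Beyond η i → i ∉ g.R → rt (i + g.m) = 0
  rs_ps : ∀ i, mulMatrix k ps (rs i) = if g.Beyond η i then Finsupp.single i 1 else 0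
  rs_pt : ∀ i, mulMatrix k pt (rs i) = 0
  rt_ps : ∀ i, mulMatrix k ps (rt (i + g.m)) =
    (if i ∈ g.R ∧ i - η ∉ g.R then Finsupp.single (i - η) (σ.edge k i (-η)) else 0) -
    if g.Beyond η i ∧ i + η ∈ g.R then Finsupp.single (i + η) (τ.edge k (i + g.m) η) else 0
  rt_pt : ∀ i, mulMatrix k pt (rt (i + g.m)) =
    if g.Beyond η i then Finsupp.single (i + g.m) 1 else 0

variable {g}

lemma Beyond.notMem {η i : ℤ} (h : g.Beyond η i) : i ∉ g.R := fun hi => by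
  simpa using h i hi

lemma Beyond.not_neg {η i : ℤ} (h : g.Beyond η i) : ¬ g.Beyond (-η) i := fun h' => by
  obtain ⟨r, hr⟩ := g.nonempty
  have := h r hr
  have := h' r hr
  linarith

lemma mem_or_beyond (i : ℤ) : i ∈ g.R ∨ g.Beyond 1 i ∨ g.Beyond (-1) i := by
  by_contra! h
  simp only [Beyond] at h
  push Not at h
  obtain ⟨h, ⟨r, hr, hr'⟩, r', hs, hs'⟩ := h
  exact h (g.ordConnected.out hr hs ⟨by omega, by omega⟩)

variable {k}

lemma mulMatrix_eq_zero {M : ℤ → (ℤ →₀ Q.Alg k)} {v : ℤ →₀ Q.Alg k}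
    (h : ∀ i, v i = 0 ∨ M i = 0) : mulMatrix k M v = 0 := by
  rw [mulMatrix, Finsupp.linearCombination_apply]
  refine Finset.sum_eq_zero fun i _ => ?_
  rcases h i with h | h <;> simp [h]

/-- The retracts on the two sides of the overlap are orthogonal. -/
lemma SideRetract.orthogonal {η η' : ℤ} (hη : η' = -η) {C C' : Q.GradedWalk}
    (S : g.SideRetract k η C) (S' : g.SideRetract k η' C') (i : ℤ) :
    mulMatrix k S'.rs (S.ps i) + mulMatrix k S'.rt (S.pt i) = 0 := by
  subst hη
  rw [mulMatrix_eq_zero, mulMatrix_eq_zero, zero_add]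
  · intro j
    obtain ⟨j, rfl⟩ : ∃ l, j = l + g.m := ⟨j - g.m, by ring⟩
    by_cases hj : g.Beyond η j
    · exact .inr (S'.rt_eq_zero j hj.not_neg hj.notMem)
    · exact .inl (S.pt_apply i j hj)
  · intro j
    by_cases hj : g.Beyond (-η) j
    · exact .inl (S.ps_apply i j (by simpa using hj.not_neg) hj.notMem)
    · exact .inr (S'.rs_eq_zero j hj)

lemma graphMap_f (hQ : Q.IsGentle) (hσ : σ.IsHomotopyString) (hτ : τ.IsHomotopyString) (n : ℤ) :
    (g.graphMap k hQ hσ hτ).f n = rowHom k hσ hτ n n (g.mapRow k)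
      (fun i _ hx => component_mem hσ hτ n i _ ((mem_summand k hx rfl).2 (Q.e_mul_e k _))) :=
  rfl

open Classical in
/-- The rows of the partial inverse of the graph map on the overlap. -/
def backRow (k : Type u) [Field k] (g : GraphMapData σ τ) (i : ℤ) : ℤ →₀ Q.Alg k :=
  if i - g.m ∈ g.R then Finsupp.single (i - g.m) 1 else 0

lemma backRow_of_mem {i : ℤ} (h : i ∈ g.R) : g.backRow k (i + g.m) = Finsupp.single i 1 := by
  simp [backRow, h]

lemma backRow_of_notMem {i : ℤ} (h : i ∉ g.R) : g.backRow k (i + g.m) = 0 := by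
  simp [backRow, h]

lemma backRow_mem (n i : ℤ) (x : Q.V) (hx : τ.vtx i = some (x, n)) :
    Q.e k x • g.backRow k i ∈ σ.term k n := by
  obtain ⟨i, rfl⟩ : ∃ l, i = l + g.m := ⟨i - g.m, by ring⟩
  by_cases h : i ∈ g.R
  · rw [backRow_of_mem h]
    exact single_one_mem k ((g.vtx_eq i h).symm.trans hx)
  · simp [backRow_of_notMem h]

lemma edge_eq {η : ℤ} (hη : η = 1 ∨ η = -1) {i : ℤ} (h : i ∈ g.R) (h' : i + η ∈ g.R) :
    τ.edge k (i + g.m) η = σ.edge k i η := by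
  rcases hη with rfl | rfl
  · rw [edge_one, edge_one, add_right_comm, g.letter_eq (i + 1) h' (by simpa using h)]
  · rw [edge_neg_one, edge_neg_one, g.letter_eq i h h']

/-- As the graph map is invertible on the overlap, its mapping cone is homotopy equivalent to the
sum of the retracts on the two sides of the overlap. -/
theorem nonempty_homotopyEquiv_of_sideRetract (hQ : Q.IsGentle) (hσ : σ.IsHomotopyString)
    (hτ : τ.IsHomotopyString) {C C' : Q.GradedWalk} (hC : C.IsHomotopyString)
    (hC' : C'.IsHomotopyString) (S : g.SideRetract k 1 C) (S' : g.SideRetract k (-1) C') :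
    Nonempty (HomotopyEquiv (CochainComplex.mappingCone (g.graphMap k hQ hσ hτ))
      (C.stringComplex k hC ⊞ C'.stringComplex k hC')) := by
  refine nonempty_homotopyEquiv_mappingCone_biprod (g.graphMap k hQ hσ hτ)
    (fun n => rowHom k hC hσ n (n + 1) S.ps (S.ps_mem n))
    (fun n => rowHom k hC hτ n n S.pt (S.pt_mem n))
    (fun n => rowHom k hC' hσ n (n + 1) S'.ps (S'.ps_mem n))
    (fun n => rowHom k hC' hτ n n S'.pt (S'.pt_mem n))
    (fun n => rowHom k hσ hC (n + 1) n S.rs (S.rs_mem n))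
    (fun n => rowHom k hτ hC n n S.rt (S.rt_mem n))
    (fun n => rowHom k hσ hC' (n + 1) n S'.rs (S'.rs_mem n))
    (fun n => rowHom k hτ hC' n n S'.rt (S'.rt_mem n))
    (fun n => rowHom k hτ hσ n n (g.backRow k) (backRow_mem n))
    ?_ ?_ ?_ ?_ ?_ ?_ ?_ ?_ ?_ ?_ ?_ ?_
  all_goals
    intro n
    try simp only [stringComplex_d_eq_rowHom, graphMap_f]
    refine stringComplex_hom_ext k _ _ fun i x hx => ?_
  · change mulMatrix k (σ.dRow k) (mulMatrix k S.ps (Finsupp.single i (Q.e k x))) =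
      - mulMatrix k S.ps (mulMatrix k (C.dRow k) (Finsupp.single i (Q.e k x)))
    simp only [mulMatrix_single, map_smul, S.comm_s, smul_neg]
  · change mulMatrix k (g.mapRow k) (mulMatrix k S.ps (Finsupp.single i (Q.e k x))) +
      mulMatrix k (τ.dRow k) (mulMatrix k S.pt (Finsupp.single i (Q.e k x))) =
      mulMatrix k S.pt (mulMatrix k (C.dRow k) (Finsupp.single i (Q.e k x)))
    simp only [mulMatrix_single, map_smul, ← S.comm_t, smul_add]
  · change mulMatrix k (σ.dRow k) (mulMatrix k S'.ps (Finsupp.single i (Q.e k x))) =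
      - mulMatrix k S'.ps (mulMatrix k (C'.dRow k) (Finsupp.single i (Q.e k x)))
    simp only [mulMatrix_single, map_smul, S'.comm_s, smul_neg]
  · change mulMatrix k (g.mapRow k) (mulMatrix k S'.ps (Finsupp.single i (Q.e k x))) +
      mulMatrix k (τ.dRow k) (mulMatrix k S'.pt (Finsupp.single i (Q.e k x))) =
      mulMatrix k S'.pt (mulMatrix k (C'.dRow k) (Finsupp.single i (Q.e k x)))
    simp only [mulMatrix_single, map_smul, ← S'.comm_t, smul_add]
  · change mulMatrix k S.rs (mulMatrix k S.ps (Finsupp.single i (Q.e k x))) +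
      mulMatrix k S.rt (mulMatrix k S.pt (Finsupp.single i (Q.e k x))) =
      Finsupp.single i (Q.e k x)
    simp only [mulMatrix_single, map_smul, ← smul_add, S.split i x n hx]
    simp
  · change mulMatrix k S'.rs (mulMatrix k S'.ps (Finsupp.single i (Q.e k x))) +
      mulMatrix k S'.rt (mulMatrix k S'.pt (Finsupp.single i (Q.e k x))) =
      Finsupp.single i (Q.e k x)
    simp only [mulMatrix_single, map_smul, ← smul_add, S'.split i x n hx]
    simp
  · change mulMatrix k S'.rs (mulMatrix k S.ps (Finsupp.single i (Q.e k x))) +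
      mulMatrix k S'.rt (mulMatrix k S.pt (Finsupp.single i (Q.e k x))) = 0
    simp only [mulMatrix_single, map_smul, ← smul_add, S.orthogonal rfl S', smul_zero]
  · change mulMatrix k S.rs (mulMatrix k S'.ps (Finsupp.single i (Q.e k x))) +
      mulMatrix k S.rt (mulMatrix k S'.pt (Finsupp.single i (Q.e k x))) = 0
    simp only [mulMatrix_single, map_smul, ← smul_add, S'.orthogonal (by simp) S, smul_zero]
  · change mulMatrix k S.ps (mulMatrix k S.rs (Finsupp.single i (Q.e k x))) +
      mulMatrix k S'.ps (mulMatrix k S'.rs (Finsupp.single i (Q.e k x))) =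
      Finsupp.single i (Q.e k x) -
      mulMatrix k (g.backRow k) (mulMatrix k (g.mapRow k) (Finsupp.single i (Q.e k x)))
    simp only [mulMatrix_single, map_smul, ← smul_add, S.rs_ps, S'.rs_ps, mapRow]
    rcases mem_or_beyond (g := g) i with h | h | h
    · have h1 : ¬ g.Beyond 1 i := fun h' => h'.notMem h
      have h2 : ¬ g.Beyond (-1) i := fun h' => h'.notMem h
      simp [h1, h2, backRow_of_mem h, component_of_mem h hx, e_mul_e]
    · simp [h, h.not_neg, backRow_of_notMem h.notMem]
    · have h1 : ¬ g.Beyond 1 i := by simpa using h.not_neg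
      simp [h, h1, backRow_of_notMem h.notMem]
  · change mulMatrix k S.pt (mulMatrix k S.rs (Finsupp.single i (Q.e k x))) +
      mulMatrix k S'.pt (mulMatrix k S'.rs (Finsupp.single i (Q.e k x))) = 0
    simp only [mulMatrix_single, map_smul, S.rs_pt, S'.rs_pt, smul_zero, add_zero]
  · change mulMatrix k S.ps (mulMatrix k S.rt (Finsupp.single i (Q.e k x))) +
      mulMatrix k S'.ps (mulMatrix k S'.rt (Finsupp.single i (Q.e k x))) =
      mulMatrix k (σ.dRow k) (mulMatrix k (g.backRow k) (Finsupp.single i (Q.e k x))) -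
      mulMatrix k (g.backRow k) (mulMatrix k (τ.dRow k) (Finsupp.single i (Q.e k x)))
    obtain ⟨i, rfl⟩ : ∃ l, i = l + g.m := ⟨i - g.m, by ring⟩
    simp only [mulMatrix_single, map_smul, ← smul_add, ← smul_sub, S.rt_ps, S'.rt_ps]
    congr 1
    rw [dRow_eq k (.inl rfl), map_add, mulMatrix_single, mulMatrix_single,
      show i + g.m - 1 = i - 1 + g.m by ring, show i + g.m + 1 = i + 1 + g.m by ring]
    rcases mem_or_beyond (g := g) i with h | h | h
    · have h1 : ¬ g.Beyond 1 i := fun h' => h'.notMem h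
      have h2 : ¬ g.Beyond (-1) i := fun h' => h'.notMem h
      rw [backRow_of_mem h, mulMatrix_single, dRow_eq k (.inl rfl)]
      have e1 : i - 1 ∈ g.R → τ.edge k (i + g.m) (-1) = σ.edge k i (-1) := fun h' =>
        edge_eq (.inr rfl) h h'
      have e2 : i + 1 ∈ g.R → τ.edge k (i + g.m) 1 = σ.edge k i 1 := edge_eq (.inl rfl) h
      by_cases h3 : i - 1 ∈ g.R <;> by_cases h4 : i + 1 ∈ g.R <;>
        simp [h, h1, h2, h3, h4, backRow_of_mem, backRow_of_notMem, e1, e2]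
    · have h1 : i - 1 ∉ g.R := fun h' => by have := h _ h'; omega
      by_cases h4 : i + 1 ∈ g.R <;>
      simp [h, h.not_neg, h.notMem, backRow_of_notMem, backRow_of_mem, h1, h4]
    · have h1 : ¬ g.Beyond 1 i := by simpa using h.not_neg
      have h2 : i + 1 ∉ g.R := fun h' => by have := h _ h'; omega
      by_cases h4 : i - 1 ∈ g.R <;>
      simp [h, h1, h.notMem, backRow_of_notMem, backRow_of_mem, h2, h4, ← sub_eq_add_neg]
  · change mulMatrix k S.pt (mulMatrix k S.rt (Finsupp.single i (Q.e k x))) +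
      mulMatrix k S'.pt (mulMatrix k S'.rt (Finsupp.single i (Q.e k x))) =
      Finsupp.single i (Q.e k x) -
      mulMatrix k (g.mapRow k) (mulMatrix k (g.backRow k) (Finsupp.single i (Q.e k x)))
    obtain ⟨i, rfl⟩ : ∃ l, i = l + g.m := ⟨i - g.m, by ring⟩
    simp only [mulMatrix_single, map_smul, ← smul_add, S.rt_pt, S'.rt_pt]
    rcases mem_or_beyond (g := g) i with h | h | h
    · have h1 : ¬ g.Beyond 1 i := fun h' => h'.notMem h
      have h2 : ¬ g.Beyond (-1) i := fun h' => h'.notMem h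
      simp [h1, h2, backRow_of_mem h, mapRow, e_mul_e,
        component_of_mem h ((g.vtx_eq i h).symm.trans hx)]
    · simp [h, h.not_neg, backRow_of_notMem h.notMem]
    · have h1 : ¬ g.Beyond 1 i := by simpa using h.not_neg
      simp [h, h1, backRow_of_notMem h.notMem]

/-- If the overlap is unbounded on one side, then there is no summand on this side. -/
def SideRetract.ofUnbounded {η : ℤ} (hη : ∀ i, ¬ g.Beyond η i) (h' : ∀ i ∈ g.R, i - η ∈ g.R) :
    g.SideRetract k η .empty where
  ps _ := 0
  pt _ := 0
  rs _ := 0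
  rt _ := 0
  ps_mem := by simp
  pt_mem := by simp
  rs_mem := by simp
  rt_mem := by simp
  comm_s i := by simp [mulMatrix_eq_zero]
  comm_t i := by simp [mulMatrix_eq_zero]
  split := by simp [empty]
  ps_apply := by simp
  pt_apply := by simp
  rs_eq_zero := by simp
  rt_eq_zero := by simp
  rs_ps := by simp [hη]
  rs_pt := by simp
  rt_ps i := by simpa [hη] using fun h1 h2 => absurd (h' i h1) h2
  rt_pt := by simp [hη]

end GraphMapData

namespace GraphMapData

variable {σ τ : Q.GradedWalk} (k : Type u) [Field k] (g : GraphMapData σ τ)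

/-- The position at distance `j` from `e`, to the right if `η = 1` and to the left if `η = -1`. -/
def sidePos (η e j : ℤ) : ℤ := e - η * j

/-- `C` is the string read off at the end `e` of the overlap (the right end if `η = 1`, the left end
if `η = -1`): the vertices and entries of the differential on the side of `e` that belongs to `σ`
are those of `Σ P_σ`, the position at distance `j > 0` of `τ` becomes the position at
distance `1 - j`, and the two entries between the distances `0` and `1` come from the elimination
of the overlap. -/
structure SideString (η e : ℤ) (C : Q.GradedWalk) : Prop where
  sign : η = 1 ∨ η = -1
  mem : e ∈ g.R
  le : ∀ r ∈ g.R, 0 ≤ η * (r - e)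
  vtx_source : ∀ j, 0 < j → C.vtx (sidePos η e j) = σ.susp.vtx (sidePos η e j)
  vtx_target : ∀ j, 0 < j → C.vtx (sidePos η e (1 - j)) = τ.vtx (sidePos η e j + g.m)
  edge_source : ∀ j, 0 < j → C.edge k (sidePos η e j) (-η) = σ.edge k (sidePos η e j) (-η)
  edge_source' : ∀ j, 0 < j →
    C.edge k (sidePos η e (j + 1)) η = σ.edge k (sidePos η e (j + 1)) η
  edge_target : ∀ j, 0 < j →
    C.edge k (sidePos η e (1 - j)) η = τ.edge k (sidePos η e j + g.m) (-η)
  edge_target' : ∀ j, 0 < j →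
    C.edge k (sidePos η e (-j)) (-η) = τ.edge k (sidePos η e (j + 1) + g.m) η
  edge_cross : C.edge k (sidePos η e 0) (-η) =
    τ.edge k (sidePos η e 1 + g.m) η * σ.edge k (sidePos η e 0) (-η)
  edge_cross' : C.edge k (sidePos η e 1) η = g.component k (sidePos η e 1)
  factor : σ.edge k (sidePos η e 1) η =
    g.component k (sidePos η e 1) * τ.edge k (sidePos η e 1 + g.m) η
  cross_zero : τ.edge k (sidePos η e 1 + g.m) η * σ.edge k (sidePos η e 0) η = 0

lemma sidePos_inj {η e j l : ℤ} (hη : η = 1 ∨ η = -1) :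
    sidePos η e j = sidePos η e l ↔ j = l := by
  rcases hη with rfl | rfl <;> simp [sidePos]

lemma exists_sidePos {η : ℤ} (hη : η = 1 ∨ η = -1) (e i : ℤ) : ∃ j, i = sidePos η e j := by
  rcases hη with rfl | rfl
  · exact ⟨e - i, by simp [sidePos]⟩
  · exact ⟨i - e, by simp [sidePos]⟩

/-- The sign `(-1) ^ (j - 1)`. It alternates along the part of the string that comes from `σ`, since
the mapping cone contains `P_σ` with the negative of its differential, and it is `1` next to the
overlap, where this part is joined to the part that comes from `τ`. -/
def distSign (Q : BoundQuiver.{u}) (k : Type u) [Field k] (j : ℤ) : Q.Alg k :=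
  (((j - 1).negOnePow : ℤˣ) : ℤ)

lemma distSign_one : distSign Q k 1 = 1 := by simp [distSign]

lemma distSign_succ (j : ℤ) : distSign Q k (j + 1) = - distSign Q k j := by
  obtain ⟨j, rfl⟩ : ∃ l, j = l + 1 := ⟨j - 1, by ring⟩
  simp [distSign, Int.negOnePow_succ]

lemma distSign_mul_self (j : ℤ) : distSign Q k j * distSign Q k j = 1 := by
  rw [distSign, ← Int.cast_mul, ← Units.val_mul, Int.units_mul_self]
  simp

lemma distSign_comm (j : ℤ) (y : Q.Alg k) : distSign Q k j * y = y * distSign Q k j :=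
  Int.cast_commute _ _

variable {k g}

namespace SideString

variable {η e : ℤ} {C : Q.GradedWalk} (h : g.SideString k η e C)

include h

lemma dRow (w : Q.GradedWalk) (j : ℤ) : w.dRow k (sidePos η e j) =
    Finsupp.single (sidePos η e (j + 1)) (w.edge k (sidePos η e j) (-η)) +
      Finsupp.single (sidePos η e (j - 1)) (w.edge k (sidePos η e j) η) := by
  rw [dRow_eq k h.sign]
  congr 2 <;> rw [sidePos, sidePos] <;> ring

lemma dRow_shift (w : Q.GradedWalk) (j : ℤ) : w.dRow k (sidePos η e j + g.m) =
    Finsupp.single (sidePos η e (j + 1) + g.m) (w.edge k (sidePos η e j + g.m) (-η)) +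
      Finsupp.single (sidePos η e (j - 1) + g.m) (w.edge k (sidePos η e j + g.m) η) := by
  rw [dRow_eq k h.sign]
  congr 2 <;> rw [sidePos, sidePos] <;> ring

lemma beyond_iff (j : ℤ) : g.Beyond η (sidePos η e j) ↔ 0 < j := by
  constructor
  · intro h'
    have := h' e h.mem
    rcases h.sign with rfl | rfl <;> simpa [sidePos] using this
  · intro hj r hr
    have := h.le r hr
    rcases h.sign with rfl | rfl <;> simp [sidePos] at this ⊢ <;> omega

lemma mem_zero : sidePos η e 0 ∈ g.R := by simpa [sidePos] using h.mem

lemma notMem {j : ℤ} (hj : 0 < j) : sidePos η e j ∉ g.R :=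
  ((h.beyond_iff j).2 hj).notMem

variable (k g η e)

omit h

/-- The distance of the position `i` from `e`, to the right if `η = 1` and to the left if
`η = -1`. -/
def sideDist (η e i : ℤ) : ℤ := η * (e - i)

/-- The component in `P_σ` of the inclusion of the string complex of a `SideString`. The entry at
distance `0` is the correction term of the elimination. -/
def psRow (i : ℤ) : ℤ →₀ Q.Alg k :=
  if 0 < sideDist η e i then Finsupp.single i (distSign Q k (sideDist η e i))
  else if sideDist η e i = 0 then
    Finsupp.single i (- τ.edge k (sidePos η e 1 + g.m) η)
  else 0

/-- The component in `P_τ` of the inclusion of the string complex of a `SideString`. -/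
def ptRow (i : ℤ) : ℤ →₀ Q.Alg k :=
  if 0 < sideDist η e i then 0
  else Finsupp.single (sidePos η e (1 - sideDist η e i) + g.m) 1

variable (Q) in
/-- The component on `P_σ` of the retraction to the string complex of a `SideString`. -/
def rsRow (i : ℤ) : ℤ →₀ Q.Alg k :=
  if 0 < sideDist η e i then Finsupp.single i (distSign Q k (sideDist η e i)) else 0

/-- The component on `P_τ` of the retraction to the string complex of a `SideString`. The entry at
distance `0` is the correction term of the elimination. -/
def rtRow (i : ℤ) : ℤ →₀ Q.Alg k :=
  if 0 < sideDist η e (i - g.m) then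
    Finsupp.single (sidePos η e (1 - sideDist η e (i - g.m))) 1
  else if sideDist η e (i - g.m) = 0 then
    Finsupp.single (sidePos η e 1) (σ.edge k (sidePos η e 0) (-η))
  else 0

variable {k g η e}

lemma sideDist_sidePos (hη : η = 1 ∨ η = -1) (j : ℤ) : sideDist η e (sidePos η e j) = j := by
  rcases hη with rfl | rfl <;> simp [sidePos, sideDist]

lemma psRow_of_pos (hη : η = 1 ∨ η = -1) {j : ℤ} (hj : 0 < j) :
    psRow k g η e (sidePos η e j) = Finsupp.single (sidePos η e j) (distSign Q k j) := by
  simp [psRow, sideDist_sidePos hη, hj]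

lemma psRow_zero (hη : η = 1 ∨ η = -1) : psRow k g η e (sidePos η e 0) =
    Finsupp.single (sidePos η e 0) (- τ.edge k (sidePos η e 1 + g.m) η) := by
  simp [psRow, sideDist_sidePos hη]

lemma psRow_of_neg (hη : η = 1 ∨ η = -1) {j : ℤ} (hj : j < 0) :
    psRow k g η e (sidePos η e j) = 0 := by
  simp [psRow, sideDist_sidePos hη, hj.ne, hj.le]

lemma ptRow_of_pos (hη : η = 1 ∨ η = -1) {j : ℤ} (hj : 0 < j) :
    ptRow k g η e (sidePos η e j) = 0 := by
  simp [ptRow, sideDist_sidePos hη, hj]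

lemma ptRow_of_nonpos (hη : η = 1 ∨ η = -1) {j : ℤ} (hj : j ≤ 0) :
    ptRow k g η e (sidePos η e j) = Finsupp.single (sidePos η e (1 - j) + g.m) 1 := by
  simp [ptRow, sideDist_sidePos hη, hj]

lemma rsRow_of_pos (hη : η = 1 ∨ η = -1) {j : ℤ} (hj : 0 < j) :
    rsRow Q k η e (sidePos η e j) = Finsupp.single (sidePos η e j) (distSign Q k j) := by
  simp [rsRow, sideDist_sidePos hη, hj]

lemma rsRow_of_nonpos (hη : η = 1 ∨ η = -1) {j : ℤ} (hj : j ≤ 0) :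
    rsRow Q k η e (sidePos η e j) = 0 := by
  simp [rsRow, sideDist_sidePos hη, hj]

lemma rtRow_of_pos (hη : η = 1 ∨ η = -1) {j : ℤ} (hj : 0 < j) :
    rtRow k g η e (sidePos η e j + g.m) = Finsupp.single (sidePos η e (1 - j)) 1 := by
  simp [rtRow, sideDist_sidePos hη, hj]

lemma rtRow_zero (hη : η = 1 ∨ η = -1) : rtRow k g η e (sidePos η e 0 + g.m) =
    Finsupp.single (sidePos η e 1) (σ.edge k (sidePos η e 0) (-η)) := by
  simp [rtRow, sideDist_sidePos hη]

lemma rtRow_of_neg (hη : η = 1 ∨ η = -1) {j : ℤ} (hj : j < 0) :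
    rtRow k g η e (sidePos η e j + g.m) = 0 := by
  simp [rtRow, sideDist_sidePos hη, hj.ne, hj.le]

lemma sidePos_one_add : sidePos η e 1 + g.m + η = sidePos η e 0 + g.m := by
  simp only [sidePos]; ring

lemma sidePos_zero_sub : sidePos η e 0 + -η = sidePos η e 1 := by
  simp only [sidePos]; ring

include h

lemma vtx_source_of_eq {j n : ℤ} {x : Q.V} (hj : 0 < j)
    (hx : C.vtx (sidePos η e j) = some (x, n)) : σ.vtx (sidePos η e j) = some (x, n + 1) := by
  rw [h.vtx_source j hj] at hx
  obtain ⟨⟨x', n'⟩, hx', he⟩ := Option.map_eq_some_iff.1 hx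
  simp only [Prod.mk.injEq] at he
  rw [hx', he.1, ← he.2, sub_add_cancel]

lemma vtx_source_of_eq' {j n : ℤ} {x : Q.V} (hj : 0 < j)
    (hx : σ.vtx (sidePos η e j) = some (x, n + 1)) : C.vtx (sidePos η e j) = some (x, n) := by
  rw [h.vtx_source j hj]
  simp [susp, hx]

lemma vtx_target_of_eq {j n : ℤ} {x : Q.V} (hj : j ≤ 0)
    (hx : C.vtx (sidePos η e j) = some (x, n)) :
    τ.vtx (sidePos η e (1 - j) + g.m) = some (x, n) := by
  rw [← hx, ← h.vtx_target (1 - j) (by omega)]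
  congr 2; ring

/-- The inclusion of the string complex is compatible with the differentials: the component in
`P_σ`, which changes sign in the mapping cone. -/
lemma psRow_comm (hτ : τ.IsHomotopyString) (i : ℤ) :
    mulMatrix k (σ.dRow k) (psRow k g η e i) = - mulMatrix k (psRow k g η e) (C.dRow k i) := by
  obtain ⟨j, rfl⟩ := exists_sidePos h.sign e i
  rw [h.dRow C, map_add, mulMatrix_single, mulMatrix_single]
  obtain hj | rfl | rfl | rfl | hj : 1 < j ∨ j = 1 ∨ j = 0 ∨ j = -1 ∨ j < -1 := by omega
  · have h1 := h.edge_source' (j - 1) (by omega)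
    rw [sub_add_cancel] at h1
    rw [psRow_of_pos h.sign (by omega), psRow_of_pos h.sign (by omega),
      psRow_of_pos h.sign (by omega), mulMatrix_single, h.dRow σ, h.edge_source j (by omega), h1]
    obtain ⟨l, rfl⟩ : ∃ l, j = l + 1 := ⟨j - 1, by ring⟩
    rw [add_sub_cancel_right]
    simp only [distSign_succ, neg_neg, smul_add, Finsupp.smul_single, smul_eq_mul, neg_mul,
      Finsupp.single_neg, neg_add, ← distSign_comm]
  · rw [psRow_of_pos h.sign (by omega), psRow_of_pos h.sign (by omega), sub_self,
      psRow_zero h.sign, mulMatrix_single, h.dRow σ, h.edge_source 1 (by omega), h.edge_cross',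
      h.factor, distSign_succ, distSign_one]
    simp only [smul_add, Finsupp.smul_single, smul_eq_mul, one_mul, mul_one, sub_self,
      Finsupp.single_neg, neg_add, neg_neg, smul_neg]
  · rw [psRow_zero h.sign, zero_add, psRow_of_pos h.sign one_pos, mulMatrix_single, h.dRow σ,
      psRow_of_neg h.sign (by omega), h.edge_cross, zero_add, distSign_one]
    simp [h.cross_zero]
  · have h1 := h.edge_target' 1 one_pos
    have h2 := hτ.edge_mul_edge k h.sign (sidePos η e (1 + 1) + g.m)
    rw [show sidePos η e (1 + 1) + g.m + η = sidePos η e 1 + g.m by simp [sidePos]; ring,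
      ← h1] at h2
    rw [neg_add_cancel, psRow_of_neg h.sign (j := -1) (by omega),
      psRow_of_neg h.sign (j := -1 - 1) (by omega), psRow_zero h.sign]
    simp [h2]
  · rw [psRow_of_neg h.sign (by omega), psRow_of_neg h.sign (by omega),
      psRow_of_neg h.sign (by omega)]
    simp

lemma component_eq_zero {j : ℤ} (hj : 1 < j) : g.component k (sidePos η e j) = 0 := by
  have h1 := h.notMem (j := j) (by omega)
  have h2 := h.notMem (j := j - 1) (by omega)
  have h3 := h.notMem (j := j + 1) (by omega)
  rcases h.sign with rfl | rfl
  · rw [show sidePos 1 e (j - 1) = sidePos 1 e j + 1 by simp [sidePos]; ring] at h2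
    rw [show sidePos 1 e (j + 1) = sidePos 1 e j - 1 by simp [sidePos]; ring] at h3
    exact component_zero h1 h2 h3
  · rw [show sidePos (-1) e (j - 1) = sidePos (-1) e j - 1 by simp [sidePos]; ring] at h2
    rw [show sidePos (-1) e (j + 1) = sidePos (-1) e j + 1 by simp [sidePos]; ring] at h3
    exact component_zero h1 h3 h2

lemma edge_mul_component (hτ : τ.IsHomotopyString) :
    τ.edge k (sidePos η e 1 + g.m) η * g.component k (sidePos η e 0) =
      τ.edge k (sidePos η e 1 + g.m) η := by
  obtain ⟨x, n, hx, hx'⟩ := exists_vtx h.mem_zero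
  rw [component_of_mem h.mem_zero hx]
  cases hv : τ.vtx (sidePos η e 1 + g.m) with
  | some v => exact hτ.edge_mul_e k hv η (by rw [sidePos_one_add, hx'])
  | none =>
    have : τ.edge k (sidePos η e 1 + g.m) η = 0 := by
      rcases h.sign with rfl | rfl
      · rw [edge_one, hτ.letter_empty _ (.inr (by rwa [add_sub_cancel_right]))]
        exact letterElt_nil k
      · rw [edge_neg_one, hτ.letter_empty _ (.inl hv)]
        exact letterElt_nil k
    rw [this, zero_mul]

/-- The inclusion of the string complex is compatible with the differentials: the component in
`P_τ`. At distance `0`, the correction term in `psRow` cancels the part of the differential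
of `P_τ` that leads into the overlap. -/
lemma ptRow_comm (hτ : τ.IsHomotopyString) (i : ℤ) :
    mulMatrix k (g.mapRow k) (psRow k g η e i) + mulMatrix k (τ.dRow k) (ptRow k g η e i) =
      mulMatrix k (ptRow k g η e) (C.dRow k i) := by
  obtain ⟨j, rfl⟩ := exists_sidePos h.sign e i
  rw [h.dRow C, map_add, mulMatrix_single, mulMatrix_single]
  obtain hj | rfl | rfl | hj : 1 < j ∨ j = 1 ∨ j = 0 ∨ j < 0 := by omega
  · rw [psRow_of_pos h.sign (by omega), ptRow_of_pos h.sign (by omega),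
      ptRow_of_pos h.sign (by omega), ptRow_of_pos h.sign (by omega), mulMatrix_single, mapRow,
      h.component_eq_zero hj]
    simp
  · rw [psRow_of_pos h.sign (by omega), ptRow_of_pos h.sign (by omega),
      ptRow_of_pos h.sign (by omega), ptRow_of_nonpos h.sign (by omega), mulMatrix_single, mapRow,
      h.edge_cross', distSign_one]
    simp
  · have h1 := h.edge_target 1 one_pos
    rw [sub_self] at h1
    rw [psRow_zero h.sign, ptRow_of_nonpos h.sign le_rfl, ptRow_of_pos h.sign (by omega),
      ptRow_of_nonpos h.sign (by omega), mulMatrix_single, mulMatrix_single, mapRow, sub_zero,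
      h.dRow_shift, h1]
    simp [h.edge_mul_component hτ]
  · have h1 := h.edge_target (1 - j) (by omega)
    have h2 := h.edge_target' (-j) (by omega)
    rw [sub_sub_cancel] at h1
    rw [neg_neg, neg_add_eq_sub] at h2
    rw [psRow_of_neg h.sign hj, ptRow_of_nonpos h.sign hj.le, ptRow_of_nonpos h.sign (by omega),
      ptRow_of_nonpos h.sign (by omega), mulMatrix_single, h.dRow_shift, h1, h2,
      show 1 - (j - 1) = 1 - j + 1 by ring, show 1 - (j + 1) = 1 - j - 1 by ring]
    simp [add_comm]

/-- The string complex of a `SideString` is a retract of the mapping cone. -/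
def sideRetract (hσ : σ.IsHomotopyString) (hτ : τ.IsHomotopyString) : g.SideRetract k η C where
  ps := psRow k g η e
  pt := ptRow k g η e
  rs := rsRow Q k η e
  rt := rtRow k g η e
  ps_mem n i x hx := by
    obtain ⟨j, rfl⟩ := exists_sidePos h.sign e i
    obtain hj | rfl | hj : 0 < j ∨ j = 0 ∨ j < 0 := by omega
    · rw [psRow_of_pos h.sign hj]
      have := Submodule.smul_mem _ (distSign Q k j)
        (single_one_mem k (h.vtx_source_of_eq hj hx))
      simpa [distSign_comm] using this
    · obtain ⟨z, l, hz, hz'⟩ := exists_vtx h.mem_zero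
      have hx' := h.vtx_target_of_eq le_rfl hx
      rw [sub_zero] at hx'
      have := hτ.edge_mem k hx' η
      rw [sidePos_one_add] at this
      rw [psRow_zero h.sign, Finsupp.smul_single, smul_eq_mul, mul_neg, hτ.e_mul_edge k hx']
      refine single_mem_term k (Submodule.neg_mem _ ?_)
      rwa [summand, hz, ← hz', ← summand]
    · simp [psRow_of_neg h.sign hj]
  pt_mem n i x hx := by
    obtain ⟨j, rfl⟩ := exists_sidePos h.sign e i
    obtain hj | hj : 0 < j ∨ j ≤ 0 := by omega
    · simp [ptRow_of_pos h.sign hj]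
    · rw [ptRow_of_nonpos h.sign hj]
      exact single_one_mem k (h.vtx_target_of_eq hj hx)
  rs_mem n i x hx := by
    obtain ⟨j, rfl⟩ := exists_sidePos h.sign e i
    obtain hj | hj : 0 < j ∨ j ≤ 0 := by omega
    · rw [rsRow_of_pos h.sign hj]
      have := Submodule.smul_mem _ (distSign Q k j)
        (single_one_mem k (h.vtx_source_of_eq' hj hx))
      simpa [distSign_comm] using this
    · simp [rsRow_of_nonpos h.sign hj]
  rt_mem n i x hx := by
    obtain ⟨i, rfl⟩ : ∃ l, i = l + g.m := ⟨i - g.m, by ring⟩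
    obtain ⟨j, rfl⟩ := exists_sidePos h.sign e i
    obtain hj | rfl | hj : 0 < j ∨ j = 0 ∨ j < 0 := by omega
    · rw [rtRow_of_pos h.sign hj]
      exact single_one_mem k ((h.vtx_target j hj).trans hx)
    · have hx' := (g.vtx_eq _ h.mem_zero).symm.trans hx
      have := hσ.edge_mem k hx' (-η)
      rw [sidePos_zero_sub] at this
      rw [rtRow_zero h.sign, Finsupp.smul_single, smul_eq_mul, hσ.e_mul_edge k hx']
      refine single_mem_term k ?_
      by_cases h0 : σ.edge k (sidePos η e 0) (-η) = 0
      · rw [h0]; exact Submodule.zero_mem _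
      obtain ⟨y, hy, hy'⟩ := exists_of_mem_summand k this h0
      rwa [mem_summand k (h.vtx_source_of_eq' one_pos hy) rfl]
    · simp [rtRow_of_neg h.sign hj]
  comm_s := h.psRow_comm hτ
  comm_t := h.ptRow_comm hτ
  split i x n hx := by
    obtain ⟨j, rfl⟩ := exists_sidePos h.sign e i
    obtain hj | rfl | hj : 0 < j ∨ j = 0 ∨ j < 0 := by omega
    · simp [psRow_of_pos h.sign hj, ptRow_of_pos h.sign hj,
        rsRow_of_pos h.sign hj, distSign_mul_self]
    · rw [psRow_zero h.sign, ptRow_of_nonpos h.sign le_rfl, mulMatrix_single, mulMatrix_single,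
        rsRow_of_nonpos h.sign le_rfl, rtRow_of_pos h.sign (by omega)]
      simp
    · rw [psRow_of_neg h.sign hj, ptRow_of_nonpos h.sign hj.le, mulMatrix_single,
        rtRow_of_pos h.sign (by omega)]
      simp
  ps_apply i l hl hl' := by
    obtain ⟨j, rfl⟩ := exists_sidePos h.sign e i
    obtain ⟨l, rfl⟩ := exists_sidePos h.sign e l
    rw [h.beyond_iff] at hl
    have hl0 : l ≠ 0 := by
      rintro rfl
      exact hl' h.mem_zero
    obtain hj | rfl | hj : 0 < j ∨ j = 0 ∨ j < 0 := by omega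
    · rw [psRow_of_pos h.sign hj, Finsupp.single_eq_of_ne]
      rw [Ne, sidePos_inj h.sign]; omega
    · rw [psRow_zero h.sign, Finsupp.single_eq_of_ne]
      rwa [Ne, sidePos_inj h.sign]
    · simp [psRow_of_neg h.sign hj]
  pt_apply i l hl := by
    obtain ⟨j, rfl⟩ := exists_sidePos h.sign e i
    obtain ⟨l, rfl⟩ := exists_sidePos h.sign e l
    rw [h.beyond_iff] at hl
    obtain hj | hj : 0 < j ∨ j ≤ 0 := by omega
    · simp [ptRow_of_pos h.sign hj]
    · rw [ptRow_of_nonpos h.sign hj, Finsupp.single_eq_of_ne]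
      rw [Ne, add_left_inj, sidePos_inj h.sign]; omega
  rs_eq_zero i hi := by
    obtain ⟨j, rfl⟩ := exists_sidePos h.sign e i
    rw [h.beyond_iff] at hi
    exact rsRow_of_nonpos h.sign (by omega)
  rt_eq_zero i hi hi' := by
    obtain ⟨j, rfl⟩ := exists_sidePos h.sign e i
    rw [h.beyond_iff] at hi
    have : j ≠ 0 := by
      rintro rfl
      exact hi' h.mem_zero
    exact rtRow_of_neg h.sign (by omega)
  rs_ps i := by
    obtain ⟨j, rfl⟩ := exists_sidePos h.sign e i
    obtain hj | hj : 0 < j ∨ j ≤ 0 := by omega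
    · simp [h.beyond_iff, hj, rsRow_of_pos h.sign hj, psRow_of_pos h.sign hj,
        distSign_mul_self]
    · simp [h.beyond_iff, hj.not_gt, rsRow_of_nonpos h.sign hj]
  rs_pt i := by
    obtain ⟨j, rfl⟩ := exists_sidePos h.sign e i
    obtain hj | hj : 0 < j ∨ j ≤ 0 := by omega
    · simp [rsRow_of_pos h.sign hj, ptRow_of_pos h.sign hj]
    · simp [rsRow_of_nonpos h.sign hj]
  rt_ps i := by
    obtain ⟨j, rfl⟩ := exists_sidePos h.sign e i
    have e1 : sidePos η e j - η = sidePos η e (j + 1) := by simp only [sidePos]; ring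
    have e2 : sidePos η e j + η = sidePos η e (j - 1) := by simp only [sidePos]; ring
    rw [e1, e2, h.beyond_iff]
    obtain hj | rfl | rfl | hj : 1 < j ∨ j = 1 ∨ j = 0 ∨ j < 0 := by omega
    · rw [rtRow_of_pos h.sign (by omega), mulMatrix_single, psRow_of_neg h.sign (by omega),
        if_neg (fun h' => h.notMem (by omega) h'.1), if_neg (fun h' => h.notMem (by omega) h'.2)]
      simp
    · rw [rtRow_of_pos h.sign one_pos, mulMatrix_single, sub_self, psRow_zero h.sign,
        if_neg (fun h' => h.notMem one_pos h'.1), if_pos ⟨one_pos, h.mem_zero⟩]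
      simp
    · rw [rtRow_zero h.sign, mulMatrix_single, psRow_of_pos h.sign one_pos,
        if_pos ⟨h.mem_zero, h.notMem one_pos⟩, if_neg (by simp), distSign_one]
      simp
    · have h1 : ¬ (sidePos η e j ∈ g.R ∧ sidePos η e (j + 1) ∉ g.R) := by
        rintro ⟨h1, h2⟩
        refine h2 (g.ordConnected.uIcc_subset h1 h.mem_zero ?_)
        rw [Set.mem_uIcc]
        rcases h.sign with rfl | rfl <;> simp only [sidePos] <;> omega
      rw [rtRow_of_neg h.sign hj, if_neg h1, if_neg (by omega)]
      simp
  rt_pt i := by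
    obtain ⟨j, rfl⟩ := exists_sidePos h.sign e i
    rw [h.beyond_iff]
    obtain hj | rfl | hj : 0 < j ∨ j = 0 ∨ j < 0 := by omega
    · rw [rtRow_of_pos h.sign hj, mulMatrix_single, ptRow_of_nonpos h.sign (by omega), if_pos hj,
        sub_sub_cancel, one_smul]
    · rw [rtRow_zero h.sign, mulMatrix_single, ptRow_of_pos h.sign one_pos, smul_zero,
        if_neg (by omega)]
    · rw [rtRow_of_neg h.sign hj, map_zero, if_neg (by omega)]

end SideString

end GraphMapData

/-! ### Reversal of strings and of graph maps -/

namespace GradedWalk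

variable {w : Q.GradedWalk}

lemma IsHomotopyString.bar (hw : w.IsHomotopyString) (N : ℤ) : (w.bar N).IsHomotopyString where
  ordConnected := ⟨fun x hx y hy z hz =>
    hw.ordConnected.out hy hx ⟨by linarith [hz.2], by linarith [hz.1]⟩⟩
  letter_spec i x m y n hx hy := by
    have hy' : w.vtx (N + 1 - i) = some (y, n) := by
      rw [← hy]; simp only [GradedWalk.bar]; congr 1; ring
    have hx' : w.vtx (N + 1 - i - 1) = some (x, m) := by
      rw [← hx]; simp only [GradedWalk.bar]; congr 1; ring
    rcases hw.letter_spec _ _ _ _ _ hy' hx' with ⟨p, hp, hl, hn⟩ | ⟨p, hp, hl, hn⟩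
    · exact .inr ⟨p, hp, by simp only [GradedWalk.bar, hl, invRev_direct], hn⟩
    · exact .inl ⟨p, hp, by simp only [GradedWalk.bar, hl, invRev_inverse], hn⟩
  letter_empty i h := by
    have := hw.letter_empty (N + 1 - i) (by
      rw [or_comm]
      simp only [GradedWalk.bar] at h
      rwa [show N + 1 - i - 1 = N - i by ring, show N + 1 - i = N - (i - 1) by ring])
    simp [GradedWalk.bar, this]
  junction i := by
    have := (hw.junction (N - i)).symm
    simp only [GradedWalk.bar]
    rwa [show N + 1 - (i + 1) = N - i by ring, show N + 1 - i = N - i + 1 by ring]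
  left_infinite h := by
    obtain ⟨M, hM⟩ := hw.right_infinite fun ⟨l, hl⟩ => h ⟨N - l, fun i hi => by
      have := hl (a := N - i) hi
      omega⟩
    refine ⟨N + 1 - M, fun i hi => ?_⟩
    obtain ⟨a, ha⟩ := hM (N + 1 - i) (by omega)
    exact ⟨a, by simp [GradedWalk.bar, ha, FreeGroup.invRev]⟩
  right_infinite h := by
    obtain ⟨M, hM⟩ := hw.left_infinite fun ⟨l, hl⟩ => h ⟨N - l, fun i hi => by
      have := hl (a := N - i) hi
      omega⟩
    refine ⟨N + 1 - M, fun i hi => ?_⟩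
    obtain ⟨a, ha⟩ := hM (N + 1 - i) (by omega)
    exact ⟨a, by simp [GradedWalk.bar, ha, FreeGroup.invRev]⟩

lemma edge_bar_one (k : Type u) [Field k] (w : Q.GradedWalk) (N i : ℤ) :
    (w.bar N).edge k i 1 = w.edge k (N - i) (-1) := by
  rw [edge_one, edge_neg_one, GradedWalk.bar, FreeGroup.invRev_invRev,
    show N + 1 - (i + 1) = N - i by ring]

lemma edge_bar_neg_one (k : Type u) [Field k] (w : Q.GradedWalk) (N i : ℤ) :
    (w.bar N).edge k i (-1) = w.edge k (N - i) 1 := by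
  rw [edge_one, edge_neg_one, show N - i + 1 = N + 1 - i by ring]
  rfl

end GradedWalk

lemma LeftEndpoint.invRev {u v : Q.Word} {f : List Q.A} (h : LeftEndpoint u v f) :
    RightEndpoint (FreeGroup.invRev u) (FreeGroup.invRev v) f := by
  rcases h with ⟨q, _, hq, hf⟩ | ⟨p, _, hp, hf⟩ | ⟨p, q⟩
  · exact .rg2 q f hq hf
  · rw [invRev_inverse, invRev_inverse]
    exact .rg1 p f hp hf
  · rw [invRev_inverse]
    exact .rg3 p q

lemma RightEndpoint.invRev {u v : Q.Word} {f : List Q.A} (h : RightEndpoint u v f) :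
    LeftEndpoint (FreeGroup.invRev u) (FreeGroup.invRev v) f := by
  rcases h with ⟨p, _, hp, hf⟩ | ⟨q, _, hq, hf⟩ | ⟨p, q⟩
  · exact .lg2 p f hp hf
  · rw [invRev_inverse, invRev_inverse]
    exact .lg1 q f hq hf
  · rw [invRev_inverse]
    exact .lg3 p q

lemma NonzeroWord.invRev {w : Q.Word} (h : NonzeroWord w) : NonzeroWord (FreeGroup.invRev w) := by
  obtain ⟨p, x, y, hp, rfl | rfl⟩ := h
  · exact ⟨p, x, y, hp, .inr rfl⟩
  · exact ⟨p, x, y, hp, .inl (invRev_inverse p)⟩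

lemma invRev_eq_nil_iff {w : Q.Word} : FreeGroup.invRev w = [] ↔ w = [] := by
  simp [FreeGroup.invRev]

namespace GraphMapData

variable {σ τ : Q.GradedWalk} (g : GraphMapData σ τ)

lemma isGreatest_neg {a : ℤ} (h : IsLeast {i | -i ∈ g.R} a) : IsGreatest g.R (-a) :=
  ⟨h.1, fun i hi => by
    obtain ⟨-, h⟩ := h
    have := h (a := -i) (by simpa using hi)
    omega⟩

lemma isLeast_neg {a : ℤ} (h : IsGreatest {i | -i ∈ g.R} a) : IsLeast g.R (-a) :=
  ⟨h.1, fun i hi => by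
    obtain ⟨-, h⟩ := h
    have := h (a := -i) (by simpa using hi)
    omega⟩

/-- The graph map between the reversed strings. -/
def bar : GraphMapData (σ.bar 0) (τ.bar 0) where
  R := {i | -i ∈ g.R}
  m := -g.m
  fL := g.fR
  fR := g.fL
  nonempty := by
    obtain ⟨r, hr⟩ := g.nonempty
    exact ⟨-r, by simpa using hr⟩
  ordConnected := ⟨fun x hx y hy z hz =>
    g.ordConnected.out hy hx ⟨by linarith [hz.2], by linarith [hz.1]⟩⟩
  subset_pos i hi := by
    have := g.subset_pos hi
    simpa [GradedWalk.pos, GradedWalk.bar] using this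
  vtx_eq i hi := by
    have := g.vtx_eq _ hi
    simp only [GradedWalk.bar]
    rwa [show 0 - (i + -g.m) = -i + g.m by ring, zero_sub]
  letter_eq i hi hi' := by
    have := g.letter_eq (-(i - 1)) hi' (by rwa [show -(i - 1) - 1 = -i by ring])
    simp only [GradedWalk.bar]
    rw [show 0 + 1 - (i + -g.m) = -(i - 1) + g.m by ring, this]
    congr 2; ring
  right_endpoint a ha := by
    have := (g.left_endpoint _ (g.isGreatest_neg ha)).invRev
    simp only [GradedWalk.bar]
    rwa [show 0 + 1 - a = -a + 1 by ring, show 0 + 1 - (a + -g.m) = -a + g.m + 1 by ring]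
  left_endpoint a ha := by
    have := (g.right_endpoint _ (g.isLeast_neg ha)).invRev
    simp only [GradedWalk.bar]
    rwa [show 0 + 1 - (a + 1) = -a by ring, show 0 + 1 - (a + -g.m + 1) = -a + g.m by ring]

variable {g}

lemma isLeast_bar {b : ℤ} (h : IsGreatest g.R b) : IsLeast g.bar.R (-b) :=
  ⟨by simpa [bar] using h.1, fun i hi => by
    obtain ⟨-, h⟩ := h
    have := h (a := -i) hi
    omega⟩

lemma component_bar (k : Type u) [Field k] (i : ℤ) : g.bar.component k i = g.component k (-i) := by
  by_cases h : -i ∈ g.R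
  · obtain ⟨x, n, hx, hx'⟩ := exists_vtx h
    rw [component_of_mem h hx, component_of_mem (g := g.bar) h (x := x) (n := n)]
    simpa [GradedWalk.bar] using hx
  by_cases h1 : -i + 1 ∈ g.R
  · rw [component_right h h1, component_left (g := g.bar) h
      (show -(i - 1) ∈ g.R by rwa [show -(i - 1) = -i + 1 by ring])]
    rfl
  by_cases h2 : -i - 1 ∈ g.R
  · rw [component_left h h2, component_right (g := g.bar) h
      (show -(i + 1) ∈ g.R by rwa [show -(i + 1) = -i - 1 by ring])]
    rfl
  rw [component_zero h h1 h2, component_zero (g := g.bar) h]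
  · exact fun h' => h2 (by rwa [show -i - 1 = -(i + 1) by ring])
  · exact fun h' => h1 (by rwa [show -i + 1 = -(i - 1) by ring])

lemma CompatiblyOriented.bar (hg : g.CompatiblyOriented) : g.bar.CompatiblyOriented := by
  intro a ha hL hR
  have ha' : g.R = {-a} := by
    ext i
    have : -i ∈ g.bar.R ↔ -i = a := by rw [ha]; rfl
    rw [show -i ∈ g.bar.R ↔ i ∈ g.R by simp [GraphMapData.bar]] at this
    rw [this, Set.mem_singleton_iff]
    omega
  obtain ⟨h1, h2, h3, h4⟩ := hg (-a) ha' hR hL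
  simp only [GradedWalk.bar, GraphMapData.bar]
  rw [show 0 + 1 - a = -a + 1 by ring, show 0 + 1 - (a + -g.m) = -a + g.m + 1 by ring,
    show 0 + 1 - (a + 1) = -a by ring, show 0 + 1 - (a + -g.m + 1) = -a + g.m by ring]
  simp only [ne_eq, invRev_eq_nil_iff]
  refine ⟨fun h h' => ?_, fun h h' => ?_, fun h h' h'' h''' => ?_, fun h h' h'' h''' => ?_⟩
  · simpa [FreeGroup.invRev_append] using (h2 h h').invRev
  · simpa [FreeGroup.invRev_append] using (h1 h h').invRev
  · intro hw
    exact h4 h h' h'' h''' (by simpa [FreeGroup.invRev_append] using hw.invRev)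
  · intro hw
    exact h3 h h' h'' h''' (by simpa [FreeGroup.invRev_append] using hw.invRev)

open Classical in
/-- The string at the left end of the overlap is the reverse of the string at the right end of the
overlap of the reversed graph map. -/
lemma leftString_eq_bar (b : ℤ) : g.leftString b = (g.bar.rightString (-b)).bar 0 := by
  have hm : g.bar.m = -g.m := rfl
  have e1 : (σ.bar 0).letter (-b) = FreeGroup.invRev (σ.letter (b + 1)) := by
    simp only [GradedWalk.bar]; congr 2; ring
  have e2 : (τ.bar 0).letter (-b + -g.m) = FreeGroup.invRev (τ.letter (b + g.m + 1)) := by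
    simp only [GradedWalk.bar]; congr 2; ring
  have e3 : ((τ.above (b + g.m)).bar (b + (b + g.m) + 1)) =
      (((τ.bar 0).below (-b + -g.m)).bar (-b + (-b + -g.m) - 1)).bar 0 := by
    simp only [GradedWalk.bar, GradedWalk.above, GradedWalk.below,
      GradedWalk.mk.injEq]
    refine ⟨funext fun i => ?_, funext fun i => ?_⟩
    · refine if_congr (by omega) (by congr 1; ring) rfl
    · rw [FreeGroup.invRev_invRev]
      by_cases hi : i < b + 1
      · rw [if_pos (by omega), if_pos (by omega)]
        congr 2; ring
      · rw [if_neg (by omega), if_neg (by omega)]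
        rfl
  have e4 : (σ.above b).susp = (((σ.bar 0).below (-b)).susp).bar 0 := by
    simp only [GradedWalk.bar, GradedWalk.susp, GradedWalk.above, GradedWalk.below,
      GradedWalk.mk.injEq]
    refine ⟨funext fun i => ?_, funext fun i => ?_⟩
    · by_cases hi : b < i
      · rw [if_pos hi, if_pos (by omega), sub_sub_cancel]
      · rw [if_neg hi, if_neg (by omega)]
    · by_cases hi : b + 1 < i
      · rw [if_pos hi, if_pos (by omega), FreeGroup.invRev_invRev]
        congr 1; ring
      · rw [if_neg hi, if_neg (by omega)]
        rfl
  unfold leftString rightString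
  simp only [hm, e1, e2, e3, e4, invRev_eq_nil_iff]
  split_ifs
  · simp [GradedWalk.bar, GradedWalk.empty]
  · rfl
  · rfl
  · generalize ((τ.bar 0).below (-b + -g.m)).bar (-b + (-b + -g.m) - 1) = l
    generalize ((σ.bar 0).below (-b)).susp = r
    simp only [GradedWalk.bar, GradedWalk.concat, GradedWalk.mk.injEq]
    refine ⟨funext fun i => ?_, funext fun i => ?_⟩
    · split_ifs <;> first | rfl | omega
    · obtain hi | hi | hi : i < b + 1 ∨ i = b + 1 ∨ b + 1 < i := by omega
      · rw [if_pos hi, if_neg (by omega), if_neg (by omega)]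
      · rw [if_neg (by omega), if_pos hi, if_neg (by omega), if_pos (by omega),
          ← FreeGroup.reduce_invRev, FreeGroup.invRev_append, FreeGroup.invRev_invRev,
          FreeGroup.invRev_invRev]
      · rw [if_neg (by omega), if_neg (by omega), if_pos (by omega)]

end GraphMapData

/-! ### Letters at the ends of the overlap -/

lemma getLast?_direct (p : List Q.A) : (direct p).getLast? = p.getLast?.map (·, true) := by
  simp [direct]

lemma head?_direct (p : List Q.A) : (direct p).head? = p.head?.map (·, true) := by
  simp [direct]

lemma getLast?_inverse (p : List Q.A) : (inverse p).getLast? = p.head?.map (·, false) := by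
  cases p <;> simp [inverse, direct, FreeGroup.invRev]

lemma head?_inverse (p : List Q.A) : (inverse p).head? = p.getLast?.map (·, false) := by
  rcases List.eq_nil_or_concat p with rfl | ⟨p, a, rfl⟩ <;>
    simp [inverse, direct, FreeGroup.invRev]

lemma direct_eq_nil_iff {p : List Q.A} : direct p = [] ↔ p = [] := by simp [direct]

lemma inverse_eq_nil_iff {p : List Q.A} : inverse p = [] ↔ p = [] := by
  rw [inverse, invRev_eq_nil_iff, direct_eq_nil_iff]

lemma Junction.left_of_append {u v w : Q.Word} (h : Junction (u ++ v) w) (hv : v ≠ []) :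
    Junction v w := fun x hx =>
  h x (by rwa [List.getLast?_append_of_ne_nil _ hv])

lemma Junction.right_of_append {u v w : Q.Word} (h : Junction w (u ++ v)) (hu : u ≠ []) :
    Junction w u := fun x hx y hy =>
  h x hx y (by rwa [List.head?_append_of_ne_nil _ hu])

lemma Junction.append_left {u v w : Q.Word} (h : Junction v w) (hv : v ≠ []) :
    Junction (u ++ v) w := fun x hx =>
  h x (by rwa [List.getLast?_append_of_ne_nil _ hv] at hx)

lemma Junction.append_right {u v w : Q.Word} (h : Junction w u) (hu : u ≠ []) :
    Junction w (u ++ v) := fun x hx y hy =>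
  h x hx y (by rwa [List.head?_append_of_ne_nil _ hu] at hy)

lemma IsPath.append {p q : List Q.A} {x y z : Q.V} (hp : Q.IsPath p x y) (hq : Q.IsPath q y z)
    (h : ∀ b ∈ p.getLast?, ∀ a ∈ q.head?, ¬ Q.rel b a) : Q.IsPath (p ++ q) x z where
  target := by rw [List.head?_append_of_ne_nil _ (isPath_ne_nil hp), hp.target]
  source := by rw [List.getLast?_append_of_ne_nil _ (isPath_ne_nil hq), hq.source]
  chain := by
    refine List.isChain_append.2 ⟨hp.chain, hq.chain, fun b hb a ha => ⟨?_, h b hb a ha⟩⟩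
    have h1 := hp.source
    have h2 := hq.target
    rw [Option.mem_def] at hb ha
    rw [hb] at h1
    rw [ha] at h2
    simp only [Option.map_some, Option.some.injEq] at h1 h2
    rw [h1, h2]

lemma IsPath.right_of_append {p q : List Q.A} {x y z : Q.V} (h : Q.IsPath (p ++ q) x z)
    (hp : Q.IsPath p x y) (hq : q ≠ []) : Q.IsPath q y z where
  target := by
    obtain ⟨a, ha⟩ := Option.ne_none_iff_exists'.1 (mt List.head?_eq_none_iff.1 hq)
    obtain ⟨b, hb⟩ :=
      Option.ne_none_iff_exists'.1 (mt List.getLast?_eq_none_iff.1 (isPath_ne_nil hp))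
    have h1 := hp.source
    rw [hb, Option.map_some] at h1
    rw [ha, Option.map_some, ← (isPath_junction h b hb a ha).1, h1]
  source := isPath_source_append h hq
  chain := (List.isChain_append.1 h.chain).2.1

lemma IsPath.left_of_append {p q : List Q.A} {x y z : Q.V} (h : Q.IsPath (p ++ q) x z)
    (hq : Q.IsPath q y z) (hp : p ≠ []) : Q.IsPath p x y where
  target := by rw [← h.target, List.head?_append_of_ne_nil _ hp]
  source := isPath_source_left h hq.target hp
  chain := (List.isChain_append.1 h.chain).1

namespace GradedWalk

variable {w : Q.GradedWalk}

/-- A letter that starts with the inverse of the arrow `c` sits to the right of the vertex `s c`. -/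
lemma IsHomotopyString.source_of_head (hw : w.IsHomotopyString) {i : ℤ} {c : Q.A}
    (h : (c, false) ∈ (w.letter i).head?) : ∃ n, w.vtx i = some (Q.s c, n) := by
  have hne : w.letter i ≠ [] := by
    intro h'
    rw [h'] at h
    simp at h
  have h1 := mt (hw.letter_empty i) hne
  push Not at h1
  obtain ⟨⟨x, m⟩, hx⟩ := Option.ne_none_iff_exists'.1 h1.1
  obtain ⟨⟨y, n⟩, hy⟩ := Option.ne_none_iff_exists'.1 h1.2
  rcases hw.letter_spec i x m y n hx hy with ⟨p, hp, hl, -⟩ | ⟨p, hp, hl, -⟩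
  · rw [hl, head?_direct] at h
    simp at h
  · rw [hl, head?_inverse] at h
    have := hp.source
    cases hc : p.getLast? with
    | none => simp [hc] at h
    | some c' =>
      simp only [hc, Option.map_some, Option.mem_def, Option.some.injEq, Prod.mk.injEq,
        and_true] at h this
      subst h this
      exact ⟨m, hx⟩

/-- A letter that starts with the arrow `c` sits to the right of the vertex `t c`. -/
lemma IsHomotopyString.target_of_head (hw : w.IsHomotopyString) {i : ℤ} {c : Q.A}
    (h : (c, true) ∈ (w.letter i).head?) : ∃ n, w.vtx i = some (Q.t c, n) := by
  have hne : w.letter i ≠ [] := by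
    intro h'
    rw [h'] at h
    simp at h
  have h1 := mt (hw.letter_empty i) hne
  push Not at h1
  obtain ⟨⟨x, m⟩, hx⟩ := Option.ne_none_iff_exists'.1 h1.1
  obtain ⟨⟨y, n⟩, hy⟩ := Option.ne_none_iff_exists'.1 h1.2
  rcases hw.letter_spec i x m y n hx hy with ⟨p, hp, hl, -⟩ | ⟨p, hp, hl, -⟩
  · rw [hl, head?_direct] at h
    have := hp.target
    cases hc : p.head? with
    | none => simp [hc] at h
    | some c' =>
      simp only [hc, Option.map_some, Option.mem_def, Option.some.injEq, Prod.mk.injEq,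
        and_true] at h this
      subst h this
      exact ⟨m, hx⟩
  · rw [hl, head?_inverse] at h
    simp at h

end GradedWalk

open Classical in
lemma reduce_of_forall {w : Q.Word} {b : Bool} (h : ∀ u ∈ w, u.2 = b) :
    FreeGroup.reduce w = w := by
  refine FreeGroup.IsReduced.reduce_eq (List.Pairwise.isChain ?_)
  rw [List.pairwise_iff_forall_sublist]
  intro u v huv _
  rw [h u (huv.subset (by simp)), h v (huv.subset (by simp))]

open Classical in
lemma reduce_direct (p : List Q.A) : FreeGroup.reduce (direct p) = direct p :=
  reduce_of_forall (b := true) (by simp [direct])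

open Classical in
lemma reduce_inverse (p : List Q.A) : FreeGroup.reduce (inverse p) = inverse p :=
  reduce_of_forall (b := false) (by simp [direct, inverse, FreeGroup.invRev])

open Classical in
lemma reduce_inverse_append_direct (p f : List Q.A) :
    FreeGroup.reduce (inverse (p ++ f) ++ direct p) = inverse f := by
  rw [← reduce_inverse f]
  refine FreeGroup.reduce.sound ?_
  rw [inverse_append, ← FreeGroup.mul_mk, ← FreeGroup.mul_mk, inverse, inverse, ← FreeGroup.inv_mk,
    ← FreeGroup.inv_mk, inv_mul_cancel_right]

open Classical in
lemma reduce_direct_append_inverse (q f : List Q.A) :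
    FreeGroup.reduce (direct q ++ inverse (f ++ q)) = inverse f := by
  rw [← reduce_inverse f]
  refine FreeGroup.reduce.sound ?_
  rw [inverse_append, ← FreeGroup.mul_mk, ← FreeGroup.mul_mk, inverse, inverse, ← FreeGroup.inv_mk,
    ← FreeGroup.inv_mk, mul_inv_cancel_left]

/-- In a gentle quiver, an arrow `l` ending and an arrow `c` starting at a vertex form a
nonzero path if some letter `v` forms a boundary both with `c` and with the inverse of `l`. -/
lemma IsGentle.not_rel_of_boundary (hQ : Q.IsGentle) {v : Q.A × Bool} {l c : Q.A}
    (h1 : Boundary v (c, true)) (h2 : Boundary v (l, false)) : ¬ Q.rel l c := by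
  rcases v with ⟨b, _ | _⟩
  · exact fun h => h1 (hQ.rel_right l b c h2 h)
  · exact fun h => h2 (hQ.rel_left c b l h1 h)

/-- The possible letters `u = σ_R` and `v = τ_R` at the right end of the overlap, with the component
`f = f_R` of the graph map and the resulting letter `l` between them in the string of
the mapping cone, which is `∅` if `u` or `v` is. -/
inductive CrossLetter : Q.Word → Q.Word → List Q.A → Q.Word → Prop
  | rg1 (p f : List Q.A) : p ≠ [] → f ≠ [] →
      CrossLetter (direct p) (direct (p ++ f)) f (inverse f)
  | rg2 (q f : List Q.A) : q ≠ [] → f ≠ [] →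
      CrossLetter (inverse (f ++ q)) (inverse q) f (inverse f)
  | nil (p q : List Q.A) : p = [] ∨ q = [] → CrossLetter (direct p) (inverse q) [] []
  | mul (p q : List Q.A) : p ≠ [] → q ≠ [] →
      (∀ b ∈ q.getLast?, ∀ a ∈ p.head?, ¬ Q.rel b a) →
      CrossLetter (direct p) (inverse q) [] (direct (q ++ p))

namespace GraphMapData

variable {σ τ : Q.GradedWalk} {g : GraphMapData σ τ}

/-- At the left end of a trivial overlap, or at the letter to the left of the right end
of a longer one, either `σ` and `τ` have letters with the same last arrow, or the overlap is trivial
and there is no component `f_L`. -/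
lemma exists_common_last (hσ : σ.IsHomotopyString) {a : ℤ} (ha : IsLeast g.R a) :
    (∃ v, v ∈ (σ.letter (a + 1)).getLast? ∧ v ∈ (τ.letter (a + g.m + 1)).getLast?) ∨
    (g.R = {a} ∧ g.fL = [] ∧ ∃ p q, σ.letter (a + 1) = inverse p ∧
      τ.letter (a + g.m + 1) = direct q) := by
  by_cases h1 : a + 1 ∈ g.R
  · left
    obtain ⟨x, n, hx, -⟩ := exists_vtx h1
    obtain ⟨y, l, hy, -⟩ := exists_vtx ha.1
    have hl := g.letter_eq (a + 1) h1 (by simpa using ha.1)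
    rw [add_right_comm, hl]
    have hne : σ.letter (a + 1) ≠ [] := by
      rcases hσ.letter_spec (a + 1) x n y l hx (by simpa using hy) with
        ⟨p, hp, h, -⟩ | ⟨p, hp, h, -⟩
      · rw [h, Ne, direct_eq_nil_iff]; exact isPath_ne_nil hp
      · rw [h, Ne, inverse_eq_nil_iff]; exact isPath_ne_nil hp
    obtain ⟨v, hv⟩ := Option.ne_none_iff_exists'.1 (mt List.getLast?_eq_none_iff.1 hne)
    exact ⟨v, hv, hv⟩
  · have hb := isGreatest_of ha.1 h1
    have hL := g.left_endpoint a hb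
    have hR : g.R = {a} := Set.Subset.antisymm (fun i hi => le_antisymm (hb.2 hi) (ha.2 hi))
      (Set.singleton_subset_iff.2 ha.1)
    generalize σ.letter (a + 1) = u at hL
    generalize τ.letter (a + g.m + 1) = v at hL
    generalize g.fL = f at hL
    rcases hL with ⟨q, _, hq, hf⟩ | ⟨p, _, hp, hf⟩ | ⟨p, q⟩
    · left
      obtain ⟨b, hb⟩ := Option.ne_none_iff_exists'.1 (mt List.getLast?_eq_none_iff.1 hq)
      refine ⟨(b, true), ?_, ?_⟩
      · rw [getLast?_direct, List.getLast?_append_of_ne_nil _ hq, hb]; rfl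
      · rw [getLast?_direct, hb]; rfl
    · left
      obtain ⟨b, hb⟩ := Option.ne_none_iff_exists'.1 (mt List.head?_eq_none_iff.1 hp)
      refine ⟨(b, false), ?_, ?_⟩
      · rw [getLast?_inverse, hb]; rfl
      · rw [getLast?_inverse, List.head?_append_of_ne_nil _ hp, hb]; rfl
    · exact .inr ⟨hR, rfl, p, q, rfl, rfl⟩

variable (g) in
open Classical in
/-- The letter between the two parts of the string at the right end `a` of the overlap; it is `∅`
if one of the two parts is empty. -/
def crossLetter (a : ℤ) : Q.Word :=
  if σ.letter a = [] ∨ τ.letter (a + g.m) = [] then []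
  else FreeGroup.reduce (FreeGroup.invRev (τ.letter (a + g.m)) ++ σ.letter a)

lemma isPath_of_nonzeroWord_direct {p : List Q.A} (h : NonzeroWord (direct p)) :
    ∃ x y, Q.IsPath p x y := by
  obtain ⟨q, x, y, hq, h | h⟩ := h
  · obtain rfl := GradedWalk.direct_inj h
    exact ⟨x, y, hq⟩
  · have : p = [] := by
      by_contra hp
      exact GradedWalk.direct_ne_inverse hp h
    subst this
    have := isPath_ne_nil hq
    rw [eq_comm, show direct ([] : List Q.A) = [] from rfl, inverse_eq_nil_iff] at h
    exact absurd h this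

/-- The classification of the letters at the right end of the overlap. In the case of (RG3), the
product of the two letters is nonzero by gentleness, or because of the compatible
orientation if the overlap is trivial and there is no component `f_L`. -/
lemma crossLetter_spec (hQ : Q.IsGentle) (hσ : σ.IsHomotopyString) (hτ : τ.IsHomotopyString)
    (hg : g.CompatiblyOriented) {a : ℤ} (ha : IsLeast g.R a) :
    CrossLetter (σ.letter a) (τ.letter (a + g.m)) g.fR (g.crossLetter a) := by
  have hR := g.right_endpoint a ha
  have hJ := hσ.junction a
  have hJ' := hτ.junction (a + g.m)
  have hcl := exists_common_last hσ ha
  have hg' : g.R = {a} → g.fL = [] → g.fR = [] → _ := fun h1 h2 h3 => (hg a h1 h2 h3).1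
  unfold crossLetter
  generalize σ.letter a = u at *
  generalize τ.letter (a + g.m) = v at *
  generalize g.fR = f at *
  rcases hR with ⟨p, _, hp, hf⟩ | ⟨q, _, hq, hf⟩ | ⟨p, q⟩
  · rw [if_neg (by simp [direct_eq_nil_iff, hp]), invRev_direct, reduce_inverse_append_direct]
    exact .rg1 p f hp hf
  · rw [if_neg (by simp [inverse_eq_nil_iff, hq]), invRev_inverse, reduce_direct_append_inverse]
    exact .rg2 q f hq hf
  · simp only [direct_eq_nil_iff, inverse_eq_nil_iff]
    split_ifs with h
    · exact .nil p q h
    push Not at h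
    rw [invRev_inverse, ← direct_append, reduce_direct]
    refine .mul p q h.1 h.2 fun l hl c hc => ?_
    rcases hcl with ⟨v, hv, hv'⟩ | ⟨h1, h2, -⟩
    · refine hQ.not_rel_of_boundary (hJ v hv (c, true) ?_) (hJ' v hv' (l, false) ?_)
      · rw [head?_direct, hc]; rfl
      · rw [head?_inverse, hl]; rfl
    · have := hg' h1 h2 rfl (by simpa [direct_eq_nil_iff] using h.1)
        (by simpa [inverse_eq_nil_iff] using h.2)
      rw [invRev_inverse, ← direct_append] at this
      obtain ⟨x, y, hxy⟩ := isPath_of_nonzeroWord_direct this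
      exact (isPath_junction hxy l hl c hc).2

end GraphMapData

/-! ### The strings at the ends of the overlap -/

namespace GraphMapData

variable {σ τ : Q.GradedWalk} {g : GraphMapData σ τ}

/-- A string ends at a position without a letter to its right. -/
lemma vtx_eq_none_of_lt (hσ : σ.IsHomotopyString) {a i : ℤ} {v : Q.V × ℤ}
    (ha : σ.vtx a = some v) (h : σ.letter a = []) (hi : i < a) : σ.vtx i = none := by
  by_contra h'
  have h1 : σ.vtx (a - 1) ≠ none := hσ.ordConnected.out h'
    (show a ∈ σ.pos by simp [pos, ha]) ⟨by omega, by omega⟩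
  obtain ⟨⟨y, n⟩, hy⟩ := Option.ne_none_iff_exists'.1 h1
  rcases hσ.letter_spec a v.1 v.2 y n ha hy with ⟨p, hp, hl, -⟩ | ⟨p, hp, hl, -⟩
  · rw [hl, direct_eq_nil_iff] at h
    exact isPath_ne_nil hp h
  · rw [hl, inverse_eq_nil_iff] at h
    exact isPath_ne_nil hp h

/-- The string at the right end of the overlap is a concatenation in all cases: if one of the two
parts is empty, then so is the letter between them. -/
lemma rightString_eq_concat (hσ : σ.IsHomotopyString) (hτ : τ.IsHomotopyString) {a : ℤ}
    (ha : a ∈ g.R) : g.rightString a = .concat a ((τ.below (a + g.m)).bar (a + (a + g.m) - 1))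
      (g.crossLetter a) (σ.below a).susp := by
  obtain ⟨x, n, hx, hx'⟩ := exists_vtx ha
  have hσv : σ.letter a = [] → ∀ i < a, σ.vtx i = none := fun h i => vtx_eq_none_of_lt hσ hx h
  have hτv : τ.letter (a + g.m) = [] → ∀ i < a + g.m, τ.vtx i = none := fun h i =>
    vtx_eq_none_of_lt hτ hx' h
  have hσl : σ.letter a = [] → ∀ i < a, σ.letter i = [] := fun h i hi =>
    hσ.letter_empty i (.inl (hσv h i hi))
  have hτl : τ.letter (a + g.m) = [] → ∀ i < a + g.m, τ.letter i = [] := fun h i hi =>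
    hτ.letter_empty i (.inl (hτv h i hi))
  unfold rightString crossLetter
  simp only []
  split_ifs with h1 h2 h3 h4 h5 h6 <;>
    simp only [GradedWalk.concat, GradedWalk.bar, GradedWalk.susp, GradedWalk.below,
      GradedWalk.empty, GradedWalk.mk.injEq]
  · refine ⟨funext fun i => ?_, funext fun i => ?_⟩
    · split_ifs with h
      · simp [hσv h1.1 i h]
      · exact (hτv h1.2 _ (by omega)).symm
      · rfl
    · split_ifs with h h' h''
      · exact (hσl h1.1 i h).symm
      · rfl
      · rw [hτl h1.2 _ h'']; rfl
      · rfl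
  · tauto
  · refine ⟨funext fun i => ?_, funext fun i => ?_⟩
    · by_cases h : i < a
      · rw [if_neg (by omega), if_pos h, if_pos h, hσv h3 i h, Option.map_none]
      · rw [if_pos (by omega), if_neg h]
    · obtain h | h | h : i < a ∨ i = a ∨ a < i := by omega
      · rw [if_neg (by omega), if_pos h, if_pos h, hσl h3 i h]; rfl
      · rw [if_neg (by omega), if_neg (by omega), if_pos h]; rfl
      · rw [if_pos (by omega), if_neg (by omega), if_neg (by omega)]
  · tauto
  · refine ⟨funext fun i => ?_, funext fun i => ?_⟩
    · by_cases h : i < a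
      · rw [if_pos h, if_pos h]
      · rw [if_neg h, if_neg h, if_pos (by omega), hτv h5 _ (by omega), Option.map_none]
    · obtain h | h | h : i < a ∨ i = a ∨ a < i := by omega
      · rw [if_pos h, if_pos h]
      · rw [if_neg (by omega), if_neg (by omega), if_pos h]
      · rw [if_neg (by omega), if_neg (by omega), if_neg (by omega), if_pos (by omega),
          hτl h5 _ (by omega)]
        rfl
  · tauto
  · tauto

section RightString

variable (hσ : σ.IsHomotopyString) (hτ : τ.IsHomotopyString) {a : ℤ} (ha : a ∈ g.R)

include hσ hτ ha

lemma rightString_vtx_of_lt {i : ℤ} (hi : i < a) :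
    (g.rightString a).vtx i = σ.susp.vtx i := by
  simp [rightString_eq_concat hσ hτ ha, GradedWalk.concat, GradedWalk.susp, GradedWalk.below, hi]

lemma rightString_vtx_of_ge {i : ℤ} (hi : a ≤ i) :
    (g.rightString a).vtx i = τ.vtx (a + (a + g.m) - 1 - i) := by
  rw [rightString_eq_concat hσ hτ ha]
  simp only [GradedWalk.concat, GradedWalk.bar, GradedWalk.below]
  rw [if_neg (by omega), if_pos (by omega)]

lemma rightString_letter_of_lt {i : ℤ} (hi : i < a) :
    (g.rightString a).letter i = σ.letter i := by
  simp [rightString_eq_concat hσ hτ ha, GradedWalk.concat, GradedWalk.susp, GradedWalk.below, hi]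

lemma rightString_letter_self : (g.rightString a).letter a = g.crossLetter a := by
  simp [rightString_eq_concat hσ hτ ha, GradedWalk.concat]

lemma rightString_letter_of_gt {i : ℤ} (hi : a < i) :
    (g.rightString a).letter i = FreeGroup.invRev (τ.letter (a + (a + g.m) - i)) := by
  rw [rightString_eq_concat hσ hτ ha]
  simp only [GradedWalk.concat, GradedWalk.bar, GradedWalk.below]
  rw [if_neg (by omega), if_neg (by omega), if_pos (by omega)]
  congr 2; ring

end RightString

section CrossLetter

variable (hQ : Q.IsGentle) (hσ : σ.IsHomotopyString) (hτ : τ.IsHomotopyString) {a : ℤ}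
  {f : List Q.A} {L : Q.Word} (ha : a ∈ g.R)
  (hL : CrossLetter (σ.letter a) (τ.letter (a + g.m)) f L)

include hσ hτ ha hL

/-- The letter between the two parts of the right string is a path or the inverse of a path, of the
right degree. The degree `n` refers to `P_σ`, so it is lowered by one in the right string. -/
lemma crossLetter_isPath {x y : Q.V} {m n : ℤ} (hx : τ.vtx (a + g.m - 1) = some (x, m))
    (hy : σ.vtx (a - 1) = some (y, n)) :
    (∃ p, Q.IsPath p x y ∧ L = direct p ∧ n = m + 2) ∨
    (∃ p, Q.IsPath p y x ∧ L = inverse p ∧ m = n) := by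
  obtain ⟨z, l, hz, hz'⟩ := exists_vtx ha
  generalize hu : σ.letter a = u at hL
  generalize hv : τ.letter (a + g.m) = v at hL
  rcases hL with ⟨p, _, hp, hf⟩ | ⟨q, _, hq, hf⟩ | ⟨p, q, hpq⟩ | ⟨p, q, hp, hq, hpq⟩
  · obtain ⟨z1, x1, l1, h1, h2, h3⟩ := hσ.of_direct hp hu
    obtain ⟨z2, x2, l2, h4, h5, h6⟩ := hτ.of_direct (by simp [hp]) hv
    rw [hz] at h1
    rw [hy] at h2
    rw [hz'] at h4
    rw [hx] at h5
    simp only [Option.some.injEq, Prod.mk.injEq] at h1 h2 h4 h5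
    obtain ⟨⟨rfl, rfl⟩, ⟨rfl, rfl⟩, ⟨rfl, rfl⟩, ⟨rfl, rfl⟩⟩ :=
      And.intro h1 (And.intro h2 (And.intro h4 h5))
    exact .inr ⟨f, h6.right_of_append h3 hf, rfl, rfl⟩
  · obtain ⟨z1, x1, l1, h1, h2, h3⟩ := hσ.of_inverse (by simp [hq]) hu
    obtain ⟨z2, x2, l2, h4, h5, h6⟩ := hτ.of_inverse hq hv
    rw [hz] at h1
    rw [hy] at h2
    rw [hz'] at h4
    rw [hx] at h5
    simp only [Option.some.injEq, Prod.mk.injEq] at h1 h2 h4 h5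
    obtain ⟨⟨rfl, h1⟩, ⟨rfl, h2⟩, ⟨rfl, h4⟩, ⟨rfl, h5⟩⟩ :=
      And.intro h1 (And.intro h2 (And.intro h4 h5))
    exact .inr ⟨f, h3.left_of_append h6 hf, rfl, by omega⟩
  · exfalso
    rcases hpq with rfl | rfl
    · rw [vtx_eq_none_of_lt hσ hz hu (by omega)] at hy
      simp at hy
    · rw [vtx_eq_none_of_lt hτ hz' hv (by omega)] at hx
      simp at hx
  · obtain ⟨z1, x1, l1, h1, h2, h3⟩ := hσ.of_direct hp hu
    obtain ⟨z2, x2, l2, h4, h5, h6⟩ := hτ.of_inverse hq hv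
    rw [hz] at h1
    rw [hy] at h2
    rw [hz'] at h4
    rw [hx] at h5
    simp only [Option.some.injEq, Prod.mk.injEq] at h1 h2 h4 h5
    obtain ⟨⟨rfl, h1⟩, ⟨rfl, h2⟩, ⟨rfl, h4⟩, ⟨rfl, h5⟩⟩ :=
      And.intro h1 (And.intro h2 (And.intro h4 h5))
    exact .inl ⟨q ++ p, h6.append h3 hpq, rfl, by omega⟩

omit hσ hτ ha in
lemma crossLetter_eq_nil (h : σ.letter a = [] ∨ τ.letter (a + g.m) = []) : L = [] := by
  generalize σ.letter a = u at *
  generalize τ.letter (a + g.m) = v at *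
  rcases hL with ⟨p, _, hp, hf⟩ | ⟨q, _, hq, hf⟩ | ⟨p, q, hpq⟩ | ⟨p, q, hp, hq, hpq⟩
  · simp [direct_eq_nil_iff, hp] at h
  · simp [inverse_eq_nil_iff, hq] at h
  · rfl
  · simp [inverse_eq_nil_iff, direct_eq_nil_iff, hp, hq] at h

include hQ

omit ha in
/-- The boundary between the new letter and `α`. In case of (RG1) this uses gentleness. -/
lemma crossLetter_junction_right : Junction L (σ.letter (a - 1)) := by
  have hJ := hσ.junction (a - 1)
  rw [sub_add_cancel] at hJ
  generalize hu : σ.letter a = u at *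
  generalize hv : τ.letter (a + g.m) = v at *
  rcases hL with ⟨p, _, hp, hf⟩ | ⟨q, _, hq, hf⟩ | ⟨p, q, hpq⟩ | ⟨p, q, hp, hq, hpq⟩
  · obtain ⟨_, y, l, _, hy, hpath⟩ := hσ.of_direct hp hu
    obtain ⟨_, _, _, _, _, hpath'⟩ := hτ.of_direct (by simp [hp]) hv
    obtain ⟨b, hb⟩ := Option.ne_none_iff_exists'.1 (mt List.getLast?_eq_none_iff.1 hp)
    intro u hu v hv
    rw [getLast?_inverse, Option.mem_def, Option.map_eq_some_iff] at hu
    obtain ⟨c, hc, rfl⟩ := hu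
    obtain ⟨h1, h2⟩ := isPath_junction hpath' b hb c hc
    have h3 := hJ (b, true) (by rw [getLast?_direct, hb]; rfl) v hv
    rcases v with ⟨v, _ | _⟩
    · change Q.rel v c
      by_contra h4
      obtain ⟨n, h5⟩ := hσ.source_of_head hv
      have h6 := hpath.source
      rw [hb, Option.map_some, Option.some.injEq] at h6
      rw [hy, Option.some.injEq, Prod.mk.injEq] at h5
      refine h3 (hQ.nonrel_left c b v h1 h2 ?_ h4)
      rw [← h5.1, ← h6, h1]
    · change c ≠ v
      rintro rfl
      exact h2 h3
  · rw [inverse_append] at hJ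
    exact hJ.left_of_append (by simpa [inverse_eq_nil_iff] using hf)
  · intro u hu
    simp at hu
  · rw [direct_append]
    exact hJ.append_left (by simpa [direct_eq_nil_iff] using hp)

omit ha in
/-- The boundary between `γ̄` and the new letter. In case of (RG2) this uses gentleness. -/
lemma crossLetter_junction_left :
    Junction (FreeGroup.invRev (τ.letter (a + g.m - 1))) L := by
  have hJ := (hτ.junction (a + g.m - 1)).symm
  rw [sub_add_cancel] at hJ
  generalize hu : σ.letter a = u at *
  generalize hv : τ.letter (a + g.m) = v at *
  rcases hL with ⟨p, _, hp, hf⟩ | ⟨q, _, hq, hf⟩ | ⟨p, q, hpq⟩ | ⟨p, q, hp, hq, hpq⟩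
  · rw [invRev_direct, inverse_append] at hJ
    exact hJ.right_of_append (by simpa [inverse_eq_nil_iff] using hf)
  · obtain ⟨_, _, _, _, _, hpath⟩ := hσ.of_inverse (by simp [hq]) hu
    obtain ⟨_, y, l, _, hy, hpath'⟩ := hτ.of_inverse hq hv
    obtain ⟨b, hb⟩ := Option.ne_none_iff_exists'.1 (mt List.head?_eq_none_iff.1 hq)
    rw [invRev_inverse] at hJ
    intro u hu v hv
    rw [head?_inverse, Option.mem_def, Option.map_eq_some_iff] at hv
    obtain ⟨c, hc, rfl⟩ := hv
    obtain ⟨h1, h2⟩ := isPath_junction hpath c hc b hb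
    have h3 := hJ u hu (b, true) (by rw [head?_direct, hb]; rfl)
    rcases u with ⟨u, _ | _⟩
    · change Q.rel c u
      by_contra h4
      have hu' : (u, true) ∈ (τ.letter (a + g.m - 1)).head? := by
        simpa [FreeGroup.invRev] using hu
      obtain ⟨n, h5⟩ := hτ.target_of_head hu'
      have h6 := hpath'.target
      rw [hb, Option.map_some, Option.some.injEq] at h6
      rw [hy, Option.some.injEq, Prod.mk.injEq] at h5
      refine h3 (hQ.nonrel_right c b u h1 h2 ?_ h4).symm
      rw [← h5.1, ← h6, h1]
    · change u ≠ c
      rintro rfl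
      exact h2 h3
  · intro u _ v hv
    simp at hv
  · rw [direct_append]
    rw [invRev_inverse] at hJ
    exact hJ.append_right (by simpa [direct_eq_nil_iff] using hq)

end CrossLetter

/-- The string at the right end of the overlap is a homotopy string. -/
theorem isHomotopyString_rightString (hQ : Q.IsGentle) (hσ : σ.IsHomotopyString)
    (hτ : τ.IsHomotopyString) (hg : g.CompatiblyOriented) {a : ℤ} (ha : IsLeast g.R a) :
    (g.rightString a).IsHomotopyString := by
  have hL := crossLetter_spec hQ hσ hτ hg ha
  obtain ⟨x₀, n₀, hx₀, hx₀'⟩ := exists_vtx ha.1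
  have hlt {i : ℤ} (hi : i < a) := rightString_vtx_of_lt hσ hτ ha.1 hi
  have hge {i : ℤ} (hi : a ≤ i) := rightString_vtx_of_ge hσ hτ ha.1 hi
  have llt {i : ℤ} (hi : i < a) := rightString_letter_of_lt hσ hτ ha.1 hi
  have lgt {i : ℤ} (hi : a < i) := rightString_letter_of_gt hσ hτ ha.1 hi
  have leq := rightString_letter_self hσ hτ ha.1
  have posσ {i : ℤ} (hi : i < a) : i ∈ (g.rightString a).pos ↔ i ∈ σ.pos := by
    simp [pos, hlt hi, GradedWalk.susp]
  have posτ {i : ℤ} (hi : a ≤ i) :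
      i ∈ (g.rightString a).pos ↔ a + (a + g.m) - 1 - i ∈ τ.pos := by
    simp [pos, hge hi]
  have pos_a : a ∈ σ.pos := by simp [pos, hx₀]
  have pos_a' : a + g.m ∈ τ.pos := by simp [pos, hx₀']
  refine ⟨⟨fun i hi j hj l hl => ?_⟩, fun i x m y n hx hy => ?_, fun i h => ?_, fun i => ?_,
    fun h => ?_, fun h => ?_⟩
  · obtain ⟨hl1, hl2⟩ := hl
    by_cases h : l < a
    · rw [posσ (by omega)] at hi
      rw [posσ h]
      exact hσ.ordConnected.out hi pos_a ⟨hl1, h.le⟩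
    · rw [posτ (by omega)] at hj
      rw [posτ (by omega)]
      exact hτ.ordConnected.out hj pos_a' ⟨by omega, by omega⟩
  · obtain h | rfl | h : i < a ∨ i = a ∨ a < i := by omega
    · rw [hlt h] at hx
      rw [hlt (by omega)] at hy
      rw [llt h]
      obtain ⟨⟨x', m'⟩, hx', he⟩ := Option.map_eq_some_iff.1 hx
      obtain ⟨⟨y', n'⟩, hy', he'⟩ := Option.map_eq_some_iff.1 hy
      simp only [Prod.mk.injEq] at he he'
      obtain ⟨⟨rfl, rfl⟩, rfl, rfl⟩ := And.intro he he'
      rcases hσ.letter_spec i x' m' y' n' hx' hy' with ⟨p, hp, hl, hn⟩ | ⟨p, hp, hl, hn⟩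
      · exact .inl ⟨p, hp, hl, by omega⟩
      · exact .inr ⟨p, hp, hl, by omega⟩
    · rw [hge le_rfl, show i + (i + g.m) - 1 - i = i + g.m - 1 by ring] at hx
      rw [hlt (by omega)] at hy
      rw [leq]
      obtain ⟨⟨y', n'⟩, hy', he'⟩ := Option.map_eq_some_iff.1 hy
      simp only [Prod.mk.injEq] at he'
      obtain ⟨rfl, rfl⟩ := he'
      rcases crossLetter_isPath hσ hτ ha.1 hL hx hy' with ⟨p, hp, hl, hn⟩ | ⟨p, hp, hl, hn⟩
      · exact .inl ⟨p, hp, hl, by omega⟩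
      · exact .inr ⟨p, hp, hl, by omega⟩
    · rw [hge (by omega), show a + (a + g.m) - 1 - i = a + (a + g.m) - i - 1 by ring] at hx
      rw [hge (by omega), show a + (a + g.m) - 1 - (i - 1) = a + (a + g.m) - i by ring] at hy
      rw [lgt h]
      rcases hτ.letter_spec _ y n x m hy hx with ⟨p, hp, hl, hn⟩ | ⟨p, hp, hl, hn⟩
      · exact .inr ⟨p, hp, by rw [hl, invRev_direct], hn⟩
      · exact .inl ⟨p, hp, by rw [hl, invRev_inverse], hn⟩
  · obtain h' | rfl | h' : i < a ∨ i = a ∨ a < i := by omega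
    · rw [hlt h', hlt (by omega)] at h
      rw [llt h']
      exact hσ.letter_empty i (by simpa [GradedWalk.susp] using h)
    · rw [hge le_rfl, hlt (by omega), show i + (i + g.m) - 1 - i = i + g.m - 1 by ring] at h
      rw [leq]
      refine crossLetter_eq_nil hL (h.symm.imp (fun h => hσ.letter_empty i (.inr ?_))
        fun h => hτ.letter_empty (i + g.m) (.inr h))
      simpa [GradedWalk.susp] using h
    · rw [hge (by omega), hge (by omega), show a + (a + g.m) - 1 - i = a + (a + g.m) - i - 1 by ring,
        show a + (a + g.m) - 1 - (i - 1) = a + (a + g.m) - i by ring] at h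
      rw [lgt h', hτ.letter_empty _ h.symm]
      rfl
  · obtain h | rfl | rfl | h : i < a - 1 ∨ i = a - 1 ∨ i = a ∨ a < i := by omega
    · rw [llt (by omega), llt (by omega)]
      exact hσ.junction i
    · rw [sub_add_cancel, leq, llt (by omega)]
      exact crossLetter_junction_right hQ hσ hτ hL
    · rw [leq, lgt (by omega), show i + (i + g.m) - (i + 1) = i + g.m - 1 by ring]
      exact crossLetter_junction_left hQ hσ hτ hL
    · rw [lgt (by omega), lgt h]
      have := (hτ.junction (a + (a + g.m) - (i + 1))).symm
      rwa [show a + (a + g.m) - (i + 1) + 1 = a + (a + g.m) - i by ring] at this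
  · obtain ⟨N, hN⟩ := hτ.right_infinite fun ⟨l, hl⟩ =>
      h ⟨max a (a + (a + g.m) - 1 - l), fun i hi => by
        by_cases h' : i < a
        · exact h'.le.trans (le_max_left _ _)
        · rw [posτ (by omega)] at hi
          have := hl hi
          exact le_max_of_le_right (by omega)⟩
    refine ⟨max (a + 1) (a + (a + g.m) - N), fun i hi => ?_⟩
    obtain ⟨hi1, hi2⟩ := max_le_iff.1 hi
    obtain ⟨b, hb⟩ := hN (a + (a + g.m) - i) (by omega)
    exact ⟨b, by rw [lgt (by omega), hb]; rfl⟩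
  · obtain ⟨N, hN⟩ := hσ.right_infinite fun ⟨l, hl⟩ =>
      h ⟨min a l, fun i hi => by
        by_cases h' : i < a
        · rw [posσ h'] at hi
          exact (min_le_right _ _).trans (hl hi)
        · exact (min_le_left _ _).trans (by omega)⟩
    refine ⟨min (a - 1) N, fun i hi => ?_⟩
    obtain ⟨hi1, hi2⟩ := le_min_iff.1 hi
    obtain ⟨b, hb⟩ := hN i hi2
    exact ⟨b, by rw [llt (by omega), hb]⟩

/-- The string at the left end of the overlap is a homotopy string. -/
theorem isHomotopyString_leftString (hQ : Q.IsGentle) (hσ : σ.IsHomotopyString)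
    (hτ : τ.IsHomotopyString) (hg : g.CompatiblyOriented) {b : ℤ} (hb : IsGreatest g.R b) :
    (g.leftString b).IsHomotopyString := by
  rw [leftString_eq_bar]
  exact (isHomotopyString_rightString hQ (hσ.bar 0) (hτ.bar 0) hg.bar (isLeast_bar hb)).bar 0

end GraphMapData

/-! ### The differential of the strings at the ends of the overlap -/

lemma mul_eq_zero_of_rel (k : Type u) [Field k] {p q : List Q.A} {b a : Q.A}
    (hb : b ∈ p.getLast?) (ha : a ∈ q.head?) (h : Q.s b = Q.t a → Q.rel b a) :
    letterElt k (direct p) * letterElt k (direct q) = 0 := by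
  refine mul_eq_zero_of_arr k hb ha ?_
  by_cases h' : Q.s b = Q.t a
  · exact Q.arr_mul_arr_of_rel k (h h')
  · exact Q.arr_mul_arr_of_ne k h'

lemma letterElt_direct_append (k : Type u) [Field k] {p q : List Q.A} (hp : p ≠ []) (hq : q ≠ []) :
    letterElt k (direct (p ++ q)) = letterElt k (direct p) * letterElt k (direct q) := by
  rw [letterElt_direct k hp, letterElt_direct k hq, letterElt_direct k (by simp [hp]),
    List.map_append, List.prod_append]

namespace GraphMapData

variable {σ τ : Q.GradedWalk} {g : GraphMapData σ τ}

/-- The composition of `τ̄_R` with `σ̄_L`, which starts to the right of the overlap in `τ` and ends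
to the left of it in `σ`, is zero. This is where the orientation of `σ` and `τ` is needed,
if the overlap is trivial. -/
lemma letterElt_mul_eq_zero (k : Type u) [Field k] (hQ : Q.IsGentle) (hσ : σ.IsHomotopyString)
    (hτ : τ.IsHomotopyString) (hg : g.CompatiblyOriented) {a : ℤ} (ha : IsLeast g.R a) :
    letterElt k (FreeGroup.invRev (τ.letter (a + g.m))) *
      letterElt k (FreeGroup.invRev (σ.letter (a + 1))) = 0 := by
  by_cases h0 : letterElt k (FreeGroup.invRev (τ.letter (a + g.m))) = 0
  · rw [h0, zero_mul]
  by_cases h0' : letterElt k (FreeGroup.invRev (σ.letter (a + 1))) = 0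
  · rw [h0', mul_zero]
  obtain ⟨q, hq, hq'⟩ := exists_of_letterElt_ne_zero k h0
  obtain ⟨p, hp, hp'⟩ := exists_of_letterElt_ne_zero k h0'
  have hτR : τ.letter (a + g.m) = inverse q := by rw [inverse, ← hq', FreeGroup.invRev_invRev]
  have hσL : σ.letter (a + 1) = inverse p := by rw [inverse, ← hp', FreeGroup.invRev_invRev]
  rw [hq', hp']
  obtain ⟨b, hb⟩ := Option.ne_none_iff_exists'.1 (mt List.getLast?_eq_none_iff.1 hq)
  obtain ⟨c, hc⟩ := Option.ne_none_iff_exists'.1 (mt List.head?_eq_none_iff.1 hp)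
  refine mul_eq_zero_of_rel k hb hc fun hbc => ?_
  have hJσ := hσ.junction a
  have hJτ := hτ.junction (a + g.m)
  rw [hσL] at hJσ
  rw [hτR] at hJτ
  have hc' : (c, false) ∈ (inverse p).getLast? := by rw [getLast?_inverse, hc]; rfl
  have hb' : (b, false) ∈ (inverse q).head? := by rw [head?_inverse, hb]; rfl
  rcases exists_common_last hσ ha with ⟨v, hv, hv'⟩ | ⟨hR, hfL, _, r, -, hτL⟩
  · rw [hσL] at hv
    obtain rfl := Option.mem_unique hv hc'
    exact hJτ _ hv' _ hb'
  have hRE := g.right_endpoint a ha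
  rw [hτR] at hRE
  rw [hτL] at hJτ
  generalize hu : σ.letter a = u at hRE hJσ
  generalize hv : inverse q = v at hRE
  generalize hf : g.fR = f at hRE
  rcases hRE with ⟨p', _, hp', -⟩ | ⟨q', _, hq', -⟩ | ⟨p', q'⟩
  · exact absurd hv.symm (direct_ne_inverse (by simp [hp']))
  · obtain rfl := direct_inj (FreeGroup.invRev_injective hv)
    refine hJσ _ hc' (b, false) ?_
    rw [head?_inverse, List.getLast?_append_of_ne_nil _ hq, hb]
    rfl
  · -- Both (RG3) and (LG3) hold for a trivial overlap. The product is a relation by the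
    -- orientation if `σ_R` and `τ_L` are empty, and otherwise since one of the arrows is
    -- already part of a nonzero path with the first arrow of `σ_R` or the last one of `τ_L`.
    obtain ⟨g1, g2, -, g4⟩ := hg a hR hfL hf
    rw [hu, hτR] at g1
    rw [hσL, hτL] at g2
    rw [hu, hτL, hσL, hτR] at g4
    simp only [ne_eq, direct_eq_nil_iff, inverse_eq_nil_iff, invRev_direct, invRev_inverse,
      ← direct_append, ← inverse_append] at g1 g2 g4
    by_contra hrel
    by_cases h1 : p' = []
    · by_cases h2 : r = []
      · refine g4 h1 h2 hp hq ?_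
        obtain ⟨x, y, l, -, -, hx⟩ := hσ.of_inverse hp hσL
        obtain ⟨z, w, l', -, -, hz⟩ := hτ.of_inverse hq hτR
        have e1 := hz.source
        have e2 := hx.target
        rw [hb, Option.map_some, Option.some.injEq] at e1
        rw [hc, Option.map_some, Option.some.injEq] at e2
        rw [← e1, hbc, e2] at hz
        exact ⟨q ++ p, w, x, hz.append hx fun b1 hb1 c1 hc1 => by
          rwa [Option.mem_unique hb1 hb, Option.mem_unique hc1 hc], .inr rfl⟩
      · obtain ⟨d, hd⟩ := Option.ne_none_iff_exists'.1 (mt List.getLast?_eq_none_iff.1 h2)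
        have g2' := (g2 hp h2).invRev
        rw [invRev_inverse] at g2'
        obtain ⟨x, y, hxy⟩ := isPath_of_nonzeroWord_direct g2'
        obtain ⟨h3, h4⟩ := isPath_junction hxy d hd c hc
        refine hJτ (d, true) (by rw [getLast?_direct, hd]; rfl) (b, false) hb' ?_
        exact hQ.nonrel_left c d b h3 h4 hbc hrel
    · obtain ⟨d, hd⟩ := Option.ne_none_iff_exists'.1 (mt List.head?_eq_none_iff.1 h1)
      obtain ⟨x, y, hxy⟩ := isPath_of_nonzeroWord_direct (g1 h1 hq)
      obtain ⟨h3, h4⟩ := isPath_junction hxy b hb d hd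
      refine hJσ (c, false) hc' (d, true) (by rw [head?_direct, hd]; rfl) ?_
      exact hQ.nonrel_right b c d hbc hrel h3 h4

/-- The entries of the differential of the right string are those obtained by eliminating the overlap
from the mapping cone. -/
theorem sideString_rightString (k : Type u) [Field k] (hQ : Q.IsGentle) (hσ : σ.IsHomotopyString)
    (hτ : τ.IsHomotopyString) (hg : g.CompatiblyOriented) {a : ℤ} (ha : IsLeast g.R a) :
    g.SideString k 1 a (g.rightString a) := by
  have hL := crossLetter_spec hQ hσ hτ hg ha
  have hcomp : g.component k (a - 1) = letterElt k (direct g.fR) :=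
    component_right (fun h => by have := ha.2 h; omega) (by simpa using ha.1)
  have hlt {i : ℤ} (hi : i < a) := rightString_vtx_of_lt hσ hτ ha.1 hi
  have hge {i : ℤ} (hi : a ≤ i) := rightString_vtx_of_ge hσ hτ ha.1 hi
  have llt {i : ℤ} (hi : i < a) := rightString_letter_of_lt hσ hτ ha.1 hi
  have lgt {i : ℤ} (hi : a < i) := rightString_letter_of_gt hσ hτ ha.1 hi
  have leq := rightString_letter_self hσ hτ ha.1
  refine ⟨.inl rfl, ha.1, fun r hr => ?_, fun j hj => ?_, fun j hj => ?_, fun j hj => ?_,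
    fun j hj => ?_, fun j hj => ?_, fun j hj => ?_, ?_, ?_, ?_, ?_⟩
  all_goals simp only [sidePos, one_mul, sub_zero, edge_neg_one, edge_one, sub_add_cancel]
  · have := ha.2 hr
    omega
  · exact hlt (by omega)
  · rw [hge (by omega)]
    congr 1; ring
  · rw [llt (by omega)]
  · rw [llt (by omega)]
  · rw [lgt (by omega), FreeGroup.invRev_invRev,
      show a + (a + g.m) - (a - (1 - j) + 1) = a - j + g.m by ring]
  · rw [lgt (by omega), show a + (a + g.m) - (a - -j) = a - (j + 1) + g.m + 1 by ring]
  · rw [leq, show a - 1 + g.m + 1 = a + g.m by ring]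
    clear hcomp
    generalize g.fR = f at hL
    generalize σ.letter a = u at hL ⊢
    generalize τ.letter (a + g.m) = v at hL ⊢
    generalize g.crossLetter a = L at hL ⊢
    rcases hL with ⟨p, _, hp, hf⟩ | ⟨q, _, hq, hf⟩ | ⟨p, q, rfl | rfl⟩ | ⟨p, q, hp, hq, hpq⟩
    · simp [letterElt_inverse, invRev_direct]
    · simp [letterElt_inverse]
    · simp [letterElt_direct_nil, letterElt_nil]
    · simp [letterElt_direct_nil, letterElt_nil, invRev_inverse]
    · rw [invRev_inverse, letterElt_direct_append k hq hp]
  · rw [leq, hcomp]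
    generalize σ.letter a = u at hL ⊢
    generalize τ.letter (a + g.m) = v at hL ⊢
    generalize g.crossLetter a = L at hL ⊢
    generalize g.fR = f at hL ⊢
    rcases hL with ⟨p, _, hp, hf⟩ | ⟨q, _, hq, hf⟩ | ⟨p, q, hpq⟩ | ⟨p, q, hp, hq, hpq⟩
    · rw [invRev_inverse]
    · rw [invRev_inverse]
    · rfl
    · rw [invRev_direct, letterElt_inverse, letterElt_direct_nil]
  · rw [hcomp, show a - 1 + g.m + 1 = a + g.m by ring]
    generalize σ.letter a = u at hL ⊢
    generalize τ.letter (a + g.m) = v at hL ⊢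
    generalize g.crossLetter a = L at hL ⊢
    generalize g.fR = f at hL ⊢
    rcases hL with ⟨p, _, hp, hf⟩ | ⟨q, _, hq, hf⟩ | ⟨p, q, hpq⟩ | ⟨p, q, hp, hq, hpq⟩
    · simp [letterElt_inverse, invRev_direct]
    · rw [invRev_inverse, invRev_inverse, letterElt_direct_append k hf hq]
    · simp [letterElt_inverse, invRev_direct, letterElt_direct_nil]
    · simp [letterElt_inverse, invRev_direct, letterElt_direct_nil]
  · rw [show a - 1 + g.m + 1 = a + g.m by ring]
    exact letterElt_mul_eq_zero k hQ hσ hτ hg ha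

/-- The description of a string at the right end of the reversed overlap, read at the left end. -/
lemma SideString.of_bar {k : Type u} [Field k] {b : ℤ} {C : Q.GradedWalk}
    (h : g.bar.SideString k 1 (-b) C) : g.SideString k (-1) b (C.bar 0) := by
  have e {j : ℤ} : sidePos (-1) b j = b + j := by simp [sidePos]
  have e' {j : ℤ} : sidePos 1 (-b) j = -b - j := by simp [sidePos]
  have em {j : ℤ} : 0 - (-b - j + g.bar.m) = b + j + g.m := by
    change 0 - (-b - j + -g.m) = _; ring
  have e0 {j : ℤ} : 0 - (b + j) = -b - j := by ring
  have e0' {j : ℤ} : 0 - (-b - j) = b + j := by ring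
  have en {j : ℤ} : -(-b - j) = b + j := by ring
  obtain ⟨-, h1, h2, h3, h4, h5, h6, h7, h8, h9, h10, h11, h12⟩ := h
  simp only [e', edge_bar_one, edge_bar_neg_one, em, e0', component_bar,
    en] at h5 h6 h7 h8 h9 h10 h11 h12 ⊢
  simp only [e'] at h3 h4
  refine ⟨.inr rfl, by simpa using (show - -b ∈ g.R from h1), fun r hr => ?_,
    fun j hj => ?_, fun j hj => ?_, fun j hj => ?_, fun j hj => ?_, fun j hj => ?_, fun j hj => ?_, ?_, ?_, ?_, ?_⟩
  all_goals try simp only [e, neg_neg, edge_bar_one, edge_bar_neg_one, e0]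
  · have := h2 (-r) (show - -r ∈ g.R by simpa using hr)
    linarith
  · have := h3 j hj
    simp only [GradedWalk.bar, GradedWalk.susp, e0'] at this ⊢
    rw [e0, this]
  · have := h4 j hj
    simp only [GradedWalk.bar, em] at this ⊢
    rw [e0, this]
  · exact h5 j hj
  · exact h6 j hj
  · exact h7 j hj
  · exact h8 j hj
  · exact h9
  · exact h10
  · exact h11
  · exact h12

theorem sideString_leftString (k : Type u) [Field k] (hQ : Q.IsGentle) (hσ : σ.IsHomotopyString)
    (hτ : τ.IsHomotopyString) (hg : g.CompatiblyOriented) {b : ℤ} (hb : IsGreatest g.R b) :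
    g.SideString k (-1) b (g.leftString b) := by
  rw [leftString_eq_bar]
  exact (sideString_rightString k hQ (hσ.bar 0) (hτ.bar 0) hg.bar (isLeast_bar hb)).of_bar

/-- An overlap without right end does not leave a summand on its right. -/
def sideRetractOfNotBddBelow (k : Type u) [Field k] (h : ¬ BddBelow g.R) :
    g.SideRetract k 1 .empty := by
  have h' : ∀ i, ∃ r ∈ g.R, r < i := by
    simpa [bddBelow_def] using h
  refine .ofUnbounded (fun i hi => ?_) (fun i hi => ?_)
  · obtain ⟨r, hr, hr'⟩ := h' i
    have := hi r hr
    omega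
  · obtain ⟨r, hr, hr'⟩ := h' i
    exact g.ordConnected.out hr hi ⟨by omega, by omega⟩

/-- An overlap without left end does not leave a summand on its left. -/
def sideRetractOfNotBddAbove (k : Type u) [Field k] (h : ¬ BddAbove g.R) :
    g.SideRetract k (-1) .empty := by
  have h' : ∀ i, ∃ r ∈ g.R, i < r := by
    simpa [bddAbove_def] using h
  refine .ofUnbounded (fun i hi => ?_) (fun i hi => ?_)
  · obtain ⟨r, hr, hr'⟩ := h' i
    have := hi r hr
    omega
  · obtain ⟨r, hr, hr'⟩ := h' i
    exact g.ordConnected.out hi hr ⟨by omega, by omega⟩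

end GraphMapData

end BoundQuiver

end

theorem mainTheorem1 {k : Type u} [Field k] (Q : BoundQuiver.{u}) (hQ : Q.IsGentle)
    {Λ : Type u} [Ring Λ] [Algebra k Λ] (E : MoritaEquivalence k (Q.Alg k) Λ)
    (σ τ : Q.GradedWalk) (hσ : σ.IsHomotopyString) (hτ : τ.IsHomotopyString)
    (g : GraphMapData σ τ) (hg : g.CompatiblyOriented) :
    (∀ a b, IsLeast g.R a → IsGreatest g.R b →
      ∃ (h₁ : (g.rightString a).IsHomotopyString) (h₂ : (g.leftString b).IsHomotopyString),
        IsoInK (CochainComplex.mappingCone (graphMapOver E hQ hσ hτ g))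
          (stringComplexOver E h₁ ⊞ stringComplexOver E h₂)) ∧
    (∀ a, IsLeast g.R a → ¬ BddAbove g.R →
      ∃ h : (g.rightString a).IsHomotopyString,
        IsoInK (CochainComplex.mappingCone (graphMapOver E hQ hσ hτ g))
          (stringComplexOver E h)) ∧
    (∀ b, IsGreatest g.R b → ¬ BddBelow g.R →
      ∃ h : (g.leftString b).IsHomotopyString,
        IsoInK (CochainComplex.mappingCone (graphMapOver E hQ hσ hτ g))
          (stringComplexOver E h)) ∧
    (¬ BddAbove g.R → ¬ BddBelow g.R →
      ∃ h : (GradedWalk.empty : Q.GradedWalk).IsHomotopyString,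
        IsoInK (CochainComplex.mappingCone (graphMapOver E hQ hσ hτ g))
          (stringComplexOver E h)) := by
  have h₀ : (GradedWalk.empty : Q.GradedWalk).IsHomotopyString :=
    GradedWalk.isHomotopyString_empty
  have hz := isZero_stringComplexOver_empty E h₀
  refine ⟨fun a b ha hb => ?_, fun a ha hb => ?_, fun b hb ha => ?_, fun hb ha => ?_⟩
  · have h₁ := GraphMapData.isHomotopyString_rightString hQ hσ hτ hg ha
    have h₂ := GraphMapData.isHomotopyString_leftString hQ hσ hτ hg hb
    exact ⟨h₁, h₂, isoInK_biprod E hQ hσ hτ g h₁ h₂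
      (GraphMapData.nonempty_homotopyEquiv_of_sideRetract hQ hσ hτ h₁ h₂
        ((GraphMapData.sideString_rightString k hQ hσ hτ hg ha).sideRetract hσ hτ)
        ((GraphMapData.sideString_leftString k hQ hσ hτ hg hb).sideRetract hσ hτ))⟩
  · have h₁ := GraphMapData.isHomotopyString_rightString hQ hσ hτ hg ha
    exact ⟨h₁, (isoInK_biprod E hQ hσ hτ g h₁ h₀
      (GraphMapData.nonempty_homotopyEquiv_of_sideRetract hQ hσ hτ h₁ h₀
        ((GraphMapData.sideString_rightString k hQ hσ hτ hg ha).sideRetract hσ hτ)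
        (GraphMapData.sideRetractOfNotBddAbove k hb))).trans_iso (Limits.isoBiprodZero hz).symm⟩
  · have h₂ := GraphMapData.isHomotopyString_leftString hQ hσ hτ hg hb
    exact ⟨h₂, (isoInK_biprod E hQ hσ hτ g h₀ h₂
      (GraphMapData.nonempty_homotopyEquiv_of_sideRetract hQ hσ hτ h₀ h₂
        (GraphMapData.sideRetractOfNotBddBelow k ha)
        ((GraphMapData.sideString_leftString k hQ hσ hτ hg hb).sideRetract hσ hτ))).trans_iso
          (Limits.isoZeroBiprod hz).symm⟩
  · exact ⟨h₀, (isoInK_biprod E hQ hσ hτ g h₀ h₀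
      (GraphMapData.nonempty_homotopyEquiv_of_sideRetract hQ hσ hτ h₀ h₀
        (GraphMapData.sideRetractOfNotBddBelow k ha)
        (GraphMapData.sideRetractOfNotBddAbove k hb))).trans_iso (Limits.isoZeroBiprod hz).symm⟩
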